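/- **Setting.** Let $d\ge 2$, let $\Omega\subset\mathbb R^d$ be a bounded open set (e.g. a bounded Lipschitz domain), and let $A\in L^\infty(\Omega;\mathbb R^{d\times d}_{\rm sym})$, $\boldsymbol b\in L^\infty(\Omega;\mathbb R^d)$, $c\in L^\infty(\Omega)$, with $A$ uniformly positive definite, such that $a(u,v)=\int_\Omega A\nabla u\cdot\nabla v+\int_\Omega \boldsymbol b\cdot\nabla u\,v+\int_\Omega cuv$ is elliptic on $H^1_0(\Omega)$. Put $|\!|\!|v|\!|\!|^2=\int_\Omega A\nabla v\cdot\nabla v$. Let $\mathcal K:H^1_0(\Omega)\to H^{-1}(\Omega)$ be linear, bounded and **compact**, and $b(v,w)=\langle\mathcal Kv,w\rangle$. Given $f\in L^2(\Omega)$, $\boldsymbol f\in L^2(\Omega)^d$, let $u\in H^1_0(\Omega)$ solve $a(u,v)=\int_\Omega fv-\int_\Omega\boldsymbol f\cdot\nabla v$ for all $v\in H^1_0(\Omega)$ and, for $w\in H^1_0(\Omega)$, let $z[w]\in H^1_0(\Omega)$ solve $a(v,z[w])=b(v,w)+b(w,v)$ for all $v\in H^1_0(\Omega)$. For a conforming simplicial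 triangulation $\mathcal T_H$ of $\Omega$ and fixed $p\ge1$ let $\mathcal X_H\subset H^1_0(\Omega)$ be the functions that are polynomials of degree $\le p$ on each element, and let $u_H,z_H[w]\in\mathcal X_H$ be the Galerkin approximations of $u$, $z[w]$. **Meshes.** Let $\mathcal T_0$ be an initial conforming triangulation and $(\mathcal T,\mathcal M)\mapsto{\tt refine}(\mathcal T,\mathcal M)$ a refinement strategy; $\mathbb T(\mathcal T_H)$ is the set of all meshes obtained from $\mathcal T_H$ by finitely many refinement steps, $\mathbb T=\mathbb T(\mathcal T_0)$. Assume that all $\mathcal T\in\mathbb T$ are conforming triangulations of $\Omega$, that elements of a refined mesh are contained in elements of the old one, that $\mathcal M\subseteq\mathcal T\setminus{\tt refine}(\mathcal T,\mathcal M)$, that $\#(\mathcal T_H\setminus\mathcal T_h)+\#\mathcal T_H\le\#\mathcal T_h$ for $\mathcal T_h\in\mathbb T(\mathcal T_H)$, that $\#\mathcal T_\ell-\#\mathcal T_0\le C_{\rm mesh}\sum_{j<\ell}\#\mathcal M_j$ whenever $\mathcal T_{j+1}={\tt refine}(\mathcal T_j,\mathcal M_j)$ with $\mathcal M_j\subseteq\mathcal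 T_j$, and that any two meshes $\mathcal T_H,\mathcal T_h\in\mathbb T$ have a common refinement in $\mathbb T(\mathcal T_H)\cap\mathbb T(\mathcal T_h)$ with at most $\#\mathcal T_H+\#\mathcal T_h-\#\mathcal T_0$ elements. **Estimators.** Let $\eta_H(T,v)\ge0$ and $\zeta_H[w](T,v)\ge0$ be refinement indicators for $T\in\mathcal T_H\in\mathbb T$, $v\in\mathcal X_H$, $w\in H^1_0(\Omega)$ (the primal problem, and the dual problem with linearization point $w$). Put $\eta_H(\mathcal U,v)^2=\sum_{T\in\mathcal U}\eta_H(T,v)^2$, $\eta_H(v)=\eta_H(\mathcal T_H,v)$, similarly for $\zeta_H[w]$, and $\zeta_H(\mathcal U,z_H[w]):=\zeta_H[w](\mathcal U,z_H[w])$. Assume, with constants $C_{\rm stab},C_{\rm rel},C_{\rm drel}>0$, $C_{\rm lip}\ge0$, $0<q_{\rm red}<1$, for all $\mathcal T_H\in\mathbb T$, $\mathcal T_h\in\mathbb T(\mathcal T_H)$ and all $w,w'\in H^1_0(\Omega)$: * (A1) $|\eta_h(\mathcal U,v_h)-\eta_H(\mathcal U,v_H)|+|\zeta_h[w](\mathcal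 U,v_h)-\zeta_H[w'](\mathcal U,v_H)|\le C_{\rm stab}|\!|\!|v_h-v_H|\!|\!|+C_{\rm lip}|\!|\!|w-w'|\!|\!|$ for all $\mathcal U\subseteq\mathcal T_h\cap\mathcal T_H$, $v_h\in\mathcal X_h$, $v_H\in\mathcal X_H$; * (A2) $\eta_h(\mathcal T_h\setminus\mathcal T_H,v_H)\le q_{\rm red}\,\eta_H(\mathcal T_H\setminus\mathcal T_h,v_H)$ for all $v_H\in\mathcal X_H$, and the same for $\zeta[w]$; * (A3) $|\!|\!|u-u_H|\!|\!|\le C_{\rm rel}\,\eta_H(u_H)$ and $|\!|\!|z[w]-z_H[w]|\!|\!|\le C_{\rm rel}\,\zeta_H(z_H[w])$; * (A4) $|\!|\!|u_h-u_H|\!|\!|\le C_{\rm drel}\,\eta_H(\mathcal T_H\setminus\mathcal T_h,u_H)$ and $|\!|\!|z_h[w]-z_H[w]|\!|\!|\le C_{\rm drel}\,\zeta_H(\mathcal T_H\setminus\mathcal T_h,z_H[w])$. ($C_{\rm lip}=0$ is the case of indicators $\zeta_H(T,v)$ that do not depend on $w$.) Write $E_H(\mathcal U)=\eta_H(\mathcal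 U,u_H)^2+\zeta_H(\mathcal U,z_H[u_H])^2$ and $E_H=E_H(\mathcal T_H)=\eta_H(u_H)^2+\zeta_H(z_H[u_H])^2$. **Algorithm B.** With parameters $0<\theta\le1$, $C_{\rm mark}\ge1$, for $\ell=0,1,2,\dots$: choose $\mathcal M_\ell\subseteq\mathcal T_\ell$ with $\theta E_\ell\le E_\ell(\mathcal M_\ell)$ whose cardinality is minimal up to the factor $C_{\rm mark}$ among all such sets, and set $\mathcal T_{\ell+1}={\tt refine}(\mathcal T_\ell,\mathcal M_\ell)$. **Approximation classes.** With $\mathbb T_N=\{\mathcal T\in\mathbb T:\#\mathcal T-\#\mathcal T_0\le N\}$ and $s,t>0$, let $\|u\|_{\mathbb A_s}=\sup_N(N+1)^s\min_{\mathcal T_H\in\mathbb T_N}\eta_H(u_H)$ and $\|z[u]\|_{\mathbb A_t}=\sup_N(N+1)^t\min_{\mathcal T_H\in\mathbb T_N}\zeta_H(z_H[u])$ in $[0,\infty]$. **Theorem.** (i) For all $0<\theta\le1$ there are $\ell_0\in\mathbb N_0$, $C_{\rm lin}>0$, $0<q_{\rm lin}<1$, depending only on $\theta$, $q_{\rm red}$,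 $C_{\rm stab}$, $C_{\rm lip}$, $C_{\rm rel}$, $a(\cdot,\cdot)$ and $\mathcal K$, such that Algorithm B guarantees, for every $C_{\rm mark}\ge1$ and all $n\ge\ell\ge\ell_0$, $$\eta_n(u_n)^2+\zeta_n(z_n[u_n])^2\le C_{\rm lin}\,q_{\rm lin}^{\,n-\ell}\,\big[\eta_\ell(u_\ell)^2+\zeta_\ell(z_\ell[u_\ell])^2\big].$$ (ii) There are constants $\widehat C_{\rm stab},\widehat C_{\rm drel}>0$, depending only on the constants in (A1)–(A4), $a(\cdot,\cdot)$ and $\mathcal K$, with which the combined estimator is stable and discretely reliable, i.e. for all $\mathcal T_H\in\mathbb T$, $\mathcal T_h\in\mathbb T(\mathcal T_H)$, $\mathcal U\subseteq\mathcal T_h\cap\mathcal T_H$, $v_h,w_h\in\mathcal X_h$, $v_H,w_H\in\mathcal X_H$, $$\Big|\big[\eta_h(\mathcal U,v_h)^2+\zeta_h[v_h](\mathcal U,w_h)^2\big]^{1/2}-\big[\eta_H(\mathcal U,v_H)^2+\zeta_H[v_H](\mathcal U,w_H)^2\big]^{1/2}\Big|\le\widehat C_{\rm stab}\big[|\!|\!|v_h-v_H|\!|\!|+|\!|\!|w_h-w_H|\!|\!|\big],$$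 $$|\!|\!|u_h-u_H|\!|\!|+|\!|\!|z_h[u_h]-z_H[u_H]|\!|\!|\le\widehat C_{\rm drel}\,E_H(\mathcal T_H\setminus\mathcal T_h)^{1/2}.$$ For any such constants, all $0<\theta<\theta_{\rm opt}:=(1+\widehat C_{\rm stab}^2\widehat C_{\rm drel}^2)^{-1}$ and all $s,t>0$, there is $C_{\rm opt}>0$, depending only on $\theta$, $C_{\rm mesh}$, $C_{\rm mark}$, $s$, $t$, the constants of (A1)–(A4), $\widehat C_{\rm stab}$, $\widehat C_{\rm drel}$, $a(\cdot,\cdot)$ and $\mathcal K$, such that, if $\|u\|_{\mathbb A_s}+\|z[u]\|_{\mathbb A_t}<\infty$, Algorithm B guarantees, with the same $\ell_0$ as in (i), for all $\ell\ge\ell_0$, $$\eta_\ell(u_\ell)^2+\zeta_\ell(z_\ell[u_\ell])^2\le C_{\rm opt}\,\big(\|u\|_{\mathbb A_s}^2+\|z[u]\|_{\mathbb A_t}^2\big)\,(\#\mathcal T_\ell-\#\mathcal T_0)^{-\beta},\qquad\beta:=\min\{2s,2t\},\tag{1}$$ where $0^{-\beta}:=\infty$. (ii′) If $0<\theta<(1+(C_{\rm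 stab}+C_{\rm lip})^2C_{\rm drel}^2)^{-1}$ (for $C_{\rm lip}=0$ this is $(1+C_{\rm stab}^2C_{\rm drel}^2)^{-1}$ with the constants of (A1) and (A4)), then for every run of Algorithm B there is $\ell_0\in\mathbb N_0$ such that, for all $s,t>0$ with $\|u\|_{\mathbb A_s}+\|z[u]\|_{\mathbb A_t}<\infty$ and all $\ell\ge\ell_0$, (1) holds with $C_{\rm opt}=C\,(\#\mathcal T_{\ell_0}-\#\mathcal T_0+1)^{\beta}$, where $C>0$ depends only on $\theta$, $C_{\rm mesh}$, $C_{\rm mark}$, $s$, $t$, the constants of (A1)–(A4), $a(\cdot,\cdot)$ and $\mathcal K$. -/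

import Mathlib

open MeasureTheory
open scoped ENNReal ContDiff Matrix

noncomputable section

namespace GOAFEM

/-! ### The Sobolev space `H¹₀(Ω)` -/

/-- Points of `ℝᵈ` with the Euclidean norm. -/
abbrev Pt (d : ℕ) : Type := EuclideanSpace ℝ (Fin d)

/-- The Hilbert space `L²(Ω) × L²(Ω; ℝᵈ)` with norm `(‖v‖² + ‖g‖²)^{1/2}`. -/
abbrev L2Pair {d : ℕ} (Ω : Set (Pt d)) : Type :=
  WithLp 2 (Lp ℝ 2 (volume.restrict Ω) × Lp (Pt d) 2 (volume.restrict Ω))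

/-- The pairs `(φ, ∇φ)` for smooth `φ` with compact support in `Ω`. -/
def testPairs {d : ℕ} (Ω : Set (Pt d)) : Submodule ℝ (L2Pair Ω) where
  carrier := {q | ∃ φ : Pt d → ℝ, ContDiff ℝ ∞ φ ∧ HasCompactSupport φ ∧ tsupport φ ⊆ Ω ∧
    q.fst =ᵐ[volume.restrict Ω] φ ∧ q.snd =ᵐ[volume.restrict Ω] gradient φ}
  zero_mem' := by
    refine ⟨0, contDiff_const, HasCompactSupport.zero, by simp [tsupport], ?_, ?_⟩
    · exact Lp.coeFn_zero _ _ _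
    · refine (Lp.coeFn_zero _ _ _).trans (Filter.Eventually.of_forall fun x => ?_)
      simp [gradient]
  add_mem' := by
    rintro q r ⟨φ, hφ, hφc, hφs, h1, h2⟩ ⟨ψ, hψ, hψc, hψs, h3, h4⟩
    refine ⟨φ + ψ, hφ.add hψ, hφc.add hψc,
      (tsupport_add φ ψ).trans (Set.union_subset hφs hψs), ?_, ?_⟩
    · exact (Lp.coeFn_add _ _).trans (h1.add h3)
    · refine ((Lp.coeFn_add _ _).trans (h2.add h4)).trans
        (Filter.Eventually.of_forall fun x => ?_)
      have e : fderiv ℝ (φ + ψ) x = fderiv ℝ φ x + fderiv ℝ ψ x :=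
        fderiv_add (hφ.differentiable (by simp) x) (hψ.differentiable (by simp) x)
      simp [gradient, e]
  smul_mem' := by
    rintro c q ⟨φ, hφ, hφc, hφs, h1, h2⟩
    refine ⟨c • φ, contDiff_const.smul hφ, hφc.smul_left (f := fun _ => c),
      (closure_mono (Function.support_const_smul_subset c φ)).trans hφs, ?_, ?_⟩
    · exact (Lp.coeFn_smul _ _).trans (h1.const_smul c)
    · refine ((Lp.coeFn_smul _ _).trans (h2.const_smul c)).trans
        (Filter.Eventually.of_forall fun x => ?_)
      have e : fderiv ℝ (c • φ) x = c • fderiv ℝ φ x :=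
        fderiv_const_smul (hφ.differentiable (by simp) x) c
      simp [gradient, e]

/-- `H¹₀(Ω)`: the closure of the smooth functions with compact support in `Ω` with respect to the
`H¹`-norm. An element is the pair `(v, ∇v)` of a function and its weak gradient. -/
def H10 {d : ℕ} (Ω : Set (Pt d)) : Submodule ℝ (L2Pair Ω) :=
  (testPairs Ω).topologicalClosure

/-- The function itself. -/
def fn {d : ℕ} {Ω : Set (Pt d)} (v : H10 Ω) : Lp ℝ 2 (volume.restrict Ω) := v.1.fst

/-- Its weak gradient. -/
def grad {d : ℕ} {Ω : Set (Pt d)} (v : H10 Ω) : Lp (Pt d) 2 (volume.restrict Ω) := v.1.snd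

/-! ### The elliptic problem -/

/-- The coefficients of `-div A∇u + b·∇u + c u`. -/
structure Coeff (d : ℕ) where
  A : Pt d → Matrix (Fin d) (Fin d) ℝ
  b : Pt d → Pt d
  c : Pt d → ℝ

/-- `∫_Ω A∇u · ∇v`. -/
def principal {d : ℕ} (κ : Coeff d) (Ω : Set (Pt d)) (u v : H10 Ω) : ℝ :=
  ∫ x in Ω, (κ.A x *ᵥ (grad u x).ofLp) ⬝ᵥ (grad v x).ofLp

/-- `a(u,v) = ∫_Ω A∇u · ∇v + ∫_Ω (b·∇u) v + ∫_Ω c u v`. -/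
def form {d : ℕ} (κ : Coeff d) (Ω : Set (Pt d)) (u v : H10 Ω) : ℝ :=
  principal κ Ω u v
    + (∫ x in Ω, inner ℝ (κ.b x) (grad u x) * fn v x)
    + ∫ x in Ω, κ.c x * fn u x * fn v x

/-- The energy norm `(∫_Ω A∇v · ∇v)^{1/2}`. -/
def energyNorm {d : ℕ} (κ : Coeff d) {Ω : Set (Pt d)} (v : H10 Ω) : ℝ :=
  √(principal κ Ω v v)

/-- Assumptions on the coefficients: bounded, `A` symmetric and uniformly positive definite, and
`a(·,·)` elliptic on `H¹₀(Ω)`. -/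
structure Coeff.Admissible {d : ℕ} (κ : Coeff d) (Ω : Set (Pt d)) : Prop where
  bounded_A : ∀ i j, MemLp (fun x => κ.A x i j) ∞ (volume.restrict Ω)
  bounded_b : MemLp κ.b ∞ (volume.restrict Ω)
  bounded_c : MemLp κ.c ∞ (volume.restrict Ω)
  symm : ∀ᵐ x ∂(volume.restrict Ω), (κ.A x).IsSymm
  posDef : ∃ α : ℝ, 0 < α ∧ ∀ᵐ x ∂(volume.restrict Ω), ∀ y : Pt d,
    α * ‖y‖ ^ 2 ≤ y.ofLp ⬝ᵥ (κ.A x *ᵥ y.ofLp)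
  elliptic : ∃ Cell : ℝ, 0 < Cell ∧ ∀ v : H10 Ω, Cell * ‖v‖ ^ 2 ≤ form κ Ω v v

/-- Bounded operators `𝒦 : H¹₀(Ω) → H⁻¹(Ω) = H¹₀(Ω)'`; `b(v,w) = ⟨𝒦 v, w⟩` is `K v w`. -/
abbrev GoalOp {d : ℕ} (Ω : Set (Pt d)) : Type := H10 Ω →L[ℝ] StrongDual ℝ (H10 Ω)

/-! ### Triangulations and finite element spaces -/

/-- A simplex, given by its set of vertices. -/
abbrev Element (d : ℕ) : Type := Finset (Pt d)

/-- A finite set of simplices. -/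
abbrev Mesh (d : ℕ) : Type := Finset (Element d)

/-- The compact simplex spanned by the vertices. -/
def Element.hull {d : ℕ} (T : Element d) : Set (Pt d) := convexHull ℝ (T : Set (Pt d))

/-- Conforming triangulations of `Ω` into compact nondegenerate simplices: two elements meet in the
convex hull of their common vertices. -/
structure IsTriangulation {d : ℕ} (Ω : Set (Pt d)) (𝒯 : Mesh d) : Prop where
  card_vertices : ∀ T ∈ 𝒯, T.card = d + 1
  nondegenerate : ∀ T ∈ 𝒯, AffineIndependent ℝ (fun x : T => (x : Pt d))
  conforming : ∀ T ∈ 𝒯, ∀ T' ∈ 𝒯,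
    T.hull ∩ T'.hull = convexHull ℝ ((T : Set (Pt d)) ∩ (T' : Set (Pt d)))
  cover : ⋃ T ∈ 𝒯, Element.hull T = closure Ω

/-- The functions `v ∈ H¹₀(Ω)` such that `v|_T` is a polynomial of degree at most `p` for all
`T ∈ 𝒯`. -/
def feSpace {d : ℕ} (Ω : Set (Pt d)) (p : ℕ) (𝒯 : Mesh d) : Submodule ℝ (H10 Ω) where
  carrier := {v | ∀ T ∈ 𝒯, ∃ P : MvPolynomial (Fin d) ℝ, P.totalDegree ≤ p ∧
    ∀ᵐ x ∂(volume.restrict Ω), x ∈ Element.hull T → fn v x = MvPolynomial.eval x.ofLp P}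
  zero_mem' := fun T _ => by
    refine ⟨0, by simp, ?_⟩
    have h : (fn (0 : H10 Ω) : Pt d → ℝ) =ᵐ[volume.restrict Ω] 0 := Lp.coeFn_zero _ _ _
    filter_upwards [h] with x hx _
    simp [hx]
  add_mem' := by
    intro v w hv hw T hT
    obtain ⟨P, hP, h1⟩ := hv T hT
    obtain ⟨Q, hQ, h2⟩ := hw T hT
    refine ⟨P + Q, (MvPolynomial.totalDegree_add P Q).trans (max_le hP hQ), ?_⟩
    have h : (fn (v + w) : Pt d → ℝ) =ᵐ[volume.restrict Ω] fn v + fn w :=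
      Lp.coeFn_add _ _
    filter_upwards [h, h1, h2] with x hx h1 h2 hxT
    simp [hx, h1 hxT, h2 hxT]
  smul_mem' := by
    intro c v hv T hT
    obtain ⟨P, hP, h1⟩ := hv T hT
    refine ⟨c • P, (MvPolynomial.totalDegree_smul_le c P).trans hP, ?_⟩
    have h : (fn (c • v) : Pt d → ℝ) =ᵐ[volume.restrict Ω] c • (fn v : Pt d → ℝ) :=
      Lp.coeFn_smul _ _
    filter_upwards [h, h1] with x hx h1 hxT
    simp [hx, h1 hxT]

/-! ### The data of the adaptive algorithm -/

/-- The polynomial degree `p`, the right-hand side `f + div 𝐟`, the initial mesh `𝒯₀`, the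
refinement strategy `(𝒯, ℳ) ↦ refine(𝒯, ℳ)`, the primal refinement indicators
`η_H(T, v) = eta 𝒯_H T v`, and the dual ones. The latter belong to a dual problem
whose right-hand side `v ↦ b(v,w) + b(w,v)` depends on `w`, and so do residual indicators:
`ζ_H[w](T, v) = zeta 𝒯_H w T v`. -/
structure Data {d : ℕ} (Ω : Set (Pt d)) where
  p : ℕ
  f : Lp ℝ 2 (volume.restrict Ω)
  fvec : Lp (Pt d) 2 (volume.restrict Ω)
  mesh₀ : Mesh d
  refineMesh : Mesh d → Finset (Element d) → Mesh d
  eta : Mesh d → Element d → H10 Ω → ℝ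
  zeta : Mesh d → H10 Ω → Element d → H10 Ω → ℝ

namespace Data

variable {d : ℕ} {Ω : Set (Pt d)}

/-- `𝒯' ∈ 𝕋(𝒯)`: the mesh `𝒯'` is obtained from `𝒯` by finitely many steps of refinement. -/
def Refinement (D : Data Ω) : Mesh d → Mesh d → Prop :=
  Relation.ReflTransGen fun 𝒯 𝒯' => ∃ ℳ ⊆ 𝒯, 𝒯' = D.refineMesh 𝒯 ℳ

/-- `𝒯 ∈ 𝕋 = 𝕋(𝒯₀)`. -/
def IsMesh (D : Data Ω) (𝒯 : Mesh d) : Prop := D.Refinement D.mesh₀ 𝒯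

/-- The finite element space `𝒳_H` of the mesh `𝒯_H`. -/
def space (D : Data Ω) (𝒯 : Mesh d) : Submodule ℝ (H10 Ω) := feSpace Ω D.p 𝒯

open Classical in
/-- The assumptions on the polynomial degree and on the mesh refinement. -/
structure MeshAssumptions (D : Data Ω) (Cmesh : ℝ) : Prop where
  degree : 1 ≤ D.p
  triangulation : ∀ 𝒯, D.IsMesh 𝒯 → IsTriangulation Ω 𝒯
  /-- marked elements are refined -/
  marked : ∀ 𝒯, D.IsMesh 𝒯 → ∀ ℳ ⊆ 𝒯, ℳ ⊆ 𝒯 \ D.refineMesh 𝒯 ℳ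
  /-- a refined mesh consists of elements of the old mesh and of parts of them -/
  subdivision : ∀ 𝒯, D.IsMesh 𝒯 → ∀ ℳ ⊆ 𝒯, ∀ T' ∈ D.refineMesh 𝒯 ℳ,
    ∃ T ∈ 𝒯, Element.hull T' ⊆ Element.hull T
  /-- each refined element has at least two sons -/
  sons : ∀ 𝒯 𝒯', D.IsMesh 𝒯 → D.Refinement 𝒯 𝒯' →
    (𝒯 \ 𝒯').card + 𝒯.card ≤ 𝒯'.card
  /-- mesh-closure estimate -/
  closure : ∀ (𝒯 : ℕ → Mesh d) (ℳ : ℕ → Finset (Element d)), 𝒯 0 = D.mesh₀ →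
    (∀ j, ℳ j ⊆ 𝒯 j ∧ 𝒯 (j + 1) = D.refineMesh (𝒯 j) (ℳ j)) →
    ∀ ℓ, ((𝒯 ℓ).card : ℝ) - D.mesh₀.card ≤ Cmesh * ∑ j ∈ Finset.range ℓ, ((ℳ j).card : ℝ)
  /-- overlay estimate -/
  overlay : ∀ 𝒯 𝒯', D.IsMesh 𝒯 → D.IsMesh 𝒯' →
    ∃ 𝒯'', D.Refinement 𝒯 𝒯'' ∧ D.Refinement 𝒯' 𝒯'' ∧
      𝒯''.card + D.mesh₀.card ≤ 𝒯.card + 𝒯'.card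

/-! #### Exact and discrete solutions -/

/-- The right-hand side `F(v) = ∫_Ω f v - ∫_Ω 𝐟 · ∇v`. -/
def rhs (D : Data Ω) (v : H10 Ω) : ℝ :=
  (∫ x in Ω, D.f x * fn v x) - ∫ x in Ω, inner ℝ (D.fvec x) (grad v x)

/-- The solution `u_X ∈ X` of `a(u_X, v) = F(v)` for all `v ∈ X`. For closed `X` it exists and is
unique by the Lax-Milgram lemma. -/
def primalIn (D : Data Ω) (κ : Coeff d) (X : Submodule ℝ (H10 Ω)) : H10 Ω :=
  Classical.epsilon fun u => u ∈ X ∧ ∀ v ∈ X, form κ Ω u v = D.rhs v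

/-- The solution `z_X[w] ∈ X` of `a(v, z_X[w]) = b(v,w) + b(w,v)` for all `v ∈ X`. -/
def _root_.GOAFEM.dualIn (κ : Coeff d) (K : GoalOp Ω) (X : Submodule ℝ (H10 Ω)) (w : H10 Ω) :
    H10 Ω :=
  Classical.epsilon fun z => z ∈ X ∧ ∀ v ∈ X, form κ Ω v z = K v w + K w v

/-- The exact primal solution `u`. -/
def sol (D : Data Ω) (κ : Coeff d) : H10 Ω := D.primalIn κ ⊤

/-- The exact dual solution `z[w]`. -/
def _root_.GOAFEM.dualSol (κ : Coeff d) (K : GoalOp Ω) (w : H10 Ω) : H10 Ω := dualIn κ K ⊤ w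

/-- The discrete primal solution `u_H`. -/
def solH (D : Data Ω) (κ : Coeff d) (𝒯 : Mesh d) : H10 Ω := D.primalIn κ (D.space 𝒯)

/-- The discrete dual solution `z_H[w]`. -/
def dualH (D : Data Ω) (κ : Coeff d) (K : GoalOp Ω) (𝒯 : Mesh d) (w : H10 Ω) : H10 Ω :=
  dualIn κ K (D.space 𝒯) w

/-! #### Error estimators -/

/-- `η_H(𝒰, v) = (∑_{T ∈ 𝒰} η_H(T, v)²)^{1/2}`. -/
def etaOn (D : Data Ω) (𝒯 : Mesh d) (𝒰 : Finset (Element d)) (v : H10 Ω) : ℝ :=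
  √(∑ T ∈ 𝒰, D.eta 𝒯 T v ^ 2)

/-- `ζ_H[w](𝒰, v) = (∑_{T ∈ 𝒰} ζ_H[w](T, v)²)^{1/2}`. -/
def zetaOn (D : Data Ω) (𝒯 : Mesh d) (w : H10 Ω) (𝒰 : Finset (Element d)) (v : H10 Ω) : ℝ :=
  √(∑ T ∈ 𝒰, D.zeta 𝒯 w T v ^ 2)

open Classical in
/-- The axioms of adaptivity. `Clip` controls the dependence of `ζ_H[w]` on `w`; `Clip = 0` is the
case of indicators `ζ_H(T, v)` that do not depend on `w`. -/
structure Axioms (D : Data Ω) (κ : Coeff d) (K : GoalOp Ω)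
    (Cstab Clip qred Crel Cdrel : ℝ) : Prop where
  eta_nonneg : ∀ 𝒯, D.IsMesh 𝒯 → ∀ T ∈ 𝒯, ∀ v ∈ D.space 𝒯, 0 ≤ D.eta 𝒯 T v
  zeta_nonneg : ∀ 𝒯, D.IsMesh 𝒯 → ∀ w, ∀ T ∈ 𝒯, ∀ v ∈ D.space 𝒯, 0 ≤ D.zeta 𝒯 w T v
  stability : ∀ 𝒯H 𝒯h, D.IsMesh 𝒯H → D.Refinement 𝒯H 𝒯h →
    ∀ vh ∈ D.space 𝒯h, ∀ vH ∈ D.space 𝒯H, ∀ wh wH : H10 Ω, ∀ 𝒰 ⊆ 𝒯h ∩ 𝒯H,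
      |D.etaOn 𝒯h 𝒰 vh - D.etaOn 𝒯H 𝒰 vH| + |D.zetaOn 𝒯h wh 𝒰 vh - D.zetaOn 𝒯H wH 𝒰 vH|
        ≤ Cstab * energyNorm κ (vh - vH) + Clip * energyNorm κ (wh - wH)
  reduction_eta : ∀ 𝒯H 𝒯h, D.IsMesh 𝒯H → D.Refinement 𝒯H 𝒯h → ∀ v ∈ D.space 𝒯H,
    D.etaOn 𝒯h (𝒯h \ 𝒯H) v ≤ qred * D.etaOn 𝒯H (𝒯H \ 𝒯h) v
  reduction_zeta : ∀ 𝒯H 𝒯h, D.IsMesh 𝒯H → D.Refinement 𝒯H 𝒯h → ∀ v ∈ D.space 𝒯H,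
    ∀ w : H10 Ω, D.zetaOn 𝒯h w (𝒯h \ 𝒯H) v ≤ qred * D.zetaOn 𝒯H w (𝒯H \ 𝒯h) v
  reliability_eta : ∀ 𝒯H, D.IsMesh 𝒯H →
    energyNorm κ (D.sol κ - D.solH κ 𝒯H) ≤ Crel * D.etaOn 𝒯H 𝒯H (D.solH κ 𝒯H)
  reliability_zeta : ∀ 𝒯H, D.IsMesh 𝒯H → ∀ w : H10 Ω,
    energyNorm κ (dualSol κ K w - D.dualH κ K 𝒯H w)
      ≤ Crel * D.zetaOn 𝒯H w 𝒯H (D.dualH κ K 𝒯H w)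
  discrete_reliability_eta : ∀ 𝒯H 𝒯h, D.IsMesh 𝒯H → D.Refinement 𝒯H 𝒯h →
    energyNorm κ (D.solH κ 𝒯h - D.solH κ 𝒯H) ≤ Cdrel * D.etaOn 𝒯H (𝒯H \ 𝒯h) (D.solH κ 𝒯H)
  discrete_reliability_zeta : ∀ 𝒯H 𝒯h, D.IsMesh 𝒯H → D.Refinement 𝒯H 𝒯h → ∀ w : H10 Ω,
    energyNorm κ (D.dualH κ K 𝒯h w - D.dualH κ K 𝒯H w)
      ≤ Cdrel * D.zetaOn 𝒯H w (𝒯H \ 𝒯h) (D.dualH κ K 𝒯H w)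

/-- The discrete dual solution `z_H[u_H]`, linearized around `u_H`. -/
def dualLinH (D : Data Ω) (κ : Coeff d) (K : GoalOp Ω) (𝒯 : Mesh d) : H10 Ω :=
  D.dualH κ K 𝒯 (D.solH κ 𝒯)

/-- The square `η_H(𝒰, v)² + ζ_H[v](𝒰, w)²` of the combined estimator. -/
def combSq (D : Data Ω) (𝒯 : Mesh d) (𝒰 : Finset (Element d)) (v w : H10 Ω) : ℝ :=
  D.etaOn 𝒯 𝒰 v ^ 2 + D.zetaOn 𝒯 v 𝒰 w ^ 2

/-- `η_H(𝒰, u_H)² + ζ_H(𝒰, z_H[u_H])²`. -/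
def estOn (D : Data Ω) (κ : Coeff d) (K : GoalOp Ω) (𝒯 : Mesh d) (𝒰 : Finset (Element d)) : ℝ :=
  D.combSq 𝒯 𝒰 (D.solH κ 𝒯) (D.dualLinH κ K 𝒯)

/-- `η_H(u_H)² + ζ_H(z_H[u_H])²`. -/
def est (D : Data Ω) (κ : Coeff d) (K : GoalOp Ω) (𝒯 : Mesh d) : ℝ := D.estOn κ K 𝒯 𝒯

open Classical in
/-- Stability and discrete reliability of the combined estimator with constants `Cs` and `Cd`. -/
structure CombinedAxioms (D : Data Ω) (κ : Coeff d) (K : GoalOp Ω) (Cs Cd : ℝ) : Prop where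
  stability : ∀ 𝒯H 𝒯h, D.IsMesh 𝒯H → D.Refinement 𝒯H 𝒯h →
    ∀ vh ∈ D.space 𝒯h, ∀ wh ∈ D.space 𝒯h, ∀ vH ∈ D.space 𝒯H, ∀ wH ∈ D.space 𝒯H,
    ∀ 𝒰 ⊆ 𝒯h ∩ 𝒯H,
      |√(D.combSq 𝒯h 𝒰 vh wh) - √(D.combSq 𝒯H 𝒰 vH wH)|
        ≤ Cs * (energyNorm κ (vh - vH) + energyNorm κ (wh - wH))
  discrete_reliability : ∀ 𝒯H 𝒯h, D.IsMesh 𝒯H → D.Refinement 𝒯H 𝒯h →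
    energyNorm κ (D.solH κ 𝒯h - D.solH κ 𝒯H) + energyNorm κ (D.dualLinH κ K 𝒯h - D.dualLinH κ K 𝒯H)
      ≤ Cd * √(D.estOn κ K 𝒯H (𝒯H \ 𝒯h))

/-! #### The algorithm -/

/-- `(𝒯_ℓ)` and `(ℳ_ℓ)` are the meshes and the sets of marked elements of a run of the algorithm
that marks for the combined estimator, with parameters `θ` and `Cmark`. -/
structure IsRun (D : Data Ω) (κ : Coeff d) (K : GoalOp Ω) (θ Cmark : ℝ)
    (𝒯 : ℕ → Mesh d) (ℳ : ℕ → Finset (Element d)) : Prop where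
  init : 𝒯 0 = D.mesh₀
  subset : ∀ ℓ, ℳ ℓ ⊆ 𝒯 ℓ
  doerfler : ∀ ℓ, θ * D.est κ K (𝒯 ℓ) ≤ D.estOn κ K (𝒯 ℓ) (ℳ ℓ)
  minimal : ∀ ℓ, ∀ ℳ' ⊆ 𝒯 ℓ, θ * D.est κ K (𝒯 ℓ) ≤ D.estOn κ K (𝒯 ℓ) ℳ' →
    ((ℳ ℓ).card : ℝ) ≤ Cmark * (ℳ'.card : ℝ)
  step : ∀ ℓ, 𝒯 (ℓ + 1) = D.refineMesh (𝒯 ℓ) (ℳ ℓ)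

/-! #### Approximation classes -/

/-- `𝕋_N`: the meshes in `𝕋` with at most `N` elements more than `𝒯₀`. -/
def meshesUpTo (D : Data Ω) (N : ℕ) : Set (Mesh d) :=
  {𝒯 | D.IsMesh 𝒯 ∧ 𝒯.card ≤ D.mesh₀.card + N}

/-- `‖u‖_{𝔸_s} = sup_N (N+1)^s min_{𝒯_H ∈ 𝕋_N} η_H(u_H)`. -/
def approxPrimal (D : Data Ω) (κ : Coeff d) (s : ℝ) : ℝ≥0∞ :=
  ⨆ N : ℕ, ((N : ℝ≥0∞) + 1) ^ s *
    ⨅ 𝒯 ∈ D.meshesUpTo N, ENNReal.ofReal (D.etaOn 𝒯 𝒯 (D.solH κ 𝒯))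

/-- `‖z[u]‖_{𝔸_t} = sup_N (N+1)^t min_{𝒯_H ∈ 𝕋_N} ζ_H(z_H[u])`. -/
def approxDual (D : Data Ω) (κ : Coeff d) (K : GoalOp Ω) (t : ℝ) : ℝ≥0∞ :=
  ⨆ N : ℕ, ((N : ℝ≥0∞) + 1) ^ t *
    ⨅ 𝒯 ∈ D.meshesUpTo N,
      ENNReal.ofReal (D.zetaOn 𝒯 (D.sol κ) 𝒯 (D.dualH κ K 𝒯 (D.sol κ)))

/-- The estimate
`η_H(u_H)² + ζ_H(z_H[u_H])² ≤ C (‖u‖²_{𝔸_s} + ‖z[u]‖²_{𝔸_t}) (#𝒯_H - #𝒯₀)^{-β}` with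
`β = min{2s, 2t}`, where `0^{-β} = ∞`. -/
def RateBound (D : Data Ω) (κ : Coeff d) (K : GoalOp Ω) (s t C : ℝ) (𝒯 : Mesh d) : Prop :=
  ENNReal.ofReal (D.est κ K 𝒯)
    ≤ ENNReal.ofReal C * (D.approxPrimal κ s ^ 2 + D.approxDual κ K t ^ 2)
      * ((𝒯.card - D.mesh₀.card : ℕ) : ℝ≥0∞) ^ (-min (2 * s) (2 * t))

end Data

/-- `θ_opt = (1 + C_stab² C_drel²)⁻¹`. -/
def thetaOpt (Cstab Cdrel : ℝ) : ℝ := (1 + Cstab ^ 2 * Cdrel ^ 2)⁻¹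

end GOAFEM

end

/-! The discrete dual solution `z_H[u_H]` is linearized around `u_H`, so by itself it is not a
Galerkin approximation of `z[u]`. The pair `(u_H, z_H[u_H])`, however, is the Galerkin approximation
of `(u, z[u])` for one coercive form on `H × H`: a sufficiently large multiple of the primal form,
plus the transposed form, minus the coupling `G` (`pairForm`, `SolvesOn.orthogonal`).

For nested Galerkin approximations of any coercive, possibly nonsymmetric, problem the squared
increments over `2 ^ m` consecutive steps sum to at most `C (1 + c) ^ m` times the squared initial
error, with `c < 1` (`sum_sq_galerkin_sub_le`). This bound is sublinear in the number of steps.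
Since Dörfler marking gives estimator reduction and reliability gives quasi-monotonicity, averaging
over a long enough block halves the squared estimator (`exists_linear_convergence`). Compactness
plays no role here, so part (i) holds from the first step on.

For the rates, a refinement that shrinks the estimator by a suitable factor must have refined a set
satisfying the marking criterion (`doerfler_of_le`). Overlaying near-best primal and dual meshes
with the current one produces such a refinement at controlled cost (`exists_comparison`,
`exists_refinement_small`). Minimality of the marked set, linear convergence and mesh closure then
bound the number of elements (`Setting.exists_rate`).

The larger range of `θ` in (ii′) requires that moving the linearization point cost almost nothing.
Normalized Galerkin errors tend weakly to zero, so the compact `𝒦` makes `G(u - u_ℓ, ·)` small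
relative to `‖u - u_ℓ‖` for late `ℓ` (`exists_compact_error_le`). The remaining perturbation is
absorbed in the marking argument (`Setting.exists_doerfler_eventually`), which is why `ℓ₀` depends
on the run. -/

namespace GOAFEM

/-! ### Galerkin approximations for coercive forms -/

section Galerkin

variable {V : Type*} [NormedAddCommGroup V] [InnerProductSpace ℝ V]

/-- The Lax-Milgram lemma on a closed subspace. -/
theorem exists_galerkin [CompleteSpace V] (B : V →L[ℝ] V →L[ℝ] ℝ) {α : ℝ} (hα : 0 < α)
    (hco : ∀ v, α * ‖v‖ ^ 2 ≤ B v v) {X : Submodule ℝ V} (hX : IsClosed (X : Set V))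
    (φ : StrongDual ℝ V) : ∃ u ∈ X, ∀ v ∈ X, B u v = φ v := by
  have : CompleteSpace X := hX.completeSpace_coe
  let B' : X →L[ℝ] X →L[ℝ] ℝ := B.bilinearComp X.subtypeL X.subtypeL
  have hB' : IsCoercive B' := ⟨α, hα, fun v => by
    have := hco v
    simp only [B', ContinuousLinearMap.bilinearComp_apply, Submodule.subtypeL_apply]
    rw [mul_assoc, ← sq]
    exact this⟩
  let f := (InnerProductSpace.toDual ℝ X).symm (φ.comp X.subtypeL)
  refine ⟨hB'.continuousLinearEquivOfBilin.symm f, Submodule.coe_mem _, fun v hv => ?_⟩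
  have h1 := hB'.continuousLinearEquivOfBilin_apply (hB'.continuousLinearEquivOfBilin.symm f)
    ⟨v, hv⟩
  rw [ContinuousLinearEquiv.apply_symm_apply, InnerProductSpace.toDual_symm_apply] at h1
  exact h1.symm

variable {B : V →L[ℝ] V →L[ℝ] ℝ} {α M : ℝ}

theorem norm_le_of_coercive (hα : 0 < α) {v : V} {C : ℝ}
    (hco : α * ‖v‖ ^ 2 ≤ B v v) (h : B v v ≤ C * ‖v‖) (hC : 0 ≤ C) : ‖v‖ ≤ C / α := by
  rcases (norm_nonneg v).eq_or_lt with h0 | h0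
  · rw [← h0]; positivity
  · rw [le_div_iff₀ hα]
    nlinarith

/-- The difference of two nested Galerkin approximations is bounded by the error of the coarse
one. -/
theorem norm_galerkin_sub_le (hα : 0 < α) (hM : 0 ≤ M) (hco : ∀ v, α * ‖v‖ ^ 2 ≤ B v v)
    (hB : ∀ u v, |B u v| ≤ M * ‖u‖ * ‖v‖) {X : Submodule ℝ V} {x y z : V} (hy : y ∈ X) (hz : z ∈ X)
    (horth : ∀ v ∈ X, B (x - y) v = 0) : ‖y - z‖ ≤ M / α * ‖x - z‖ := by
  have h1 : B (y - z) (y - z) = B (x - z) (y - z) := by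
    have := horth _ (X.sub_mem hy hz)
    have e : x - z = (x - y) + (y - z) := by abel
    rw [e, map_add, add_apply, this, zero_add]
  have := norm_le_of_coercive (B := B) hα (hco (y - z)) (C := M * ‖x - z‖)
    (h1 ▸ (le_abs_self _).trans (hB _ _)) (by positivity)
  rwa [mul_div_right_comm] at this

/-- The mixed term is absorbed by `2‖y‖‖z‖ ≤ ‖y‖² + ‖z‖²`. A factor `1 + c < 2`, instead of the 2
valid for arbitrary vectors, is the source of the sublinear growth below. -/
theorem norm_add_sq_le_of_strengthened {c : ℝ} {y z : V}
    (h : |inner ℝ y z| ≤ c * (‖y‖ * ‖z‖)) (hc : 0 ≤ c) :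
    ‖y + z‖ ^ 2 ≤ (1 + c) * (‖y‖ ^ 2 + ‖z‖ ^ 2) := by
  rw [norm_add_sq_real]
  have h1 := (le_abs_self _).trans h
  nlinarith [mul_nonneg hc (sq_nonneg (‖y‖ - ‖z‖))]

/-- The constant in the strengthened Cauchy-Schwarz inequality. -/
noncomputable def angleConst (α M : ℝ) : ℝ := √(1 - (α / M) ^ 2)

theorem angleConst_nonneg : 0 ≤ angleConst α M := Real.sqrt_nonneg _

theorem angleConst_lt_one (hα : 0 < α) (hM : 0 < M) : angleConst α M < 1 := by
  rw [angleConst, Real.sqrt_lt' one_pos]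
  have : 0 < (α / M) ^ 2 := by positivity
  linarith

/-- Strengthened Cauchy-Schwarz inequality for `y ∈ X` and `z` with `B(X, z) = 0`. -/
theorem strengthened_cauchy_schwarz (hα : 0 < α) (hM : 0 < M) (hco : ∀ v, α * ‖v‖ ^ 2 ≤ B v v)
    (hB : ∀ u v, |B u v| ≤ M * ‖u‖ * ‖v‖) {y z : V} (hyz : B y z = 0) :
    |inner ℝ y z| ≤ angleConst α M * (‖y‖ * ‖z‖) := by
  rcases eq_or_ne z 0 with rfl | hz
  · simp
  have hz' : 0 < ‖z‖ := norm_pos_iff.mpr hz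
  -- Since `B y z = 0`, coercivity may be tested with `y + s • z` in place of `y`; hence `y` keeps a
  -- definite distance from the line spanned by `z`.
  have key : ∀ s : ℝ, (α / M) * ‖y‖ ≤ ‖y + s • z‖ := by
    intro s
    have h1 : α * ‖y‖ ^ 2 ≤ M * ‖y‖ * ‖y + s • z‖ := by
      refine (hco y).trans (le_trans (le_of_eq ?_) ((le_abs_self _).trans (hB y (y + s • z))))
      simp [hyz]
    rcases (norm_nonneg y).eq_or_lt with h0 | h0
    · rw [← h0]; simp
    · rw [div_mul_eq_mul_div, div_le_iff₀ hM]
      nlinarith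
  -- The value of `s` that minimizes `‖y + s • z‖`.
  set s : ℝ := -(inner ℝ y z / ‖z‖ ^ 2) with hs
  have h2 := pow_le_pow_left₀ (by positivity) (key s) 2
  have h3 : ‖y + s • z‖ ^ 2 = ‖y‖ ^ 2 - (inner ℝ y z) ^ 2 / ‖z‖ ^ 2 := by
    rw [norm_add_sq_real, inner_smul_right, norm_smul, mul_pow, Real.norm_eq_abs, sq_abs, hs]
    field_simp
    ring
  rw [h3] at h2
  have h4 : (inner ℝ y z) ^ 2 ≤ (1 - (α / M) ^ 2) * (‖y‖ * ‖z‖) ^ 2 := by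
    have : (inner ℝ y z) ^ 2 / ‖z‖ ^ 2 ≤ (1 - (α / M) ^ 2) * ‖y‖ ^ 2 := by nlinarith
    rw [div_le_iff₀ (by positivity)] at this
    nlinarith
  have h5 : 1 - (α / M) ^ 2 ≤ angleConst α M ^ 2 := by
    rw [angleConst]
    rcases le_total 0 (1 - (α / M) ^ 2) with h | h
    · rw [Real.sq_sqrt h]
    · exact h.trans (sq_nonneg _)
  refine abs_le_of_sq_le_sq ?_ (mul_nonneg angleConst_nonneg (by positivity : 0 ≤ ‖y‖ * ‖z‖))
  rw [mul_pow]
  exact h4.trans (mul_le_mul_of_nonneg_right h5 (by positivity))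

/-- Upper estimate for a block sum in a decomposition with a uniform angle condition. -/
theorem norm_sum_sq_le_of_blocks {c : ℝ} (hc : 0 ≤ c) (w : ℕ → V)
    (h : ∀ a b d, a ≤ b → b ≤ d →
      |inner ℝ (∑ i ∈ Finset.Ico a b, w i) (∑ i ∈ Finset.Ico b d, w i)|
        ≤ c * (‖∑ i ∈ Finset.Ico a b, w i‖ * ‖∑ i ∈ Finset.Ico b d, w i‖)) (m ℓ : ℕ) :
    ‖∑ i ∈ Finset.Ico ℓ (ℓ + 2 ^ m), w i‖ ^ 2
      ≤ (1 + c) ^ m * ∑ i ∈ Finset.Ico ℓ (ℓ + 2 ^ m), ‖w i‖ ^ 2 := by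
  induction m generalizing ℓ with
  | zero => simp
  | succ m ih =>
    -- The block is halved; each of the `m` levels of halving costs one factor `1 + c`.
    have e : ℓ + 2 ^ (m + 1) = ℓ + 2 ^ m + 2 ^ m := by ring
    have h1 : ℓ ≤ ℓ + 2 ^ m := Nat.le_add_right _ _
    have h2 : ℓ + 2 ^ m ≤ ℓ + 2 ^ m + 2 ^ m := Nat.le_add_right _ _
    rw [e, ← Finset.sum_Ico_consecutive w h1 h2,
      ← Finset.sum_Ico_consecutive (fun i => ‖w i‖ ^ 2) h1 h2]
    refine (norm_add_sq_le_of_strengthened (h _ _ _ h1 h2) hc).trans ?_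
    rw [pow_succ (1 + c) m, mul_comm ((1 + c) ^ m) (1 + c), mul_assoc]
    refine mul_le_mul_of_nonneg_left ?_ (by linarith)
    rw [mul_add]
    exact add_le_add (ih _) (ih _)

/-- Quasi-orthogonality of Galerkin approximations: the constant grows sublinearly in the number
`2 ^ m` of terms. -/
theorem sum_sq_galerkin_sub_le [CompleteSpace V] (hα : 0 < α) (hM : 0 < M)
    (hco : ∀ v, α * ‖v‖ ^ 2 ≤ B v v)
    (hB : ∀ u v, |B u v| ≤ M * ‖u‖ * ‖v‖) {Y : ℕ → Submodule ℝ V} (hmono : Monotone Y)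
    (hcl : ∀ k, IsClosed (Y k : Set V)) {x : V} {xs : ℕ → V} (hxs : ∀ k, xs k ∈ Y k)
    (horth : ∀ k, ∀ v ∈ Y k, B (x - xs k) v = 0) (ℓ m : ℕ) :
    ∑ k ∈ Finset.Ico ℓ (ℓ + 2 ^ m), ‖xs (k + 1) - xs k‖ ^ 2
      ≤ (M * ((1 + M / α) / α)) ^ 2 * (1 + angleConst α M) ^ m * ‖x - xs ℓ‖ ^ 2 := by
  have hco' : ∀ v, α * ‖v‖ ^ 2 ≤ B.flip v v := hco
  have hδ : ∀ k, xs (k + 1) - xs k ∈ Y (k + 1) := fun k =>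
    (Y (k + 1)).sub_mem (hxs _) (hmono (Nat.le_succ k) (hxs k))
  -- A dual increment `w k`: it is seen by the increment of `xs` at step `k` but by nothing in `Y
  -- k`. It is the representer of `⟪δ, ·⟫` for the transposed form on `Y (k + 1)`, minus its
  -- Galerkin projection to `Y k`; the subtraction leaves `B δ w` unchanged because `δ` is Galerkin
  -- orthogonal to `Y k`.
  have hex : ∀ k, ∃ w ∈ Y (k + 1), (∀ v ∈ Y k, B v w = 0) ∧
      B (xs (k + 1) - xs k) w = ‖xs (k + 1) - xs k‖ ^ 2 ∧
      ‖w‖ ≤ (1 + M / α) / α * ‖xs (k + 1) - xs k‖ := by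
    intro k
    set δ := xs (k + 1) - xs k with hδ'
    obtain ⟨w, hw, hw'⟩ := exists_galerkin B.flip hα hco' (hcl (k + 1)) (innerSL ℝ δ)
    obtain ⟨w', hw1, hw2⟩ := exists_galerkin B.flip hα hco' (hcl k) (B.flip w)
    have hδ0 : ∀ v ∈ Y k, B δ v = 0 := by
      intro v hv
      have h1 := horth k v hv
      have h2 := horth (k + 1) v (hmono (Nat.le_succ k) hv)
      have e : δ = (x - xs k) - (x - xs (k + 1)) := by rw [hδ']; abel
      rw [e, map_sub, sub_apply, h1, h2, sub_zero]
    have hwn : ‖w‖ ≤ ‖δ‖ / α := by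
      refine norm_le_of_coercive (B := B.flip) hα (hco' w) ?_ (norm_nonneg _)
      rw [hw' w hw]
      exact real_inner_le_norm δ w
    have hwn' : ‖w'‖ ≤ M * ‖w‖ / α := by
      refine norm_le_of_coercive (B := B.flip) hα (hco' w') ?_ (by positivity)
      rw [hw2 w' hw1]
      refine (le_abs_self _).trans ((hB w' w).trans (le_of_eq (by ring)))
    refine ⟨w - w', (Y (k + 1)).sub_mem hw (hmono (Nat.le_succ k) hw1), ?_, ?_, ?_⟩
    · intro v hv
      have := hw2 v hv
      simp only [ContinuousLinearMap.flip_apply] at this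
      rw [map_sub, this, sub_self]
    · have := hw' δ (hδ k)
      simp only [ContinuousLinearMap.flip_apply, innerSL_apply_apply] at this
      rw [map_sub, hδ0 w' hw1, sub_zero, this, real_inner_self_eq_norm_sq]
    · calc ‖w - w'‖ ≤ ‖w‖ + M * ‖w‖ / α := (norm_sub_le _ _).trans (by gcongr)
        _ = (1 + M / α) * ‖w‖ := by ring
        _ ≤ (1 + M / α) * (‖δ‖ / α) := by gcongr
        _ = _ := by ring
  choose w hwY hwo hwd hwn using hex
  have hmem : ∀ a b, ∑ i ∈ Finset.Ico a b, w i ∈ Y b := fun a b =>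
    Submodule.sum_mem _ fun i hi => hmono (Finset.mem_Ico.mp hi).2 (hwY i)
  have hzero : ∀ b d, ∀ v ∈ Y b, B v (∑ i ∈ Finset.Ico b d, w i) = 0 := by
    intro b d v hv
    rw [map_sum]
    exact Finset.sum_eq_zero fun i hi => hwo i v (hmono (Finset.mem_Ico.mp hi).1 hv)
  set c := angleConst α M
  set W := ∑ i ∈ Finset.Ico ℓ (ℓ + 2 ^ m), w i with hW
  set S := ∑ k ∈ Finset.Ico ℓ (ℓ + 2 ^ m), ‖xs (k + 1) - xs k‖ ^ 2 with hS
  set A := (1 + M / α) / α with hA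
  -- Two adjacent block sums of `w` satisfy the angle condition: the first lies in `Y b`, and `B`
  -- vanishes between `Y b` and the second.
  have hWn : ‖W‖ ^ 2 ≤ (1 + c) ^ m * (A ^ 2 * S) := by
    refine (norm_sum_sq_le_of_blocks (c := c) angleConst_nonneg w (fun a b d _ _ =>
      strengthened_cauchy_schwarz hα hM hco hB (hzero b d _ (hmem a b))) m ℓ).trans ?_
    have : 0 ≤ c := angleConst_nonneg
    gcongr
    rw [hS, Finset.mul_sum]
    refine Finset.sum_le_sum fun i _ => ?_
    rw [← mul_pow]
    exact pow_le_pow_left₀ (norm_nonneg _) (hwn i) 2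
  have hSW : S = B (x - xs ℓ) W := by
    rw [hW, map_sum, hS]
    refine Finset.sum_congr rfl fun k hk => ?_
    -- Only the middle term pairs with `w k`: the first vanishes by Galerkin orthogonality on `Y (k
    -- + 1)`, the last because it lies in `Y k`.
    have e : x - xs ℓ = (x - xs (k + 1)) + (xs (k + 1) - xs k) + (xs k - xs ℓ) := by abel
    rw [e, map_add, map_add, add_apply, add_apply,
      horth _ _ (hwY k), hwd, hwo k _ ((Y k).sub_mem (hxs k)
        (hmono (Finset.mem_Ico.mp hk).1 (hxs ℓ)))]
    ring
  have hS0 : 0 ≤ S := Finset.sum_nonneg fun _ _ => sq_nonneg _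
  have h1 : S ≤ M * ‖x - xs ℓ‖ * ‖W‖ := hSW.le.trans ((le_abs_self _).trans (hB _ _))
  have hR : 0 ≤ (M * A) ^ 2 * (1 + c) ^ m * ‖x - xs ℓ‖ ^ 2 := by
    have : 0 ≤ c := angleConst_nonneg
    positivity
  rcases hS0.eq_or_lt with h0 | h0
  · rw [← h0]; exact hR
  · have h2 : S ^ 2 ≤ (M * ‖x - xs ℓ‖) ^ 2 * ((1 + c) ^ m * (A ^ 2 * S)) := by
      refine (pow_le_pow_left₀ hS0 h1 2).trans ?_
      rw [mul_pow]
      gcongr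
    refine le_of_mul_le_mul_right (a := S) ?_ h0
    rw [← sq]
    refine h2.trans (le_of_eq ?_)
    ring

end Galerkin

/-! ### Linear convergence of sequences -/

/-- The rate is the `N`-th root of the contraction factor `1 / 2`. Quasi-monotonicity bridges the
incomplete last block, which costs the factor `Cm` and at most another factor 2. -/
theorem le_geometric_of_contraction {Cm : ℝ} (hCm : 0 ≤ Cm) {N : ℕ} (hN : 0 < N) {E : ℕ → ℝ}
    (hE : ∀ k, 0 ≤ E k) (hmono : ∀ ℓ n, ℓ ≤ n → E n ≤ Cm * E ℓ)
    (hcon : ∀ ℓ, E (ℓ + N) ≤ 1 / 2 * E ℓ) (ℓ n : ℕ) (h : ℓ ≤ n) :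
    E n ≤ 2 * Cm * ((1 / 2 : ℝ) ^ ((N : ℝ)⁻¹)) ^ (n - ℓ) * E ℓ := by
  set ρ : ℝ := (1 / 2 : ℝ) ^ ((N : ℝ)⁻¹) with hρ
  have hρ0 : 0 < ρ := by positivity
  have hρ1 : ρ ≤ 1 := Real.rpow_le_one (by norm_num) (by norm_num) (by positivity)
  have hρN : ρ ^ N = 1 / 2 := Real.rpow_inv_natCast_pow (by norm_num) hN.ne'
  have hit : ∀ k, E (ℓ + N * k) ≤ (1 / 2) ^ k * E ℓ := by
    intro k
    induction k with
    | zero => simp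
    | succ k ih =>
      rw [Nat.mul_succ, ← add_assoc, pow_succ]
      linarith [hcon (ℓ + N * k)]
  set k := (n - ℓ) / N
  have hk : N * k + (n - ℓ) % N = n - ℓ := Nat.div_add_mod _ _
  have hr : (n - ℓ) % N < N := Nat.mod_lt _ hN
  have h1 : E n ≤ Cm * E (ℓ + N * k) := hmono _ _ (by omega)
  have h2 : (1 / 2 : ℝ) ^ k ≤ 2 * ρ ^ (n - ℓ) := by
    rw [← hk, pow_add, pow_mul, hρN]
    have h3 : (1 / 2 : ℝ) ≤ ρ ^ ((n - ℓ) % N) := by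
      rw [← hρN]
      exact pow_le_pow_of_le_one hρ0.le hρ1 hr.le
    have h4 : (0 : ℝ) < (1 / 2) ^ k := by positivity
    nlinarith
  calc E n ≤ Cm * ((1 / 2) ^ k * E ℓ) := h1.trans (by gcongr; exact hit k)
    _ ≤ Cm * (2 * ρ ^ (n - ℓ) * E ℓ) := by
      have := hE ℓ
      gcongr
    _ = _ := by ring

/-- Estimator reduction, quasi-monotonicity and quasi-orthogonality with a sublinearly growing
constant imply linear convergence. -/
theorem exists_linear_convergence {q Cr Co c Cm : ℝ} (hq0 : 0 ≤ q) (hq : q < 1)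
    (hCo : 0 ≤ Co) (hc0 : 0 ≤ c) (hc : c < 1) (hCm : 0 < Cm) :
    ∃ C ρ : ℝ, 0 < C ∧ 0 < ρ ∧ ρ < 1 ∧ ∀ a D : ℕ → ℝ, (∀ k, 0 ≤ a k) →
      (∀ k, a (k + 1) ≤ q * a k + Cr * D k) → (∀ ℓ n, ℓ ≤ n → a n ≤ Cm * a ℓ) →
      (∀ ℓ m, ∑ k ∈ Finset.Ico ℓ (ℓ + 2 ^ m), D k ^ 2 ≤ Co * (1 + c) ^ m * a ℓ ^ 2) →
      ∀ ℓ n, ℓ ≤ n → a n ^ 2 ≤ C * ρ ^ (n - ℓ) * a ℓ ^ 2 := by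
  have hq' : 0 < 1 - q := by linarith
  set C' : ℝ := Cr ^ 2 / (1 - q) with hC'
  have hC'0 : 0 ≤ C' := by positivity
  set G : ℝ := Cm ^ 2 * ((1 + C' * Co) / (1 - q)) with hG
  have hG0 : 0 < G := by positivity
  obtain ⟨m, hm⟩ := exists_pow_lt_of_lt_one (x := 1 / 2 / G) (y := (1 + c) / 2) (by positivity)
    (by linarith)
  have hm' : G * ((1 + c) / 2) ^ m ≤ 1 / 2 := by
    rw [lt_div_iff₀ hG0] at hm
    linarith
  have hN : 0 < 2 ^ m := by positivity
  refine ⟨2 * Cm ^ 2, (1 / 2 : ℝ) ^ (((2 ^ m : ℕ) : ℝ)⁻¹), by positivity, by positivity, ?_, ?_⟩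
  · exact Real.rpow_lt_one (by norm_num) (by norm_num) (by positivity)
  intro a D ha hred hmono horth ℓ n hn
  refine le_geometric_of_contraction (E := fun k => a k ^ 2) (by positivity) hN
    (fun k => sq_nonneg _) (fun ℓ n h => ?_) (fun ℓ => ?_) ℓ n hn
  · simp only [← mul_pow]
    exact pow_le_pow_left₀ (ha n) (hmono ℓ n h) 2
  -- Convexity of the square at `q * a k + (1 - q) * x` with `x = Cr * D k / (1 - q)`; the factor of
  -- `a k ^ 2` remains `q < 1`.
  have hsq : ∀ k, a (k + 1) ^ 2 ≤ q * a k ^ 2 + C' * D k ^ 2 := by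
    intro k
    refine (pow_le_pow_left₀ (ha _) (hred k) 2).trans ?_
    have : q * a k ^ 2 + C' * D k ^ 2 - (q * a k + Cr * D k) ^ 2
        = q / (1 - q) * ((1 - q) * a k - Cr * D k) ^ 2 := by
      rw [hC']; field_simp; ring
    have h2 : 0 ≤ q / (1 - q) * ((1 - q) * a k - Cr * D k) ^ 2 := by positivity
    linarith
  set I := Finset.Ico ℓ (ℓ + 2 ^ m) with hI
  set S := ∑ k ∈ I, a (k + 1) ^ 2 with hS
  have hshift : ∑ k ∈ I, a k ^ 2 ≤ S + a ℓ ^ 2 := by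
    have h1 : ∑ k ∈ I, a (k + 1) ^ 2 - ∑ k ∈ I, a k ^ 2 = a (ℓ + 2 ^ m) ^ 2 - a ℓ ^ 2 := by
      rw [← Finset.sum_sub_distrib]
      exact Finset.sum_Ico_sub (fun k => a k ^ 2) (Nat.le_add_right _ _)
    have := sq_nonneg (a (ℓ + 2 ^ m))
    linarith
  have hsum : S ≤ q * (S + a ℓ ^ 2) + C' * (Co * (1 + c) ^ m * a ℓ ^ 2) := by
    calc S ≤ ∑ k ∈ I, (q * a k ^ 2 + C' * D k ^ 2) := Finset.sum_le_sum fun k _ => hsq k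
      _ = q * ∑ k ∈ I, a k ^ 2 + C' * ∑ k ∈ I, D k ^ 2 := by
        rw [Finset.sum_add_distrib, Finset.mul_sum, Finset.mul_sum]
      _ ≤ _ := by
        have := horth ℓ m
        gcongr
  have hpow : 1 ≤ (1 + c) ^ m := one_le_pow₀ (by linarith)
  have hS2 : S ≤ (1 + C' * Co) / (1 - q) * (1 + c) ^ m * a ℓ ^ 2 := by
    rw [div_mul_eq_mul_div, div_mul_eq_mul_div, le_div_iff₀ hq']
    have h3 : q * a ℓ ^ 2 ≤ (1 + c) ^ m * a ℓ ^ 2 := by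
      refine mul_le_mul_of_nonneg_right ?_ (sq_nonneg _)
      linarith
    linarith
  -- By quasi-monotonicity the last term is, up to `Cm ^ 2`, below each of the `2 ^ m` terms of the
  -- sum.
  have hlow : (2 : ℝ) ^ m * a (ℓ + 2 ^ m) ^ 2 ≤ Cm ^ 2 * S := by
    have : ∀ k ∈ I, a (ℓ + 2 ^ m) ^ 2 ≤ Cm ^ 2 * a (k + 1) ^ 2 := by
      intro k hk
      rw [← mul_pow]
      exact pow_le_pow_left₀ (ha _) (hmono _ _ (Finset.mem_Ico.mp hk).2) 2
    have h4 := Finset.sum_le_sum this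
    rw [Finset.sum_const, ← Finset.mul_sum, hI, Nat.card_Ico, nsmul_eq_mul] at h4
    simpa using h4
  have h5 : (2 : ℝ) ^ m * a (ℓ + 2 ^ m) ^ 2 ≤ 2 ^ m * (G * ((1 + c) / 2) ^ m * a ℓ ^ 2) := by
    calc _ ≤ Cm ^ 2 * S := hlow
      _ ≤ Cm ^ 2 * ((1 + C' * Co) / (1 - q) * (1 + c) ^ m * a ℓ ^ 2) := by gcongr
      _ = _ := by rw [hG, div_pow]; field_simp
  have h6 := le_of_mul_le_mul_left h5 (by positivity)
  refine h6.trans (mul_le_mul_of_nonneg_right hm' (sq_nonneg _))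

end GOAFEM

namespace GOAFEM

/-! ### Bilinear integral forms on `L² × L²` -/

section Integrals

variable {X : Type*} [MeasurableSpace X] {μ : Measure X}
variable {E F : Type*} [NormedAddCommGroup E] [NormedAddCommGroup F]

theorem integrable_norm_mul_norm (f : Lp E 2 μ) (g : Lp F 2 μ) :
    Integrable (fun x => ‖f x‖ * ‖g x‖) μ :=
  (Lp.memLp f).norm.integrable_mul (Lp.memLp g).norm

theorem integral_norm_mul_norm_le (f : Lp E 2 μ) (g : Lp F 2 μ) :
    ∫ x, ‖f x‖ * ‖g x‖ ∂μ ≤ ‖f‖ * ‖g‖ := by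
  have hf := (Lp.memLp f).norm
  have hg := (Lp.memLp g).norm
  have h := real_inner_le_norm (hf.toLp _) (hg.toLp _)
  rw [L2.inner_def, Lp.norm_toLp, Lp.norm_toLp, eLpNorm_norm, eLpNorm_norm, ← Lp.norm_def,
    ← Lp.norm_def] at h
  refine le_trans (le_of_eq (integral_congr_ae ?_)) h
  filter_upwards [hf.coeFn_toLp, hg.coeFn_toLp] with x h1 h2
  rw [h1, h2]
  simp [mul_comm]

theorem integrable_of_bilinear_bound {T : X → E → F → ℝ} {C : ℝ}
    (hT : ∀ᵐ x ∂μ, ∀ e f, |T x e f| ≤ C * (‖e‖ * ‖f‖)) (f : Lp E 2 μ) (g : Lp F 2 μ)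
    (hm : AEStronglyMeasurable (fun x => T x (f x) (g x)) μ) :
    Integrable (fun x => T x (f x) (g x)) μ := by
  refine ((integrable_norm_mul_norm f g).const_mul C).mono' hm ?_
  filter_upwards [hT] with x hx using hx _ _

theorem abs_integral_le_of_bilinear_bound {T : X → E → F → ℝ} {C : ℝ} (hC : 0 ≤ C)
    (hT : ∀ᵐ x ∂μ, ∀ e f, |T x e f| ≤ C * (‖e‖ * ‖f‖)) (f : Lp E 2 μ) (g : Lp F 2 μ) :
    |∫ x, T x (f x) (g x) ∂μ| ≤ C * (‖f‖ * ‖g‖) := by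
  have h := norm_integral_le_of_norm_le ((integrable_norm_mul_norm f g).const_mul C)
    (f := fun x => T x (f x) (g x)) (by filter_upwards [hT] with x hx using hx _ _)
  rw [integral_const_mul] at h
  exact h.trans (mul_le_mul_of_nonneg_left (integral_norm_mul_norm_le f g) hC)

/-- The bounded bilinear form `(f, g) ↦ ∫ T(x)(f(x), g(x))` on `L² × L²`. -/
theorem exists_bilinear_integral [NormedSpace ℝ E] [NormedSpace ℝ F]
    {T : X → E →ₗ[ℝ] F →ₗ[ℝ] ℝ} {C : ℝ} (hC : 0 ≤ C)
    (hT : ∀ᵐ x ∂μ, ∀ e f, |T x e f| ≤ C * (‖e‖ * ‖f‖))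
    (hm : ∀ (f : Lp E 2 μ) (g : Lp F 2 μ), AEStronglyMeasurable (fun x => T x (f x) (g x)) μ) :
    ∃ B : Lp E 2 μ →L[ℝ] Lp F 2 μ →L[ℝ] ℝ, ∀ f g,
      Integrable (fun x => T x (f x) (g x)) μ ∧ B f g = ∫ x, T x (f x) (g x) ∂μ := by
  have hi := fun f g => integrable_of_bilinear_bound (T := fun x e f => T x e f) hT f g (hm f g)
  let L : Lp E 2 μ →ₗ[ℝ] Lp F 2 μ →ₗ[ℝ] ℝ :=
    LinearMap.mk₂ ℝ (fun f g => ∫ x, T x (f x) (g x) ∂μ)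
      (fun f f' g => by
        rw [← integral_add (hi f g) (hi f' g)]
        refine integral_congr_ae ?_
        filter_upwards [Lp.coeFn_add f f'] with x hx
        rw [hx]
        simp)
      (fun c f g => by
        rw [smul_eq_mul, ← integral_const_mul]
        refine integral_congr_ae ?_
        filter_upwards [Lp.coeFn_smul c f] with x hx
        rw [hx]
        simp)
      (fun f g g' => by
        rw [← integral_add (hi f g) (hi f g')]
        refine integral_congr_ae ?_
        filter_upwards [Lp.coeFn_add g g'] with x hx
        rw [hx]
        simp)
      (fun c f g => by
        rw [smul_eq_mul, ← integral_const_mul]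
        refine integral_congr_ae ?_
        filter_upwards [Lp.coeFn_smul c g] with x hx
        rw [hx]
        simp)
  refine ⟨L.mkContinuous₂ C fun f g => ?_, fun f g => ⟨hi f g, rfl⟩⟩
  rw [mul_assoc]
  exact abs_integral_le_of_bilinear_bound (T := fun x e f => T x e f) hC hT f g

theorem exists_ae_bound_of_memLp_top {f : X → E} (hf : MemLp f ∞ μ) :
    ∃ C : ℝ, 0 ≤ C ∧ ∀ᵐ x ∂μ, ‖f x‖ ≤ C := by
  refine ⟨(eLpNorm f ∞ μ).toReal, ENNReal.toReal_nonneg, ?_⟩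
  have h := hf.eLpNorm_lt_top
  filter_upwards [ae_le_eLpNormEssSup (f := f) (μ := μ)] with x hx
  rw [← eLpNorm_exponent_top] at hx
  have := ENNReal.toReal_mono h.ne hx
  simpa using this

end Integrals

/-! ### The forms as bounded bilinear forms -/

section Forms

variable {d : ℕ} {Ω : Set (Pt d)}

/-- The Hilbert space `H¹₀(Ω)` is complete. -/
instance : CompleteSpace (H10 Ω) :=
  (Submodule.isClosed_topologicalClosure (testPairs Ω)).completeSpace_coe

/-- `v ↦ v` as a map into `L²(Ω)`. -/
noncomputable def fnL (Ω : Set (Pt d)) : H10 Ω →L[ℝ] Lp ℝ 2 (volume.restrict Ω) :=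
  (WithLp.fstL 2 ℝ _ _).comp (H10 Ω).subtypeL

/-- `v ↦ ∇v` as a map into `L²(Ω; ℝᵈ)`. -/
noncomputable def gradL (Ω : Set (Pt d)) : H10 Ω →L[ℝ] Lp (Pt d) 2 (volume.restrict Ω) :=
  (WithLp.sndL 2 ℝ _ _).comp (H10 Ω).subtypeL

theorem fnL_apply (v : H10 Ω) : fnL Ω v = fn v := rfl

theorem gradL_apply (v : H10 Ω) : gradL Ω v = grad v := rfl

theorem norm_sq_H10 (v : H10 Ω) : ‖v‖ ^ 2 = ‖fn v‖ ^ 2 + ‖grad v‖ ^ 2 :=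
  WithLp.prod_norm_sq_eq_of_L2 v.1

/-- A matrix as a bilinear form on `ℝᵈ`. -/
def matrixForm (A : Matrix (Fin d) (Fin d) ℝ) : Pt d →ₗ[ℝ] Pt d →ₗ[ℝ] ℝ :=
  LinearMap.mk₂ ℝ (fun y z => (A *ᵥ y.ofLp) ⬝ᵥ z.ofLp)
    (fun y y' z => by simp [Matrix.mulVec_add, add_dotProduct])
    (fun c y z => by simp [Matrix.mulVec_smul, smul_dotProduct])
    (fun y z z' => by simp [dotProduct_add])
    (fun c y z => by simp [dotProduct_smul])

theorem matrixForm_apply (A : Matrix (Fin d) (Fin d) ℝ) (y z : Pt d) :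
    matrixForm A y z = (A *ᵥ y.ofLp) ⬝ᵥ z.ofLp := rfl

theorem matrixForm_eq_sum (A : Matrix (Fin d) (Fin d) ℝ) (y z : Pt d) :
    matrixForm A y z = ∑ i, ∑ j, A i j * y j * z i := by
  simp [matrixForm_apply, dotProduct, Matrix.mulVec, Finset.sum_mul]

/-- Integrability is recorded next to the value because the lower bound of the energy norm compares
two integrals pointwise. -/
theorem exists_principalL {κ : Coeff d}
    (hA : ∀ i j, MemLp (fun x => κ.A x i j) ∞ (volume.restrict Ω)) :
    ∃ B : Lp (Pt d) 2 (volume.restrict Ω) →L[ℝ] Lp (Pt d) 2 (volume.restrict Ω) →L[ℝ] ℝ,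
      ∀ f g, Integrable (fun x => (κ.A x *ᵥ (f x).ofLp) ⬝ᵥ (g x).ofLp) (volume.restrict Ω) ∧
        B f g = ∫ x in Ω, (κ.A x *ᵥ (f x).ofLp) ⬝ᵥ (g x).ofLp := by
  choose C hC0 hC using fun i j => exists_ae_bound_of_memLp_top (hA i j)
  refine exists_bilinear_integral (T := fun x => matrixForm (κ.A x)) (C := ∑ i, ∑ j, C i j)
    (Finset.sum_nonneg fun i _ => Finset.sum_nonneg fun j _ => hC0 i j) ?_ ?_
  · have hC' : ∀ᵐ x ∂(volume.restrict Ω), ∀ i j, ‖κ.A x i j‖ ≤ C i j :=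
      ae_all_iff.mpr fun i => ae_all_iff.mpr fun j => hC i j
    filter_upwards [hC'] with x hx y z
    rw [matrixForm_eq_sum, Finset.sum_mul]
    refine (Finset.abs_sum_le_sum_abs _ _).trans (Finset.sum_le_sum fun i _ => ?_)
    rw [Finset.sum_mul]
    refine (Finset.abs_sum_le_sum_abs _ _).trans (Finset.sum_le_sum fun j _ => ?_)
    rw [abs_mul, abs_mul, mul_assoc]
    have h1 : |y j| ≤ ‖y‖ := PiLp.norm_apply_le y j
    have h2 : |z i| ≤ ‖z‖ := PiLp.norm_apply_le z i
    have h3 := hx i j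
    rw [Real.norm_eq_abs] at h3
    have := hC0 i j
    gcongr
  · intro f g
    simp only [matrixForm_eq_sum]
    have hcoord : ∀ (h : Lp (Pt d) 2 (volume.restrict Ω)) (i : Fin d),
        AEStronglyMeasurable (fun x => h x i) (volume.restrict Ω) := fun h i =>
      (EuclideanSpace.proj (𝕜 := ℝ) i).continuous.comp_aestronglyMeasurable
        (Lp.aestronglyMeasurable h)
    refine Finset.aestronglyMeasurable_fun_sum _ fun i _ =>
      Finset.aestronglyMeasurable_fun_sum _ fun j _ => ?_
    exact (((hA i j).aestronglyMeasurable).mul (hcoord f j)).mul (hcoord g i)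

theorem exists_convectionL {κ : Coeff d} (hb : MemLp κ.b ∞ (volume.restrict Ω)) :
    ∃ B : Lp (Pt d) 2 (volume.restrict Ω) →L[ℝ] Lp ℝ 2 (volume.restrict Ω) →L[ℝ] ℝ,
      ∀ f g, Integrable (fun x => inner ℝ (κ.b x) (f x) * g x) (volume.restrict Ω) ∧
        B f g = ∫ x in Ω, inner ℝ (κ.b x) (f x) * g x := by
  obtain ⟨C, hC0, hC⟩ := exists_ae_bound_of_memLp_top hb
  refine exists_bilinear_integral (T := fun x =>
    (LinearMap.mul ℝ ℝ).comp (innerSL ℝ (κ.b x) : Pt d →ₗ[ℝ] ℝ)) hC0 ?_ ?_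
  · filter_upwards [hC] with x hx y z
    simp only [LinearMap.comp_apply, LinearMap.mul_apply', ContinuousLinearMap.coe_coe,
      innerSL_apply_apply, abs_mul]
    rw [← mul_assoc]
    have := (abs_real_inner_le_norm (κ.b x) y).trans (mul_le_mul_of_nonneg_right hx (norm_nonneg y))
    exact mul_le_mul_of_nonneg_right this (abs_nonneg z)
  · intro f g
    exact (hb.aestronglyMeasurable.inner (Lp.aestronglyMeasurable f)).mul
      (Lp.aestronglyMeasurable g)

theorem exists_reactionL {κ : Coeff d} (hc : MemLp κ.c ∞ (volume.restrict Ω)) :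
    ∃ B : Lp ℝ 2 (volume.restrict Ω) →L[ℝ] Lp ℝ 2 (volume.restrict Ω) →L[ℝ] ℝ,
      ∀ f g, Integrable (fun x => κ.c x * f x * g x) (volume.restrict Ω) ∧
        B f g = ∫ x in Ω, κ.c x * f x * g x := by
  obtain ⟨C, hC0, hC⟩ := exists_ae_bound_of_memLp_top hc
  refine exists_bilinear_integral (T := fun x =>
    (LinearMap.mul ℝ ℝ).comp (LinearMap.mul ℝ ℝ (κ.c x))) hC0 ?_ ?_
  · filter_upwards [hC] with x hx y z
    simp only [LinearMap.comp_apply, LinearMap.mul_apply', abs_mul]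
    rw [← mul_assoc]
    have := mul_le_mul_of_nonneg_right hx (norm_nonneg y)
    exact mul_le_mul_of_nonneg_right this (abs_nonneg z)
  · intro f g
    exact (hc.aestronglyMeasurable.mul (Lp.aestronglyMeasurable f)).mul
      (Lp.aestronglyMeasurable g)

/-- The form `a(·,·)` is a bounded bilinear form on `H¹₀(Ω)`. -/
theorem exists_formL {κ : Coeff d} (hκ : κ.Admissible Ω) :
    ∃ a : H10 Ω →L[ℝ] H10 Ω →L[ℝ] ℝ, ∀ u v, a u v = form κ Ω u v := by
  obtain ⟨B₁, h₁⟩ := exists_principalL hκ.bounded_A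
  obtain ⟨B₂, h₂⟩ := exists_convectionL hκ.bounded_b
  obtain ⟨B₃, h₃⟩ := exists_reactionL hκ.bounded_c
  refine ⟨B₁.bilinearComp (gradL Ω) (gradL Ω) + B₂.bilinearComp (gradL Ω) (fnL Ω)
    + B₃.bilinearComp (fnL Ω) (fnL Ω), fun u v => ?_⟩
  simp only [add_apply, ContinuousLinearMap.bilinearComp_apply, (h₁ _ _).2, (h₂ _ _).2, (h₃ _ _).2,
    gradL_apply, fnL_apply]
  rfl

/-- The right-hand side is a bounded functional on `H¹₀(Ω)`. -/
theorem Data.exists_rhsL (D : Data Ω) : ∃ F : StrongDual ℝ (H10 Ω), ∀ v, F v = D.rhs v := by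
  refine ⟨(innerSL ℝ D.f).comp (fnL Ω) - (innerSL ℝ D.fvec).comp (gradL Ω), fun v => ?_⟩
  simp only [sub_apply, ContinuousLinearMap.comp_apply, innerSL_apply_apply, L2.inner_def,
    gradL_apply, fnL_apply, Data.rhs]
  simp [mul_comm]

/-! ### Friedrichs inequality and the energy norm -/

theorem norm_gradient (φ : Pt d → ℝ) (x : Pt d) : ‖gradient φ x‖ = ‖fderiv ℝ φ x‖ := by
  simp [gradient]

/-- The Gagliardo-Nirenberg-Sobolev inequality for functions supported in a bounded set. For `d ≥ 3`
the exponent `2 < d` is admissible directly. For `d = 2` it is critical, so the embedding of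
`W^{1,1}` into `L²` is used and followed by Hölder's inequality on the set `Ω` of finite measure. -/
theorem exists_eLpNorm_le_fderiv (hd : 2 ≤ d) (hΩb : Bornology.IsBounded Ω) :
    ∃ C : ℝ≥0∞, C ≠ ⊤ ∧ ∀ φ : Pt d → ℝ, ContDiff ℝ 1 φ → tsupport φ ⊆ Ω →
      eLpNorm φ 2 (volume.restrict Ω) ≤ C * eLpNorm (fderiv ℝ φ) 2 (volume.restrict Ω) := by
  have hvol : ∀ φ : Pt d → ℝ, tsupport φ ⊆ Ω → ∀ p : ℝ≥0∞,
      eLpNorm φ p volume = eLpNorm φ p (volume.restrict Ω) ∧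
      eLpNorm (fderiv ℝ φ) p volume = eLpNorm (fderiv ℝ φ) p (volume.restrict Ω) := by
    intro φ hφ p
    have h1 : Function.support φ ⊆ Ω := (subset_tsupport φ).trans hφ
    have h2 : Function.support (fun x => ‖fderiv ℝ φ x‖) ⊆ Ω := fun x hx =>
      hφ (support_fderiv_subset ℝ fun h0 => hx (by simp [h0]))
    constructor
    · rw [eLpNorm_restrict_eq_of_support_subset h1]
    · rw [← eLpNorm_norm, ← eLpNorm_norm (fderiv ℝ φ), eLpNorm_restrict_eq_of_support_subset h2]
  have hfr : Module.finrank ℝ (Pt d) = d := by simp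
  rcases hd.eq_or_lt with hd2 | hd3
  · refine ⟨eLpNormLESNormFDerivOfLeConst ℝ (volume : Measure (Pt d)) Ω 1 2 *
      (volume.restrict Ω) Set.univ ^ (1 / 2 : ℝ), ?_, fun φ h1 h2 => ?_⟩
    · refine ENNReal.mul_ne_top ENNReal.coe_ne_top (ENNReal.rpow_ne_top_of_nonneg (by norm_num) ?_)
      rw [Measure.restrict_apply_univ]
      exact hΩb.measure_lt_top.ne
    · have h := eLpNorm_le_eLpNorm_fderiv_of_le (volume : Measure (Pt d)) (s := Ω) h1
        ((subset_tsupport φ).trans h2) (p := 1) (q := 2) le_rfl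
        (by rw [hfr, ← hd2]; norm_num) (by rw [hfr, ← hd2]; norm_num) hΩb
      rw [mul_assoc]
      have h3 : eLpNorm (fderiv ℝ φ) 1 (volume.restrict Ω) ≤
          (volume.restrict Ω) Set.univ ^ (1 / 2 : ℝ) *
            eLpNorm (fderiv ℝ φ) 2 (volume.restrict Ω) := by
        have := eLpNorm_le_eLpNorm_mul_rpow_measure_univ (μ := volume.restrict Ω)
          (f := fderiv ℝ φ) (p := 1) (q := 2) (by norm_num)
          (h1.continuous_fderiv one_ne_zero).aestronglyMeasurable
        rw [mul_comm]
        convert this using 3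
        norm_num
      rw [← (hvol φ h2 2).1]
      refine h.trans ?_
      simp only [ENNReal.coe_one]
      rw [(hvol φ h2 1).2]
      gcongr
  · refine ⟨eLpNormLESNormFDerivOfLeConst ℝ (volume : Measure (Pt d)) Ω 2 2,
      ENNReal.coe_ne_top, fun φ h1 h2 => ?_⟩
    have h := eLpNorm_le_eLpNorm_fderiv (volume : Measure (Pt d)) (s := Ω) h1
        ((subset_tsupport φ).trans h2) (p := 2) (by norm_num)
        (by rw [hfr]; exact_mod_cast hd3) hΩb
    rw [← (hvol φ h2 2).1, ← (hvol φ h2 2).2]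
    exact h

/-- Friedrichs inequality. -/
theorem exists_friedrichs (hd : 2 ≤ d) (hΩb : Bornology.IsBounded Ω) :
    ∃ C : ℝ, 0 ≤ C ∧ ∀ v : H10 Ω, ‖fn v‖ ≤ C * ‖grad v‖ := by
  obtain ⟨C, hC, h⟩ := exists_eLpNorm_le_fderiv hd hΩb
  refine ⟨C.toReal, ENNReal.toReal_nonneg, fun v => ?_⟩
  -- The inequality is a closed condition on pairs in `L² × L²`, so it passes from test functions to
  -- their closure.
  have hcl : IsClosed {q : L2Pair Ω | ‖q.fst‖ ≤ C.toReal * ‖q.snd‖} := by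
    refine isClosed_le ?_ ?_
    · exact (WithLp.fstL 2 ℝ _ _).continuous.norm
    · exact continuous_const.mul (WithLp.sndL 2 ℝ _ _).continuous.norm
  have hsub : (testPairs Ω : Set (L2Pair Ω)) ⊆ {q | ‖q.fst‖ ≤ C.toReal * ‖q.snd‖} := by
    rintro q ⟨φ, h1, -, h3, h4, h5⟩
    have h6 := h φ (h1.of_le (by exact_mod_cast le_top)) h3
    have e : eLpNorm q.snd 2 (volume.restrict Ω) = eLpNorm (fderiv ℝ φ) 2 (volume.restrict Ω) := by
      rw [eLpNorm_congr_ae h5]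
      exact eLpNorm_congr_norm_ae (Filter.Eventually.of_forall fun x => norm_gradient φ x)
    rw [← eLpNorm_congr_ae h4, ← e] at h6
    simp only [Set.mem_ofPred_eq, Lp.norm_def]
    rw [← ENNReal.toReal_mul]
    exact ENNReal.toReal_mono (ENNReal.mul_ne_top hC (Lp.eLpNorm_ne_top _)) h6
  exact closure_minimal hsub hcl v.2

theorem energyNorm_nonneg (κ : Coeff d) (v : H10 Ω) : 0 ≤ energyNorm κ v := Real.sqrt_nonneg _

/-- The energy norm is equivalent to the norm of `H¹₀(Ω)`. -/
theorem exists_energyNorm_equiv (hd : 2 ≤ d) (hΩb : Bornology.IsBounded Ω) {κ : Coeff d}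
    (hκ : κ.Admissible Ω) : ∃ C : ℝ, 0 < C ∧ ∀ v : H10 Ω,
      energyNorm κ v ≤ C * ‖v‖ ∧ ‖v‖ ≤ C * energyNorm κ v := by
  obtain ⟨CF, hCF0, hCF⟩ := exists_friedrichs hd hΩb
  obtain ⟨B, hB⟩ := exists_principalL hκ.bounded_A
  obtain ⟨α, hα, hpos⟩ := hκ.posDef
  have hprin : ∀ v : H10 Ω, principal κ Ω v v = B (grad v) (grad v) := fun v => (hB _ _).2.symm
  have hgrad : ∀ v : H10 Ω, ‖grad v‖ ≤ ‖v‖ := fun v => by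
    refine abs_le_of_sq_le_sq' ?_ (norm_nonneg v) |>.2
    rw [norm_sq_H10]
    exact le_add_of_nonneg_left (sq_nonneg _)
  have hup : ∀ v : H10 Ω, principal κ Ω v v ≤ ‖B‖ * ‖v‖ ^ 2 := fun v => by
    rw [hprin]
    refine (le_abs_self _).trans ((B.le_opNorm₂ _ _).trans ?_)
    rw [mul_assoc, ← sq]
    have := hgrad v
    gcongr
  have hlow : ∀ v : H10 Ω, α * ‖grad v‖ ^ 2 ≤ principal κ Ω v v := fun v => by
    have h1 : ‖grad v‖ ^ 2 = ∫ x in Ω, ‖grad v x‖ ^ 2 := by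
      rw [← real_inner_self_eq_norm_sq, L2.inner_def]
      simp only [real_inner_self_eq_norm_sq]
    rw [h1, ← integral_const_mul, principal]
    refine integral_mono_of_nonneg (Filter.Eventually.of_forall fun x => by positivity) ?_ ?_
    · exact (hB (grad v) (grad v)).1
    · filter_upwards [hpos] with x hx
      rw [dotProduct_comm]
      exact hx _
  -- Positive definiteness controls only the gradient; Friedrichs' inequality supplies the `L²` part
  -- of the norm.
  have hnorm : ∀ v : H10 Ω, ‖v‖ ^ 2 ≤ (CF ^ 2 + 1) / α * principal κ Ω v v := fun v => by
    rw [norm_sq_H10, div_mul_eq_mul_div, le_div_iff₀ hα]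
    have h1 := pow_le_pow_left₀ (norm_nonneg _) (hCF v) 2
    have h2 := hlow v
    have h3 : (CF ^ 2 + 1) * (α * ‖grad v‖ ^ 2) ≤ (CF ^ 2 + 1) * principal κ Ω v v := by gcongr
    rw [mul_pow] at h1
    nlinarith
  refine ⟨√‖B‖ + √((CF ^ 2 + 1) / α), by positivity, fun v => ⟨?_, ?_⟩⟩
  · rw [energyNorm]
    refine (Real.sqrt_le_sqrt (hup v)).trans ?_
    rw [Real.sqrt_mul (norm_nonneg B), Real.sqrt_sq (norm_nonneg v)]
    gcongr
    exact le_add_of_nonneg_right (Real.sqrt_nonneg _)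
  · have h1 := Real.sqrt_le_sqrt (hnorm v)
    rw [Real.sqrt_sq (norm_nonneg _), Real.sqrt_mul (by positivity)] at h1
    refine h1.trans ?_
    rw [energyNorm]
    gcongr
    exact le_add_of_nonneg_left (Real.sqrt_nonneg _)

/-! ### Finite element spaces -/

theorem measurableSet_hull (T : Element d) : MeasurableSet T.hull :=
  (T.finite_toSet.isCompact_convexHull ℝ).measurableSet

theorem memLp_eval (hΩb : Bornology.IsBounded Ω) (P : MvPolynomial (Fin d) ℝ) :
    MemLp (fun x : Pt d => MvPolynomial.eval x.ofLp P) 2 (volume.restrict Ω) := by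
  have hcont : Continuous fun x : Pt d => MvPolynomial.eval x.ofLp P :=
    (MvPolynomial.continuous_eval P).comp (PiLp.continuous_ofLp 2 _)
  have hc : IsCompact (closure Ω) := hΩb.isCompact_closure
  obtain ⟨C, hC⟩ := hc.exists_bound_of_continuousOn hcont.continuousOn
  have : IsFiniteMeasure (volume.restrict (closure Ω)) := ⟨by
    rw [Measure.restrict_apply_univ]
    exact hc.measure_lt_top⟩
  have h : MemLp (fun x : Pt d => MvPolynomial.eval x.ofLp P) 2 (volume.restrict (closure Ω)) :=
    MemLp.of_bound hcont.aestronglyMeasurable C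
      ((ae_restrict_mem isClosed_closure.measurableSet).mono hC)
  exact h.mono_measure (Measure.restrict_mono subset_closure le_rfl)

/-- Polynomials of degree at most `p` as elements of `L²`. -/
noncomputable def polyToLp (hΩb : Bornology.IsBounded Ω) (p : ℕ) :
    MvPolynomial.restrictTotalDegree (Fin d) ℝ p →ₗ[ℝ] Lp ℝ 2 (volume.restrict Ω) where
  toFun P := (memLp_eval hΩb P.1).toLp _
  map_add' P Q := by
    rw [← MemLp.toLp_add]
    exact MemLp.toLp_congr _ _ (Filter.Eventually.of_forall fun x => by simp)
  map_smul' c P := by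
    rw [RingHom.id_apply, ← MemLp.toLp_const_smul]
    exact MemLp.toLp_congr _ _ (Filter.Eventually.of_forall fun x => by simp)

/-- On each element, membership says that the restriction of `v` lies in the finite-dimensional,
hence closed, image of the polynomials. The space is thus an intersection of preimages of closed
sets under continuous maps. Closedness is what the Lax-Milgram lemma needs on discrete spaces. -/
theorem isClosed_feSpace (hΩb : Bornology.IsBounded Ω) (p : ℕ) (𝒯 : Mesh d) :
    IsClosed (feSpace Ω p 𝒯 : Set (H10 Ω)) := by
  let R := fun T : Element d => LpToLpRestrictCLM (Pt d) ℝ ℝ (volume.restrict Ω) 2 T.hull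
  let S := fun T : Element d => (LinearMap.range (polyToLp hΩb p)).map (R T).toLinearMap
  have hS : ∀ T, IsClosed (S T : Set (Lp ℝ 2 ((volume.restrict Ω).restrict T.hull))) :=
    fun T => Submodule.closed_of_finiteDimensional (S T)
  have e : (feSpace Ω p 𝒯 : Set (H10 Ω)) = ⋂ T ∈ 𝒯, (fun v => R T (fnL Ω v)) ⁻¹' (S T) := by
    ext v
    simp only [Set.mem_iInter, Set.mem_preimage]
    refine forall₂_congr fun T _ => ?_
    constructor
    · rintro ⟨P, hP, h⟩
      refine ⟨polyToLp hΩb p ⟨P, (MvPolynomial.mem_restrictTotalDegree _ _ _).mpr hP⟩,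
        ⟨_, rfl⟩, ?_⟩
      refine Lp.ext ?_
      filter_upwards [LpToLpRestrictCLM_coeFn ℝ T.hull (fnL Ω v),
        LpToLpRestrictCLM_coeFn ℝ T.hull (polyToLp hΩb p ⟨P,
          (MvPolynomial.mem_restrictTotalDegree _ _ _).mpr hP⟩),
        (ae_restrict_iff' (measurableSet_hull T)).mpr h,
        ae_restrict_of_ae (s := T.hull) (memLp_eval hΩb P).coeFn_toLp] with x h1 h2 h3 h4
      refine (h2.trans ?_).trans h1.symm
      exact h4.trans h3.symm
    · rintro ⟨_, ⟨P, rfl⟩, h⟩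
      refine ⟨P.1, (MvPolynomial.mem_restrictTotalDegree _ _ _).mp P.2, ?_⟩
      rw [← ae_restrict_iff' (measurableSet_hull T)]
      have h0 : R T (polyToLp hΩb p P) = R T (fnL Ω v) := h
      have h1 := LpToLpRestrictCLM_coeFn ℝ T.hull (fnL Ω v)
      have h2 := LpToLpRestrictCLM_coeFn ℝ T.hull (polyToLp hΩb p P)
      change R T (fnL Ω v) =ᵐ[_] _ at h1
      change R T (polyToLp hΩb p P) =ᵐ[_] _ at h2
      rw [h0] at h2
      filter_upwards [h1, h2, ae_restrict_of_ae (s := T.hull) (memLp_eval hΩb P.1).coeFn_toLp]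
        with x h1 h2 h4
      exact (h1.symm.trans h2).trans h4
  rw [e]
  exact isClosed_biInter fun T _ => (hS T).preimage ((R T).comp (fnL Ω)).continuous

end Forms

end GOAFEM

namespace GOAFEM

/-! ### The primal and dual problem as one Galerkin scheme -/

section Pairs

variable {H : Type*} [NormedAddCommGroup H] [InnerProductSpace ℝ H]

/-- The form `μ a(u,v) + a(y,z) - G(u,y)` on pairs `(u,z)`, `(v,y)`. -/
noncomputable def pairForm (a G : H →L[ℝ] H →L[ℝ] ℝ) (α : ℝ) :
    WithLp 2 (H × H) →L[ℝ] WithLp 2 (H × H) →L[ℝ] ℝ :=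
  (1 / 2 + ‖G‖ ^ 2 / (2 * α ^ 2)) •
      a.bilinearComp (WithLp.fstL 2 ℝ H H) (WithLp.fstL 2 ℝ H H)
    + a.flip.bilinearComp (WithLp.sndL 2 ℝ H H) (WithLp.sndL 2 ℝ H H)
    - G.bilinearComp (WithLp.fstL 2 ℝ H H) (WithLp.sndL 2 ℝ H H)

variable {a G : H →L[ℝ] H →L[ℝ] ℝ} {α : ℝ}

theorem pairForm_apply (p q : WithLp 2 (H × H)) : pairForm a G α p q =
    (1 / 2 + ‖G‖ ^ 2 / (2 * α ^ 2)) * a p.fst q.fst + a q.snd p.snd - G p.fst q.snd := rfl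

/-- The weight of the primal part is chosen for Young's inequality: half of the dual coercivity and
the share `‖G‖² / (2α²)` of the weight absorb the coupling, and `α / 2` is left in both components.
-/
theorem pairForm_coercive (hα : 0 < α) (hco : ∀ v, α * ‖v‖ ^ 2 ≤ a v v) (p : WithLp 2 (H × H)) :
    α / 2 * ‖p‖ ^ 2 ≤ pairForm a G α p p := by
  rw [pairForm_apply, WithLp.prod_norm_sq_eq_of_L2]
  have h1 := hco p.fst
  have h2 := hco p.snd
  have h3 : G p.fst p.snd ≤ ‖G‖ * ‖p.fst‖ * ‖p.snd‖ :=
    (le_abs_self _).trans (G.le_opNorm₂ _ _)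
  have h4 : (1 / 2 + ‖G‖ ^ 2 / (2 * α ^ 2)) * (α * ‖p.fst‖ ^ 2)
      ≤ (1 / 2 + ‖G‖ ^ 2 / (2 * α ^ 2)) * a p.fst p.fst :=
    mul_le_mul_of_nonneg_left h1 (by positivity)
  have h5 : 0 ≤ α / 2 * (‖p.snd‖ - ‖G‖ / α * ‖p.fst‖) ^ 2 := by positivity
  have h6 : α / 2 * (‖p.snd‖ - ‖G‖ / α * ‖p.fst‖) ^ 2 =
      α / 2 * ‖p.snd‖ ^ 2 - ‖G‖ * ‖p.fst‖ * ‖p.snd‖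
        + ‖G‖ ^ 2 / (2 * α ^ 2) * (α * ‖p.fst‖ ^ 2) := by
    field_simp
    ring
  linarith

theorem exists_bound_bilinear {V W : Type*} [NormedAddCommGroup V] [NormedSpace ℝ V]
    [NormedAddCommGroup W] [NormedSpace ℝ W] (B : V →L[ℝ] W →L[ℝ] ℝ) :
    ∃ M : ℝ, 0 < M ∧ ∀ p q, |B p q| ≤ M * ‖p‖ * ‖q‖ := by
  refine ⟨‖B‖ + 1, by positivity, fun p q => (B.le_opNorm₂ p q).trans ?_⟩
  gcongr
  linarith

/-- Pairs of elements of `X`. -/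
noncomputable def pairSpace (X : Submodule ℝ H) : Submodule ℝ (WithLp 2 (H × H)) :=
  X.comap (WithLp.fstL 2 ℝ H H).toLinearMap ⊓ X.comap (WithLp.sndL 2 ℝ H H).toLinearMap

theorem isClosed_pairSpace {X : Submodule ℝ H} (hX : IsClosed (X : Set H)) :
    IsClosed (pairSpace X : Set (WithLp 2 (H × H))) :=
  (hX.preimage (WithLp.fstL 2 ℝ H H).continuous).inter
    (hX.preimage (WithLp.sndL 2 ℝ H H).continuous)

theorem pairSpace_mono : Monotone (pairSpace (H := H)) := fun _ _ h _ hp => ⟨h hp.1, h hp.2⟩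

/-- `u` and `z` solve the primal problem with right-hand side `F` and the dual problem linearized
around `u`, with test functions in `X`. -/
structure SolvesOn (a G : H →L[ℝ] H →L[ℝ] ℝ) (F : H → ℝ) (X : Submodule ℝ H) (u z : H) : Prop where
  mem_primal : u ∈ X
  mem_dual : z ∈ X
  primal : ∀ v ∈ X, a u v = F v
  dual : ∀ v ∈ X, a v z = G u v

/-- The two dual problems are linearized at `u` and `u'`, so `a(v, z - z') = G(u - u', v)` need not
vanish. The coupling term in `pairForm` subtracts exactly this defect. -/
theorem SolvesOn.orthogonal {F : H → ℝ} {X : Submodule ℝ H} {u z u' z' : H}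
    (h : SolvesOn a G F ⊤ u z) (h' : SolvesOn a G F X u' z') {q : WithLp 2 (H × H)}
    (hq : q ∈ pairSpace X) :
    pairForm a G α (WithLp.toLp 2 (u, z) - WithLp.toLp 2 (u', z')) q = 0 := by
  rw [pairForm_apply]
  have h1 : q.fst ∈ X := hq.1
  have h2 : q.snd ∈ X := hq.2
  simp only [WithLp.sub_fst, WithLp.sub_snd, WithLp.toLp_fst, WithLp.toLp_snd, map_sub, sub_apply]
  rw [h.primal _ trivial, h'.primal _ h1, h.dual _ trivial, h'.dual _ h2]
  ring

/-- Nested Galerkin approximations of the combined problem are bounded by the coarse error. -/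
theorem exists_pair_stability (a G : H →L[ℝ] H →L[ℝ] ℝ) {α : ℝ} (hα : 0 < α)
    (hco : ∀ v, α * ‖v‖ ^ 2 ≤ a v v) : ∃ C : ℝ, 0 < C ∧
      ∀ (F : H → ℝ) (X X' : Submodule ℝ H) (u z u₁ z₁ u₂ z₂ : H), X ≤ X' →
        SolvesOn a G F ⊤ u z → SolvesOn a G F X u₁ z₁ → SolvesOn a G F X' u₂ z₂ →
        ‖u₂ - u₁‖ ^ 2 + ‖z₂ - z₁‖ ^ 2 ≤ C * (‖u - u₁‖ ^ 2 + ‖z - z₁‖ ^ 2) := by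
  obtain ⟨M, hM, hB⟩ := exists_bound_bilinear (pairForm a G α)
  refine ⟨(M / (α / 2)) ^ 2, by positivity, fun F X X' u z u₁ z₁ u₂ z₂ hX h h₁ h₂ => ?_⟩
  have h3 := norm_galerkin_sub_le (half_pos hα) hM.le (pairForm_coercive (G := G) hα hco) hB
    (X := pairSpace X') (x := WithLp.toLp 2 (u, z)) (y := WithLp.toLp 2 (u₂, z₂))
    (z := WithLp.toLp 2 (u₁, z₁)) ⟨h₂.mem_primal, h₂.mem_dual⟩
    ⟨hX h₁.mem_primal, hX h₁.mem_dual⟩ (fun v hv => h.orthogonal h₂ hv)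
  have h4 := pow_le_pow_left₀ (norm_nonneg _) h3 2
  rw [mul_pow, WithLp.prod_norm_sq_eq_of_L2, WithLp.prod_norm_sq_eq_of_L2] at h4
  exact h4

/-- Quasi-orthogonality of the combined problem, with a sublinearly growing constant. -/
theorem exists_pair_quasi_orthogonality [CompleteSpace H] (a G : H →L[ℝ] H →L[ℝ] ℝ) {α : ℝ}
    (hα : 0 < α) (hco : ∀ v, α * ‖v‖ ^ 2 ≤ a v v) :
    ∃ Co c : ℝ, 0 ≤ Co ∧ 0 ≤ c ∧ c < 1 ∧
      ∀ (F : H → ℝ) (X : ℕ → Submodule ℝ H) (u z : H) (us zs : ℕ → H), Monotone X →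
        (∀ k, IsClosed (X k : Set H)) → SolvesOn a G F ⊤ u z →
        (∀ k, SolvesOn a G F (X k) (us k) (zs k)) → ∀ ℓ m : ℕ,
        ∑ k ∈ Finset.Ico ℓ (ℓ + 2 ^ m), (‖us (k + 1) - us k‖ ^ 2 + ‖zs (k + 1) - zs k‖ ^ 2)
          ≤ Co * (1 + c) ^ m * (‖u - us ℓ‖ ^ 2 + ‖z - zs ℓ‖ ^ 2) := by
  obtain ⟨M, hM, hB⟩ := exists_bound_bilinear (pairForm a G α)
  refine ⟨(M * ((1 + M / (α / 2)) / (α / 2))) ^ 2, angleConst (α / 2) M, sq_nonneg _,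
    angleConst_nonneg, angleConst_lt_one (half_pos hα) hM,
    fun F X u z us zs hmono hcl h hs ℓ m => ?_⟩
  have h1 := sum_sq_galerkin_sub_le (half_pos hα) hM (pairForm_coercive (G := G) hα hco) hB
    (Y := fun k => pairSpace (X k)) (fun i j hij => pairSpace_mono (hmono hij))
    (fun k => isClosed_pairSpace (hcl k)) (x := WithLp.toLp 2 (u, z))
    (xs := fun k => WithLp.toLp 2 (us k, zs k)) (fun k => ⟨(hs k).mem_primal, (hs k).mem_dual⟩)
    (fun k v hv => h.orthogonal (hs k) hv) ℓ m
  simp only [WithLp.prod_norm_sq_eq_of_L2] at h1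
  exact h1

theorem exists_symm_form (K : H →L[ℝ] StrongDual ℝ H) :
    ∃ (G : H →L[ℝ] H →L[ℝ] ℝ), ∀ w v, G w v = K v w + K w v :=
  ⟨K + K.flip, fun w v => by simp [add_comm]⟩

/-- The bound `C` on the functional `G (w - w')` is left free: boundedness of `G` provides a
multiple of `‖w - w'‖`, compactness later a much smaller value. -/
theorem norm_sub_le_of_dual (hα : 0 < α) (hco : ∀ v, α * ‖v‖ ^ 2 ≤ a v v) {X : Submodule ℝ H}
    {z z' w w' : H} {C : ℝ} (hz : z ∈ X) (hz' : z' ∈ X) (h : ∀ v ∈ X, a v z = G w v)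
    (h' : ∀ v ∈ X, a v z' = G w' v) (hC0 : 0 ≤ C) (hC : ∀ v, |G (w - w') v| ≤ C * ‖v‖) :
    ‖z - z'‖ ≤ C / α := by
  refine norm_le_of_coercive (B := a) hα (hco _) ?_ hC0
  have hm := X.sub_mem hz hz'
  rw [map_sub, h _ hm, h' _ hm, ← sub_apply, ← map_sub]
  exact (le_abs_self _).trans (hC _)

end Pairs

variable {d : ℕ} {Ω : Set (Pt d)} {κ : Coeff d} {K : GoalOp Ω}

/-! ### Analytic setting -/

/-- The forms `a(w,v)` and `b(v,w) + b(w,v)` as bounded bilinear forms on `H¹₀(Ω)`, with the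
ellipticity constant, the bound of the latter and a constant for the equivalence of the energy norm
and the norm of `H¹₀(Ω)`. -/
structure Setting (κ : Coeff d) (K : GoalOp Ω) where
  a : H10 Ω →L[ℝ] H10 Ω →L[ℝ] ℝ
  a_apply : ∀ u v, a u v = form κ Ω u v
  α : ℝ
  α_pos : 0 < α
  coercive : ∀ v, α * ‖v‖ ^ 2 ≤ a v v
  G : H10 Ω →L[ℝ] H10 Ω →L[ℝ] ℝ
  G_apply : ∀ w v, G w v = K v w + K w v
  MG : ℝ
  MG_pos : 0 < MG
  G_le : ∀ w v, |G w v| ≤ MG * ‖w‖ * ‖v‖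
  CE : ℝ
  CE_pos : 0 < CE
  energy_le : ∀ v : H10 Ω, energyNorm κ v ≤ CE * ‖v‖
  le_energy : ∀ v : H10 Ω, ‖v‖ ≤ CE * energyNorm κ v
  closed : ∀ p 𝒯, IsClosed (feSpace Ω p 𝒯 : Set (H10 Ω))

theorem nonempty_setting (hd : 2 ≤ d) (hΩb : Bornology.IsBounded Ω) (hκ : κ.Admissible Ω)
    (K : GoalOp Ω) : Nonempty (Setting κ K) := by
  obtain ⟨a, ha⟩ := exists_formL hκ
  obtain ⟨α, hα, hco⟩ := hκ.elliptic
  obtain ⟨CE, hCE, h⟩ := exists_energyNorm_equiv hd hΩb hκ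
  obtain ⟨G, hG⟩ := exists_symm_form K
  obtain ⟨M, hM, hGM⟩ := exists_bound_bilinear G
  exact ⟨⟨a, ha, α, hα, fun v => (ha v v).symm ▸ hco v, G, hG, M, hM, hGM, CE, hCE,
    fun v => (h v).1, fun v => (h v).2, fun p 𝒯 => isClosed_feSpace hΩb p 𝒯⟩⟩

namespace Setting

/-- Existence by Lax-Milgram is what gives `Classical.epsilon` its meaning; the defining equations
of the chosen element suffice for all later arguments. -/
theorem primalIn_spec (S : Setting κ K) (D : Data Ω) {X : Submodule ℝ (H10 Ω)}
    (hX : IsClosed (X : Set (H10 Ω))) :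
    D.primalIn κ X ∈ X ∧ ∀ v ∈ X, S.a (D.primalIn κ X) v = D.rhs v := by
  obtain ⟨F, hF⟩ := D.exists_rhsL
  obtain ⟨u, hu, hu'⟩ := exists_galerkin S.a S.α_pos S.coercive hX F
  have h : ∃ u, u ∈ X ∧ ∀ v ∈ X, form κ Ω u v = D.rhs v :=
    ⟨u, hu, fun v hv => by rw [← S.a_apply, hu' v hv, hF]⟩
  have h' := Classical.epsilon_spec h
  exact ⟨h'.1, fun v hv => (S.a_apply _ _).trans (h'.2 v hv)⟩

theorem dualIn_spec (S : Setting κ K) {X : Submodule ℝ (H10 Ω)}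
    (hX : IsClosed (X : Set (H10 Ω))) (w : H10 Ω) :
    dualIn κ K X w ∈ X ∧ ∀ v ∈ X, S.a v (dualIn κ K X w) = S.G w v := by
  obtain ⟨z, hz, hz'⟩ := exists_galerkin S.a.flip S.α_pos S.coercive hX (S.G w)
  have h : ∃ z, z ∈ X ∧ ∀ v ∈ X, form κ Ω v z = K v w + K w v :=
    ⟨z, hz, fun v hv => by rw [← S.a_apply, ← S.G_apply, ← hz' v hv]; rfl⟩
  have h' := Classical.epsilon_spec h
  exact ⟨h'.1, fun v hv => (S.a_apply _ _).trans ((h'.2 v hv).trans (S.G_apply _ _).symm)⟩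

theorem solH_mem (S : Setting κ K) (D : Data Ω) (𝒯 : Mesh d) : D.solH κ 𝒯 ∈ D.space 𝒯 :=
  (S.primalIn_spec D (S.closed D.p 𝒯)).1

theorem dualH_mem (S : Setting κ K) (D : Data Ω) (𝒯 : Mesh d) (w : H10 Ω) :
    D.dualH κ K 𝒯 w ∈ D.space 𝒯 :=
  (S.dualIn_spec (S.closed D.p 𝒯) w).1

theorem dualLinH_mem (S : Setting κ K) (D : Data Ω) (𝒯 : Mesh d) : D.dualLinH κ K 𝒯 ∈ D.space 𝒯 :=
  S.dualH_mem D 𝒯 _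

theorem solvesOn_sol (S : Setting κ K) (D : Data Ω) :
    SolvesOn S.a S.G D.rhs ⊤ (D.sol κ) (dualSol κ K (D.sol κ)) :=
  ⟨trivial, trivial, (S.primalIn_spec D (X := ⊤) isClosed_univ).2,
    (S.dualIn_spec (X := ⊤) isClosed_univ _).2⟩

theorem solvesOn_solH (S : Setting κ K) (D : Data Ω) (𝒯 : Mesh d) :
    SolvesOn S.a S.G D.rhs (D.space 𝒯) (D.solH κ 𝒯) (D.dualLinH κ K 𝒯) :=
  ⟨S.solH_mem D 𝒯, S.dualLinH_mem D 𝒯, (S.primalIn_spec D (S.closed D.p 𝒯)).2,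
    (S.dualIn_spec (S.closed D.p 𝒯) _).2⟩

/-- The dual solution depends continuously on the linearization point. -/
theorem norm_dualIn_sub_le (S : Setting κ K) {X : Submodule ℝ (H10 Ω)}
    (hX : IsClosed (X : Set (H10 Ω))) {w w' : H10 Ω} {C : ℝ} (hC0 : 0 ≤ C)
    (hC : ∀ v, |S.G (w - w') v| ≤ C * ‖v‖) :
    ‖dualIn κ K X w - dualIn κ K X w'‖ ≤ C / S.α := by
  obtain ⟨h1, h2⟩ := S.dualIn_spec hX w
  obtain ⟨h3, h4⟩ := S.dualIn_spec hX w'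
  exact norm_sub_le_of_dual S.α_pos S.coercive h1 h3 h2 h4 hC0 hC

theorem norm_dualH_sub_le (S : Setting κ K) (D : Data Ω) (𝒯 : Mesh d) (w w' : H10 Ω) :
    ‖D.dualH κ K 𝒯 w - D.dualH κ K 𝒯 w'‖ ≤ S.MG / S.α * ‖w - w'‖ := by
  have := S.norm_dualIn_sub_le (S.closed D.p 𝒯) (mul_nonneg S.MG_pos.le (norm_nonneg (w - w')))
    (S.G_le _)
  rwa [mul_div_right_comm] at this

theorem norm_dualSol_sub_le (S : Setting κ K) (w w' : H10 Ω) :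
    ‖dualSol κ K w - dualSol κ K w'‖ ≤ S.MG / S.α * ‖w - w'‖ := by
  have := S.norm_dualIn_sub_le (X := ⊤) isClosed_univ
    (mul_nonneg S.MG_pos.le (norm_nonneg (w - w'))) (S.G_le _)
  rwa [mul_div_right_comm] at this

theorem energyNorm_zero (S : Setting κ K) : energyNorm κ (0 : H10 Ω) = 0 :=
  le_antisymm (by simpa using S.energy_le 0) (energyNorm_nonneg _ _)

end Setting

/-- The squared error of the approximation of `u` and `z[u]`. -/
noncomputable def Data.errSq (D : Data Ω) (κ : Coeff d) (K : GoalOp Ω) (𝒯 : Mesh d) : ℝ :=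
  ‖D.sol κ - D.solH κ 𝒯‖ ^ 2 + ‖dualSol κ K (D.sol κ) - D.dualLinH κ K 𝒯‖ ^ 2

/-- The squared distance of the discrete solutions on two meshes. -/
noncomputable def Data.distSq (D : Data Ω) (κ : Coeff d) (K : GoalOp Ω) (𝒯 𝒯' : Mesh d) : ℝ :=
  ‖D.solH κ 𝒯' - D.solH κ 𝒯‖ ^ 2 + ‖D.dualLinH κ K 𝒯' - D.dualLinH κ K 𝒯‖ ^ 2

namespace Setting

theorem exists_distSq_le (S : Setting κ K) : ∃ C : ℝ, 0 < C ∧ ∀ (D : Data Ω) (𝒯 𝒯' : Mesh d),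
    D.space 𝒯 ≤ D.space 𝒯' → D.distSq κ K 𝒯 𝒯' ≤ C * D.errSq κ K 𝒯 := by
  obtain ⟨C, hC, h⟩ := exists_pair_stability S.a S.G S.α_pos S.coercive
  exact ⟨C, hC, fun D 𝒯 𝒯' hX => h D.rhs _ _ _ _ _ _ _ _ hX (S.solvesOn_sol D)
    (S.solvesOn_solH D 𝒯) (S.solvesOn_solH D 𝒯')⟩

theorem exists_quasi_orthogonality (S : Setting κ K) :
    ∃ Co c : ℝ, 0 ≤ Co ∧ 0 ≤ c ∧ c < 1 ∧ ∀ (D : Data Ω) (𝒯 : ℕ → Mesh d),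
      Monotone (fun k => D.space (𝒯 k)) → ∀ ℓ m : ℕ,
        ∑ k ∈ Finset.Ico ℓ (ℓ + 2 ^ m), D.distSq κ K (𝒯 k) (𝒯 (k + 1))
          ≤ Co * (1 + c) ^ m * D.errSq κ K (𝒯 ℓ) := by
  obtain ⟨Co, c, h1, h2, h3, h⟩ := exists_pair_quasi_orthogonality S.a S.G S.α_pos S.coercive
  exact ⟨Co, c, h1, h2, h3, fun D 𝒯 hmono => h D.rhs _ _ _ _ _ hmono
    (fun k => S.closed D.p (𝒯 k)) (S.solvesOn_sol D) (fun k => S.solvesOn_solH D (𝒯 k))⟩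

end Setting

/-! ### Refinements -/

namespace Data

variable {D : Data Ω} {Cmesh Cstab Clip qred Crel Cdrel θ Cmark : ℝ}

theorem Refinement.refl (𝒯 : Mesh d) : D.Refinement 𝒯 𝒯 := Relation.ReflTransGen.refl

theorem Refinement.trans {𝒯 𝒯' 𝒯'' : Mesh d} (h : D.Refinement 𝒯 𝒯') (h' : D.Refinement 𝒯' 𝒯'') :
    D.Refinement 𝒯 𝒯'' := Relation.ReflTransGen.trans h h'

theorem IsMesh.refinement {𝒯 𝒯' : Mesh d} (h : D.IsMesh 𝒯) (h' : D.Refinement 𝒯 𝒯') :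
    D.IsMesh 𝒯' := Relation.ReflTransGen.trans h h'

theorem isMesh_mesh₀ : D.IsMesh D.mesh₀ := Relation.ReflTransGen.refl

/-- A polynomial on an old element restricts to the new elements contained in it; induction over the
refinement steps does the rest. -/
theorem MeshAssumptions.space_mono (hM : D.MeshAssumptions Cmesh) {𝒯 𝒯' : Mesh d}
    (h : D.IsMesh 𝒯) (h' : D.Refinement 𝒯 𝒯') : D.space 𝒯 ≤ D.space 𝒯' := by
  induction h' with
  | refl => exact le_rfl
  | tail h1 h2 ih =>
    obtain ⟨ℳ, hℳ, rfl⟩ := h2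
    refine ih.trans fun v hv T' hT' => ?_
    obtain ⟨T, hT, hsub⟩ := hM.subdivision _ (h.refinement h1) ℳ hℳ T' hT'
    obtain ⟨P, hP, hv'⟩ := hv T hT
    exact ⟨P, hP, hv'.mono fun x hx hxT => hx (hsub hxT)⟩

theorem MeshAssumptions.card_le (hM : D.MeshAssumptions Cmesh) {𝒯 𝒯' : Mesh d}
    (h : D.IsMesh 𝒯) (h' : D.Refinement 𝒯 𝒯') : 𝒯.card ≤ 𝒯'.card :=
  (Nat.le_add_left _ _).trans (hM.sons 𝒯 𝒯' h h')

theorem IsRun.refinement {𝒯 : ℕ → Mesh d} {ℳ : ℕ → Finset (Element d)}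
    (h : D.IsRun κ K θ Cmark 𝒯 ℳ) {ℓ n : ℕ} (hn : ℓ ≤ n) : D.Refinement (𝒯 ℓ) (𝒯 n) := by
  induction n, hn using Nat.le_induction with
  | base => exact Refinement.refl _
  | succ n _ ih => exact ih.tail ⟨ℳ n, h.subset n, h.step n⟩

theorem IsRun.isMesh {𝒯 : ℕ → Mesh d} {ℳ : ℕ → Finset (Element d)}
    (h : D.IsRun κ K θ Cmark 𝒯 ℳ) (ℓ : ℕ) : D.IsMesh (𝒯 ℓ) := by
  have := h.refinement (Nat.zero_le ℓ)
  rwa [IsRun.init h] at this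

/-! ### Estimators -/

theorem etaOn_nonneg (𝒯 : Mesh d) (𝒰 : Finset (Element d)) (v : H10 Ω) : 0 ≤ D.etaOn 𝒯 𝒰 v :=
  Real.sqrt_nonneg _

theorem zetaOn_nonneg (𝒯 : Mesh d) (w : H10 Ω) (𝒰 : Finset (Element d)) (v : H10 Ω) :
    0 ≤ D.zetaOn 𝒯 w 𝒰 v :=
  Real.sqrt_nonneg _

theorem etaOn_sq (𝒯 : Mesh d) (𝒰 : Finset (Element d)) (v : H10 Ω) :
    D.etaOn 𝒯 𝒰 v ^ 2 = ∑ T ∈ 𝒰, D.eta 𝒯 T v ^ 2 :=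
  Real.sq_sqrt (Finset.sum_nonneg fun _ _ => sq_nonneg _)

theorem zetaOn_sq (𝒯 : Mesh d) (w : H10 Ω) (𝒰 : Finset (Element d)) (v : H10 Ω) :
    D.zetaOn 𝒯 w 𝒰 v ^ 2 = ∑ T ∈ 𝒰, D.zeta 𝒯 w T v ^ 2 :=
  Real.sq_sqrt (Finset.sum_nonneg fun _ _ => sq_nonneg _)

theorem etaOn_sq_split (𝒯 𝒯' : Mesh d) (𝒯₁ : Mesh d) (v : H10 Ω) :
    D.etaOn 𝒯₁ 𝒯 v ^ 2 = D.etaOn 𝒯₁ (𝒯 ∩ 𝒯') v ^ 2 + D.etaOn 𝒯₁ (𝒯 \ 𝒯') v ^ 2 := by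
  simp only [etaOn_sq]
  exact (Finset.sum_inter_add_sum_sdiff 𝒯 𝒯' _).symm

theorem zetaOn_sq_split (𝒯 𝒯' : Mesh d) (𝒯₁ : Mesh d) (w v : H10 Ω) :
    D.zetaOn 𝒯₁ w 𝒯 v ^ 2 = D.zetaOn 𝒯₁ w (𝒯 ∩ 𝒯') v ^ 2 + D.zetaOn 𝒯₁ w (𝒯 \ 𝒯') v ^ 2 := by
  simp only [zetaOn_sq]
  exact (Finset.sum_inter_add_sum_sdiff 𝒯 𝒯' _).symm

theorem combSq_nonneg (𝒯 : Mesh d) (𝒰 : Finset (Element d)) (v w : H10 Ω) :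
    0 ≤ D.combSq 𝒯 𝒰 v w := add_nonneg (sq_nonneg _) (sq_nonneg _)

theorem combSq_split (𝒯 𝒯' 𝒯₁ : Mesh d) (v w : H10 Ω) :
    D.combSq 𝒯₁ 𝒯 v w = D.combSq 𝒯₁ (𝒯 ∩ 𝒯') v w + D.combSq 𝒯₁ (𝒯 \ 𝒯') v w := by
  simp only [combSq]
  rw [etaOn_sq_split 𝒯 𝒯', zetaOn_sq_split 𝒯 𝒯']
  ring

theorem combSq_mono {𝒰 𝒰' : Finset (Element d)} (h : 𝒰 ⊆ 𝒰') (𝒯 : Mesh d) (v w : H10 Ω) :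
    D.combSq 𝒯 𝒰 v w ≤ D.combSq 𝒯 𝒰' v w := by
  simp only [combSq, etaOn_sq, zetaOn_sq]
  exact add_le_add (Finset.sum_le_sum_of_subset_of_nonneg h fun _ _ _ => sq_nonneg _)
    (Finset.sum_le_sum_of_subset_of_nonneg h fun _ _ _ => sq_nonneg _)

theorem est_nonneg (𝒯 : Mesh d) : 0 ≤ D.est κ K 𝒯 := combSq_nonneg _ _ _ _

theorem etaOn_le_sqrt_est (𝒯 : Mesh d) : D.etaOn 𝒯 𝒯 (D.solH κ 𝒯) ≤ √(D.est κ K 𝒯) :=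
  Real.le_sqrt_of_sq_le (le_add_of_nonneg_right (sq_nonneg _))

theorem zetaOn_le_sqrt_est (𝒯 : Mesh d) :
    D.zetaOn 𝒯 (D.solH κ 𝒯) 𝒯 (D.dualLinH κ K 𝒯) ≤ √(D.est κ K 𝒯) :=
  Real.le_sqrt_of_sq_le (le_add_of_nonneg_left (sq_nonneg _))

/-- The reverse triangle inequality in `ℝ²`. -/
theorem _root_.GOAFEM.abs_sqrt_sub_sqrt_le (x y x' y' : ℝ) :
    |√(x ^ 2 + y ^ 2) - √(x' ^ 2 + y' ^ 2)| ≤ |x - x'| + |y - y'| := by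
  have key : ∀ x y x' y' : ℝ, √(x ^ 2 + y ^ 2) ≤ √(x' ^ 2 + y' ^ 2) + (|x - x'| + |y - y'|) := by
    intro x y x' y'
    refine Real.sqrt_le_iff.mpr ⟨by positivity, ?_⟩
    set r := √(x' ^ 2 + y' ^ 2)
    have hr : r ^ 2 = x' ^ 2 + y' ^ 2 := Real.sq_sqrt (by positivity)
    have h1 : |x'| ≤ r := Real.abs_le_sqrt (by nlinarith)
    have h2 : |y'| ≤ r := Real.abs_le_sqrt (by nlinarith)
    have h3 : x' * (x - x') ≤ r * |x - x'| := by
      refine (le_abs_self _).trans ?_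
      rw [abs_mul]
      gcongr
    have h4 : y' * (y - y') ≤ r * |y - y'| := by
      refine (le_abs_self _).trans ?_
      rw [abs_mul]
      gcongr
    have h5 := sq_abs (x - x')
    have h6 := sq_abs (y - y')
    nlinarith [mul_nonneg (abs_nonneg (x - x')) (abs_nonneg (y - y'))]
  rw [abs_le]
  constructor
  · have := key x' y' x y
    rw [abs_sub_comm x' x, abs_sub_comm y' y] at this
    linarith
  · linarith [key x y x' y']

end Data

end GOAFEM

namespace GOAFEM

variable {d : ℕ} {Ω : Set (Pt d)} {κ : Coeff d} {K : GoalOp Ω}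
variable {Cmesh Cstab Clip qred Crel Cdrel θ Cmark : ℝ}

namespace Data

variable {D : Data Ω}

/-! ### Consequences of the axioms -/

namespace Axioms

theorem abs_etaOn_sub_le (hA : D.Axioms κ K Cstab Clip qred Crel Cdrel) (S : Setting κ K)
    {𝒯 𝒯' : Mesh d} (h : D.IsMesh 𝒯) (h' : D.Refinement 𝒯 𝒯') {v v' : H10 Ω}
    (hv : v ∈ D.space 𝒯) (hv' : v' ∈ D.space 𝒯') {𝒰 : Finset (Element d)} (hU : 𝒰 ⊆ 𝒯' ∩ 𝒯) :
    |D.etaOn 𝒯' 𝒰 v' - D.etaOn 𝒯 𝒰 v| ≤ Cstab * energyNorm κ (v' - v) := by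
  have h1 := hA.stability 𝒯 𝒯' h h' v' hv' v hv 0 0 𝒰 hU
  rw [sub_self (0 : H10 Ω), S.energyNorm_zero, mul_zero, add_zero] at h1
  linarith [abs_nonneg (D.zetaOn 𝒯' 0 𝒰 v' - D.zetaOn 𝒯 0 𝒰 v)]

theorem abs_zetaOn_sub_le (hA : D.Axioms κ K Cstab Clip qred Crel Cdrel)
    {𝒯 𝒯' : Mesh d} (h : D.IsMesh 𝒯) (h' : D.Refinement 𝒯 𝒯') {v v' : H10 Ω}
    (hv : v ∈ D.space 𝒯) (hv' : v' ∈ D.space 𝒯') (w w' : H10 Ω) {𝒰 : Finset (Element d)}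
    (hU : 𝒰 ⊆ 𝒯' ∩ 𝒯) :
    |D.zetaOn 𝒯' w' 𝒰 v' - D.zetaOn 𝒯 w 𝒰 v|
      ≤ Cstab * energyNorm κ (v' - v) + Clip * energyNorm κ (w' - w) := by
  have h1 := hA.stability 𝒯 𝒯' h h' v' hv' v hv w' w 𝒰 hU
  linarith [abs_nonneg (D.etaOn 𝒯' 𝒰 v' - D.etaOn 𝒯 𝒰 v)]

/-- Stability of the combined estimator. -/
theorem abs_sqrt_combSq_sub_le (hA : D.Axioms κ K Cstab Clip qred Crel Cdrel) (S : Setting κ K)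
    (hl : 0 ≤ Clip) {𝒯 𝒯' : Mesh d} (h : D.IsMesh 𝒯) (h' : D.Refinement 𝒯 𝒯') {v w v' w' : H10 Ω}
    (hv : v ∈ D.space 𝒯) (hw : w ∈ D.space 𝒯) (hv' : v' ∈ D.space 𝒯') (hw' : w' ∈ D.space 𝒯')
    {𝒰 : Finset (Element d)} (hU : 𝒰 ⊆ 𝒯' ∩ 𝒯) :
    |√(D.combSq 𝒯' 𝒰 v' w') - √(D.combSq 𝒯 𝒰 v w)|
      ≤ (Cstab + Clip) * (energyNorm κ (v' - v) + energyNorm κ (w' - w)) := by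
  refine (abs_sqrt_sub_sqrt_le _ _ _ _).trans ?_
  have h1 := hA.abs_etaOn_sub_le S h h' hv hv' hU
  have h2 := hA.abs_zetaOn_sub_le h h' hw hw' v v' hU
  have h3 := mul_nonneg hl (energyNorm_nonneg κ (w' - w))
  linarith

/-- For one fixed discrete function, stability at distance zero gives equal contributions on the
common elements, and (A2) shrinks those of the refined elements. -/
theorem etaOn_refined_sq_le (hA : D.Axioms κ K Cstab Clip qred Crel Cdrel) (S : Setting κ K)
    (hM : D.MeshAssumptions Cmesh) {𝒯 𝒯' : Mesh d} (h : D.IsMesh 𝒯) (h' : D.Refinement 𝒯 𝒯')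
    {v : H10 Ω} (hv : v ∈ D.space 𝒯) :
    D.etaOn 𝒯' 𝒯' v ^ 2 ≤ D.etaOn 𝒯 𝒯 v ^ 2 - (1 - qred ^ 2) * D.etaOn 𝒯 (𝒯 \ 𝒯') v ^ 2 := by
  have h1 := hA.abs_etaOn_sub_le S h h' hv (hM.space_mono h h' hv) (Finset.Subset.refl (𝒯' ∩ 𝒯))
  rw [sub_self v, S.energyNorm_zero, mul_zero] at h1
  have h2 : D.etaOn 𝒯' (𝒯' ∩ 𝒯) v = D.etaOn 𝒯 (𝒯 ∩ 𝒯') v := by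
    rw [Finset.inter_comm 𝒯 𝒯']
    exact sub_eq_zero.mp (abs_nonpos_iff.mp h1)
  have h3 := pow_le_pow_left₀ (etaOn_nonneg _ _ _) (hA.reduction_eta 𝒯 𝒯' h h' v hv) 2
  rw [etaOn_sq_split 𝒯' 𝒯 𝒯', etaOn_sq_split 𝒯 𝒯' 𝒯, h2]
  rw [mul_pow] at h3
  linarith

theorem zetaOn_refined_sq_le (hA : D.Axioms κ K Cstab Clip qred Crel Cdrel) (S : Setting κ K)
    (hM : D.MeshAssumptions Cmesh) {𝒯 𝒯' : Mesh d} (h : D.IsMesh 𝒯) (h' : D.Refinement 𝒯 𝒯')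
    (w : H10 Ω) {v : H10 Ω} (hv : v ∈ D.space 𝒯) :
    D.zetaOn 𝒯' w 𝒯' v ^ 2
      ≤ D.zetaOn 𝒯 w 𝒯 v ^ 2 - (1 - qred ^ 2) * D.zetaOn 𝒯 w (𝒯 \ 𝒯') v ^ 2 := by
  have h1 := hA.abs_zetaOn_sub_le h h' hv (hM.space_mono h h' hv) w w
    (Finset.Subset.refl (𝒯' ∩ 𝒯))
  rw [sub_self v, sub_self w, S.energyNorm_zero, mul_zero, mul_zero, add_zero] at h1
  have h2 : D.zetaOn 𝒯' w (𝒯' ∩ 𝒯) v = D.zetaOn 𝒯 w (𝒯 ∩ 𝒯') v := by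
    rw [Finset.inter_comm 𝒯 𝒯']
    exact sub_eq_zero.mp (abs_nonpos_iff.mp h1)
  have h3 := pow_le_pow_left₀ (zetaOn_nonneg _ _ _ _) (hA.reduction_zeta 𝒯 𝒯' h h' v hv w) 2
  rw [zetaOn_sq_split 𝒯' 𝒯 𝒯', zetaOn_sq_split 𝒯 𝒯' 𝒯, h2]
  rw [mul_pow] at h3
  linarith

/-- Reduction of the combined estimator up to the distance of the discrete solutions. -/
theorem sqrt_est_refined_le (hA : D.Axioms κ K Cstab Clip qred Crel Cdrel) (S : Setting κ K)
    (hs : 0 ≤ Cstab) (hl : 0 ≤ Clip) (hM : D.MeshAssumptions Cmesh) {𝒯 𝒯' : Mesh d}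
    (h : D.IsMesh 𝒯) (h' : D.Refinement 𝒯 𝒯') :
    √(D.est κ K 𝒯') ≤ √(D.est κ K 𝒯 - (1 - qred ^ 2) * D.estOn κ K 𝒯 (𝒯 \ 𝒯'))
      + 2 * (Cstab + Clip) * S.CE * √(D.distSq κ K 𝒯 𝒯') := by
  have hmono := hM.space_mono h h'
  -- Stability is applied on the fine mesh, viewed as its own refinement, so that the whole of `𝒯'`
  -- is admissible. The change of mesh is then made with the coarse functions held fixed.
  have h1 := hA.abs_sqrt_combSq_sub_le S hl (h.refinement h') (Refinement.refl 𝒯')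
    (hmono (S.solH_mem D 𝒯)) (hmono (S.dualLinH_mem D 𝒯)) (S.solH_mem D 𝒯') (S.dualLinH_mem D 𝒯')
    (𝒰 := 𝒯') (by simp)
  have h2 : D.combSq 𝒯' 𝒯' (D.solH κ 𝒯) (D.dualLinH κ K 𝒯)
      ≤ D.est κ K 𝒯 - (1 - qred ^ 2) * D.estOn κ K 𝒯 (𝒯 \ 𝒯') := by
    have h3 := hA.etaOn_refined_sq_le S hM h h' (S.solH_mem D 𝒯)
    have h4 := hA.zetaOn_refined_sq_le S hM h h' (D.solH κ 𝒯) (S.dualLinH_mem D 𝒯)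
    simp only [est, estOn, combSq]
    linarith
  have h5 := (abs_le.mp h1).2
  have h6 : ∀ x y : ℝ, x ≤ √(x ^ 2 + y ^ 2) ∧ y ≤ √(x ^ 2 + y ^ 2) := fun x y =>
    ⟨Real.le_sqrt_of_sq_le (le_add_of_nonneg_right (sq_nonneg _)),
      Real.le_sqrt_of_sq_le (le_add_of_nonneg_left (sq_nonneg _))⟩
  obtain ⟨h7, h8⟩ := h6 ‖D.solH κ 𝒯' - D.solH κ 𝒯‖ ‖D.dualLinH κ K 𝒯' - D.dualLinH κ K 𝒯‖
  have h9 : energyNorm κ (D.solH κ 𝒯' - D.solH κ 𝒯)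
      + energyNorm κ (D.dualLinH κ K 𝒯' - D.dualLinH κ K 𝒯)
      ≤ 2 * S.CE * √(D.distSq κ K 𝒯 𝒯') := by
    have hCE := S.CE_pos.le
    have h10 := (S.energy_le _).trans (mul_le_mul_of_nonneg_left h7 hCE)
    have h11 := (S.energy_le _).trans (mul_le_mul_of_nonneg_left h8 hCE)
    rw [distSq]
    linarith
  have h12 := mul_le_mul_of_nonneg_left h9 (add_nonneg hs hl)
  have h13 := Real.sqrt_le_sqrt h2
  simp only [est, estOn] at *
  linarith

end Axioms

end Data

/-! ### Properties of the combined estimator -/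

/-- Reliability of the combined estimator. -/
theorem Setting.exists_reliability (S : Setting κ K) (hr : 0 < Crel) : ∃ C : ℝ, 0 < C ∧
    ∀ (D : Data Ω) (Cstab Clip qred Cdrel : ℝ), D.Axioms κ K Cstab Clip qred Crel Cdrel →
      ∀ 𝒯, D.IsMesh 𝒯 → D.errSq κ K 𝒯 ≤ C * D.est κ K 𝒯 := by
  have hα := S.α_pos
  have hG := S.MG_pos
  have hCE := S.CE_pos
  refine ⟨(S.CE * Crel) ^ 2 * (1 + (S.MG / S.α + 1) ^ 2), by positivity,
    fun D Cstab Clip qred Cdrel hA 𝒯 h => ?_⟩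
  set e := √(D.est κ K 𝒯) with he
  have he2 : e ^ 2 = D.est κ K 𝒯 := Real.sq_sqrt (Data.est_nonneg _)
  have h1 : ‖D.sol κ - D.solH κ 𝒯‖ ≤ S.CE * Crel * e := by
    refine (S.le_energy _).trans ?_
    rw [mul_assoc]
    exact mul_le_mul_of_nonneg_left ((hA.reliability_eta 𝒯 h).trans
      (mul_le_mul_of_nonneg_left (Data.etaOn_le_sqrt_est 𝒯) hr.le)) hCE.le
  have h2 : ‖dualSol κ K (D.solH κ 𝒯) - D.dualLinH κ K 𝒯‖ ≤ S.CE * Crel * e := by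
    refine (S.le_energy _).trans ?_
    rw [mul_assoc]
    exact mul_le_mul_of_nonneg_left ((hA.reliability_zeta 𝒯 h _).trans
      (mul_le_mul_of_nonneg_left (Data.zetaOn_le_sqrt_est 𝒯) hr.le)) hCE.le
  -- The reliability axiom compares dual solutions with the same linearization point; the exact dual
  -- solution at `u_H` is therefore inserted.
  have h3 : ‖dualSol κ K (D.sol κ) - D.dualLinH κ K 𝒯‖
      ≤ (S.MG / S.α + 1) * (S.CE * Crel * e) := by
    refine (norm_sub_le_norm_sub_add_norm_sub _ (dualSol κ K (D.solH κ 𝒯)) _).trans ?_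
    have h4 := (S.norm_dualSol_sub_le (D.sol κ) (D.solH κ 𝒯)).trans
      (mul_le_mul_of_nonneg_left h1 (by positivity))
    linarith
  have h4 := pow_le_pow_left₀ (norm_nonneg _) h1 2
  have h5 := pow_le_pow_left₀ (norm_nonneg _) h3 2
  rw [Data.errSq, ← he2]
  refine (add_le_add h4 h5).trans (le_of_eq ?_)
  ring

/-- Quasi-monotonicity of the combined estimator. -/
theorem Setting.exists_quasi_monotone (S : Setting κ K) (hs : 0 < Cstab) (hl : 0 ≤ Clip)
    (hq : qred < 1) (hq0 : 0 < qred) (hr : 0 < Crel) : ∃ C : ℝ, 0 < C ∧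
    ∀ (D : Data Ω) (Cdrel Cmesh : ℝ), D.Axioms κ K Cstab Clip qred Crel Cdrel →
      D.MeshAssumptions Cmesh → ∀ 𝒯 𝒯', D.IsMesh 𝒯 → D.Refinement 𝒯 𝒯' →
        √(D.est κ K 𝒯') ≤ C * √(D.est κ K 𝒯) := by
  obtain ⟨C₁, hC₁, h₁⟩ := S.exists_reliability hr
  obtain ⟨C₂, hC₂, h₂⟩ := S.exists_distSq_le
  have hCE := S.CE_pos
  refine ⟨1 + 2 * (Cstab + Clip) * S.CE * √(C₂ * C₁), by positivity,
    fun D Cdrel Cmesh hA hM 𝒯 𝒯' h h' => ?_⟩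
  have h3 := hA.sqrt_est_refined_le S hs.le hl hM h h'
  -- Céa-type stability and reliability are used instead of discrete reliability, which keeps the
  -- constant independent of `Cdrel`, as part (i) demands.
  have h4 : D.distSq κ K 𝒯 𝒯' ≤ C₂ * C₁ * D.est κ K 𝒯 := by
    refine (h₂ D 𝒯 𝒯' (hM.space_mono h h')).trans ?_
    rw [mul_assoc]
    exact mul_le_mul_of_nonneg_left (h₁ D _ _ _ _ hA 𝒯 h) hC₂.le
  have h5 := Real.sqrt_le_sqrt h4
  rw [Real.sqrt_mul (by positivity)] at h5
  have h6 : D.est κ K 𝒯 - (1 - qred ^ 2) * D.estOn κ K 𝒯 (𝒯 \ 𝒯') ≤ D.est κ K 𝒯 := by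
    have : 0 ≤ (1 - qred ^ 2) * D.estOn κ K 𝒯 (𝒯 \ 𝒯') :=
      mul_nonneg (by nlinarith) (Data.combSq_nonneg _ _ _ _)
    linarith
  have h7 := Real.sqrt_le_sqrt h6
  have h8 : 0 ≤ 2 * (Cstab + Clip) * S.CE := by positivity
  have h9 := mul_le_mul_of_nonneg_left h5 h8
  linarith

/-- Linear convergence of the combined estimator. -/
theorem Setting.exists_linear_convergence (S : Setting κ K) (hθ : 0 < θ) (hθ1 : θ ≤ 1)
    (hs : 0 < Cstab) (hl : 0 ≤ Clip) (hq0 : 0 < qred) (hq : qred < 1) (hr : 0 < Crel) :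
    ∃ Clin qlin : ℝ, 0 < Clin ∧ 0 < qlin ∧ qlin < 1 ∧
      ∀ (D : Data Ω) (Cmesh Cdrel Cmark : ℝ), D.MeshAssumptions Cmesh →
        D.Axioms κ K Cstab Clip qred Crel Cdrel → ∀ 𝒯 ℳ, D.IsRun κ K θ Cmark 𝒯 ℳ →
          ∀ ℓ n : ℕ, ℓ ≤ n → D.est κ K (𝒯 n) ≤ Clin * qlin ^ (n - ℓ) * D.est κ K (𝒯 ℓ) := by
  obtain ⟨C₁, hC₁, h₁⟩ := S.exists_reliability hr
  obtain ⟨Cm, hCm, hmono⟩ := S.exists_quasi_monotone hs hl hq hq0 hr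
  obtain ⟨Co, c, hCo, hc0, hc1, horth⟩ := S.exists_quasi_orthogonality
  have hq2 : 0 < 1 - qred ^ 2 := by nlinarith
  have hq3 : 0 ≤ 1 - (1 - qred ^ 2) * θ := by nlinarith [sq_nonneg qred]
  -- The contraction factor of the estimator reduction: Dörfler marking puts at least the share `θ`
  -- of the squared estimator on refined elements.
  have hq4 : √(1 - (1 - qred ^ 2) * θ) < 1 := by
    rw [Real.sqrt_lt' one_pos]
    nlinarith
  obtain ⟨C, ρ, hC, hρ0, hρ1, hlin⟩ := GOAFEM.exists_linear_convergence
    (Cr := 2 * (Cstab + Clip) * S.CE) (Real.sqrt_nonneg _) hq4 (mul_nonneg hCo hC₁.le) hc0 hc1 hCm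
  refine ⟨C, ρ, hC, hρ0, hρ1, fun D Cmesh Cdrel Cmark hM hA 𝒯 ℳ hrun ℓ n hn => ?_⟩
  have key := hlin (fun k => √(D.est κ K (𝒯 k))) (fun k => √(D.distSq κ K (𝒯 k) (𝒯 (k + 1))))
    (fun k => Real.sqrt_nonneg _) ?_ ?_ ?_ ℓ n hn
  · rwa [Real.sq_sqrt (Data.est_nonneg _), Real.sq_sqrt (Data.est_nonneg _)] at key
  · intro k
    refine (hA.sqrt_est_refined_le S hs.le hl hM (hrun.isMesh k)
      (hrun.refinement (Nat.le_succ k))).trans ?_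
    refine add_le_add_left ?_ _
    rw [← Real.sqrt_mul hq3]
    refine Real.sqrt_le_sqrt ?_
    have h2 : ℳ k ⊆ 𝒯 k \ 𝒯 (k + 1) := by
      rw [hrun.step k]
      exact hM.marked _ (hrun.isMesh k) _ (hrun.subset k)
    have h3 : θ * D.est κ K (𝒯 k) ≤ D.estOn κ K (𝒯 k) (𝒯 k \ 𝒯 (k + 1)) :=
      (hrun.doerfler k).trans (Data.combSq_mono h2 _ _ _)
    have h4 := mul_le_mul_of_nonneg_left h3 hq2.le
    linarith
  · exact fun ℓ n h => hmono D _ _ hA hM _ _ (hrun.isMesh ℓ) (hrun.refinement h)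
  · intro ℓ m
    have h2 : ∀ k, √(D.distSq κ K (𝒯 k) (𝒯 (k + 1))) ^ 2 = D.distSq κ K (𝒯 k) (𝒯 (k + 1)) :=
      fun k => Real.sq_sqrt (add_nonneg (sq_nonneg _) (sq_nonneg _))
    simp only [h2]
    rw [Real.sq_sqrt (Data.est_nonneg _)]
    refine (horth D 𝒯 (fun i j hij => hM.space_mono (hrun.isMesh i) (hrun.refinement hij))
      ℓ m).trans ?_
    have h3 := mul_le_mul_of_nonneg_left (h₁ D _ _ _ _ hA _ (hrun.isMesh ℓ))
      (mul_nonneg hCo (pow_nonneg (by linarith : 0 ≤ 1 + c) m))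
    linarith

/-- Stability and discrete reliability of the combined estimator. -/
theorem Setting.exists_combinedAxioms (S : Setting κ K) (hs : 0 < Cstab) (hl : 0 ≤ Clip)
    (hdr : 0 < Cdrel) : ∃ Cs Cd : ℝ, 0 < Cs ∧ 0 < Cd ∧ ∀ D : Data Ω,
      D.Axioms κ K Cstab Clip qred Crel Cdrel → D.CombinedAxioms κ K Cs Cd := by
  have hα := S.α_pos
  have hG := S.MG_pos
  have hCE := S.CE_pos
  refine ⟨Cstab + Clip, Cdrel + S.CE * (S.MG / S.α * (S.CE * Cdrel) + S.CE * Cdrel),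
    by positivity, by positivity, fun D hA => ⟨?_, ?_⟩⟩
  · intro 𝒯 𝒯' h h' vh hvh wh hwh vH hvH wH hwH 𝒰 hU
    exact hA.abs_sqrt_combSq_sub_le S hl h h' hvH hwH hvh hwh hU
  · intro 𝒯 𝒯' h h'
    set r := √(D.estOn κ K 𝒯 (𝒯 \ 𝒯'))
    have h1 : D.etaOn 𝒯 (𝒯 \ 𝒯') (D.solH κ 𝒯) ≤ r :=
      Real.le_sqrt_of_sq_le (le_add_of_nonneg_right (sq_nonneg _))
    have h2 : D.zetaOn 𝒯 (D.solH κ 𝒯) (𝒯 \ 𝒯') (D.dualH κ K 𝒯 (D.solH κ 𝒯)) ≤ r :=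
      Real.le_sqrt_of_sq_le (le_add_of_nonneg_left (sq_nonneg _))
    have h3 := (hA.discrete_reliability_eta 𝒯 𝒯' h h').trans
      (mul_le_mul_of_nonneg_left h1 hdr.le)
    have h4 := (hA.discrete_reliability_zeta 𝒯 𝒯' h h' (D.solH κ 𝒯)).trans
      (mul_le_mul_of_nonneg_left h2 hdr.le)
    have h5 := (S.le_energy _).trans (mul_le_mul_of_nonneg_left h3 hCE.le)
    have h6 := (S.le_energy _).trans (mul_le_mul_of_nonneg_left h4 hCE.le)
    have h7 := (S.norm_dualH_sub_le D 𝒯' (D.solH κ 𝒯') (D.solH κ 𝒯)).trans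
      (mul_le_mul_of_nonneg_left h5 (by positivity))
    -- On the fine mesh the linearization point is first moved from `u_h` to `u_H`; then discrete
    -- reliability with fixed linearization point applies.
    have h8 := (norm_sub_le_norm_sub_add_norm_sub (D.dualLinH κ K 𝒯')
      (D.dualH κ K 𝒯' (D.solH κ 𝒯)) (D.dualLinH κ K 𝒯)).trans (add_le_add h7 h6)
    have h9 := (S.energy_le _).trans (mul_le_mul_of_nonneg_left h8 hCE.le)
    refine (add_le_add h3 h9).trans (le_of_eq ?_)
    ring

/-- The estimator on a common refinement is controlled by the primal estimator on one mesh and the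
dual estimator, with exact linearization, on another one. -/
theorem Setting.exists_comparison (S : Setting κ K) (hs : 0 < Cstab) (hl : 0 ≤ Clip)
    (hq : qred < 1) (hq0 : 0 < qred) (hr : 0 < Crel) (hdr : 0 < Cdrel) : ∃ C : ℝ, 0 < C ∧
    ∀ (D : Data Ω) (Cmesh : ℝ), D.Axioms κ K Cstab Clip qred Crel Cdrel →
      D.MeshAssumptions Cmesh → ∀ 𝒯₁ 𝒯₂ 𝒯, D.IsMesh 𝒯₁ → D.IsMesh 𝒯₂ → D.Refinement 𝒯₁ 𝒯 →
        D.Refinement 𝒯₂ 𝒯 → √(D.est κ K 𝒯) ≤ C * (D.etaOn 𝒯₁ 𝒯₁ (D.solH κ 𝒯₁)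
          + D.zetaOn 𝒯₂ (D.sol κ) 𝒯₂ (D.dualH κ K 𝒯₂ (D.sol κ))) := by
  have hα := S.α_pos
  have hG := S.MG_pos
  have hCE := S.CE_pos
  have hq2 : 0 < 1 - qred ^ 2 := by nlinarith
  -- `P` is the quasi-monotonicity constant of each individual estimator, and `Q` the price of
  -- replacing the linearization point `u` by `u_H`.
  set P := 1 + Cstab * Cdrel with hP
  set Q := (Cstab * (S.CE * (S.MG / S.α)) + Clip * S.CE) * (S.CE * Crel) with hQ
  have hP0 : 0 < P := by positivity
  have hQ0 : 0 ≤ Q := by positivity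
  refine ⟨P * (1 + Q), by positivity, fun D Cmesh hA hM 𝒯₁ 𝒯₂ 𝒯 h₁ h₂ h₁' h₂' => ?_⟩
  have hT := h₁.refinement h₁'
  set η₁ := D.etaOn 𝒯₁ 𝒯₁ (D.solH κ 𝒯₁) with hη₁
  set ζ₂ := D.zetaOn 𝒯₂ (D.sol κ) 𝒯₂ (D.dualH κ K 𝒯₂ (D.sol κ)) with hζ₂
  have hη0 : 0 ≤ η₁ := Data.etaOn_nonneg _ _ _
  have hζ0 : 0 ≤ ζ₂ := Data.zetaOn_nonneg _ _ _ _
  have eta_le : D.etaOn 𝒯 𝒯 (D.solH κ 𝒯) ≤ P * η₁ := by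
    have a1 := (abs_le.mp (hA.abs_etaOn_sub_le S hT (Data.Refinement.refl 𝒯)
      (hM.space_mono h₁ h₁' (S.solH_mem D 𝒯₁)) (S.solH_mem D 𝒯) (𝒰 := 𝒯) (by simp))).2
    have a2 := hA.etaOn_refined_sq_le S hM h₁ h₁' (S.solH_mem D 𝒯₁)
    have a3 : D.etaOn 𝒯 𝒯 (D.solH κ 𝒯₁) ≤ η₁ := by
      refine abs_le_of_sq_le_sq' ?_ hη0 |>.2
      have := mul_nonneg hq2.le (sq_nonneg (D.etaOn 𝒯₁ (𝒯₁ \ 𝒯) (D.solH κ 𝒯₁)))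
      linarith
    have a4 : D.etaOn 𝒯₁ (𝒯₁ \ 𝒯) (D.solH κ 𝒯₁) ≤ η₁ :=
      Real.sqrt_le_sqrt (Finset.sum_le_sum_of_subset_of_nonneg Finset.sdiff_subset
        fun _ _ _ => sq_nonneg _)
    have a5 := mul_le_mul_of_nonneg_left ((hA.discrete_reliability_eta 𝒯₁ 𝒯 h₁ h₁').trans
      (mul_le_mul_of_nonneg_left a4 hdr.le)) hs.le
    rw [hP]
    linarith
  have zeta_le : D.zetaOn 𝒯 (D.sol κ) 𝒯 (D.dualH κ K 𝒯 (D.sol κ)) ≤ P * ζ₂ := by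
    have a1 := (abs_le.mp (hA.abs_zetaOn_sub_le hT (Data.Refinement.refl 𝒯)
      (hM.space_mono h₂ h₂' (S.dualH_mem D 𝒯₂ (D.sol κ))) (S.dualH_mem D 𝒯 (D.sol κ))
      (D.sol κ) (D.sol κ) (𝒰 := 𝒯) (by simp))).2
    rw [sub_self (D.sol κ), S.energyNorm_zero, mul_zero, add_zero] at a1
    have a2 := hA.zetaOn_refined_sq_le S hM h₂ h₂' (D.sol κ) (S.dualH_mem D 𝒯₂ (D.sol κ))
    have a3 : D.zetaOn 𝒯 (D.sol κ) 𝒯 (D.dualH κ K 𝒯₂ (D.sol κ)) ≤ ζ₂ := by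
      refine abs_le_of_sq_le_sq' ?_ hζ0 |>.2
      have := mul_nonneg hq2.le
        (sq_nonneg (D.zetaOn 𝒯₂ (D.sol κ) (𝒯₂ \ 𝒯) (D.dualH κ K 𝒯₂ (D.sol κ))))
      linarith
    have a4 : D.zetaOn 𝒯₂ (D.sol κ) (𝒯₂ \ 𝒯) (D.dualH κ K 𝒯₂ (D.sol κ)) ≤ ζ₂ :=
      Real.sqrt_le_sqrt (Finset.sum_le_sum_of_subset_of_nonneg Finset.sdiff_subset
        fun _ _ _ => sq_nonneg _)
    have a5 := mul_le_mul_of_nonneg_left ((hA.discrete_reliability_zeta 𝒯₂ 𝒯 h₂ h₂'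
      (D.sol κ)).trans (mul_le_mul_of_nonneg_left a4 hdr.le)) hs.le
    rw [hP]
    linarith
  set w := ‖D.solH κ 𝒯 - D.sol κ‖ with hw
  have w_le : w ≤ S.CE * Crel * (P * η₁) := by
    rw [hw, norm_sub_rev, mul_assoc]
    exact (S.le_energy _).trans (mul_le_mul_of_nonneg_left ((hA.reliability_eta 𝒯 hT).trans
      (mul_le_mul_of_nonneg_left eta_le hr.le)) hCE.le)
  -- Changing the linearization point costs a multiple of `‖u_H - u‖`, hence of the primal
  -- estimator. This is how the approximation class of the exact `z[u]` controls the computable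
  -- estimator.
  have lin_le : D.zetaOn 𝒯 (D.solH κ 𝒯) 𝒯 (D.dualLinH κ K 𝒯) ≤ P * ζ₂ + Q * (P * η₁) := by
    have a1 := (abs_le.mp (hA.abs_zetaOn_sub_le hT (Data.Refinement.refl 𝒯)
      (S.dualH_mem D 𝒯 (D.sol κ)) (S.dualLinH_mem D 𝒯) (D.sol κ) (D.solH κ 𝒯)
      (𝒰 := 𝒯) (by simp))).2
    have a2 : energyNorm κ (D.dualLinH κ K 𝒯 - D.dualH κ K 𝒯 (D.sol κ))
        ≤ S.CE * (S.MG / S.α * w) :=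
      (S.energy_le _).trans (mul_le_mul_of_nonneg_left (S.norm_dualH_sub_le D 𝒯 _ _) hCE.le)
    have a3 : energyNorm κ (D.solH κ 𝒯 - D.sol κ) ≤ S.CE * w := S.energy_le _
    have a4 := mul_le_mul_of_nonneg_left a2 hs.le
    have a5 := mul_le_mul_of_nonneg_left a3 hl
    have a6 := mul_le_mul_of_nonneg_left w_le
      (by positivity : 0 ≤ Cstab * (S.CE * (S.MG / S.α)) + Clip * S.CE)
    rw [hQ]
    linarith
  have hsum : √(D.est κ K 𝒯) ≤ D.etaOn 𝒯 𝒯 (D.solH κ 𝒯)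
      + D.zetaOn 𝒯 (D.solH κ 𝒯) 𝒯 (D.dualLinH κ K 𝒯) := by
    have b1 := Data.etaOn_nonneg (D := D) 𝒯 𝒯 (D.solH κ 𝒯)
    have b2 := Data.zetaOn_nonneg (D := D) 𝒯 (D.solH κ 𝒯) 𝒯 (D.dualLinH κ K 𝒯)
    refine Real.sqrt_le_iff.mpr ⟨by positivity, ?_⟩
    simp only [Data.est, Data.estOn, Data.combSq]
    nlinarith
  have : 0 ≤ Q * (P * ζ₂) := by positivity
  linarith

end GOAFEM

namespace GOAFEM

/-! ### Compactness -/

section Compactness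

open Filter Topology

variable {H : Type*} [NormedAddCommGroup H] [InnerProductSpace ℝ H]

/-- Elements of the limit space that are Galerkin orthogonal to the `ℓ`-th space tend weakly
to zero. -/
theorem tendsto_of_galerkin_orthogonal [CompleteSpace H] (a : H →L[ℝ] H →L[ℝ] ℝ) {α : ℝ}
    (hα : 0 < α) (hco : ∀ v, α * ‖v‖ ^ 2 ≤ a v v) {X : ℕ → Submodule ℝ H} (hX : Monotone X)
    {w : ℕ → H} (hw1 : ∀ ℓ, ‖w ℓ‖ ≤ 1) (hw : ∀ ℓ, w ℓ ∈ (⨆ k, X k).topologicalClosure)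
    (horth : ∀ ℓ, ∀ x ∈ X ℓ, a (w ℓ) x = 0) (φ : StrongDual ℝ H) :
    Tendsto (fun ℓ => φ (w ℓ)) atTop (𝓝 0) := by
  obtain ⟨M, hM, hB⟩ := exists_bound_bilinear a
  -- On the limit space `φ` is represented by some `y` through `a`. An approximation `x` of `y` from
  -- `X k` is annihilated by `w ℓ` for all `ℓ ≥ k`.
  obtain ⟨y, hy, hy'⟩ := exists_galerkin a.flip hα hco
    (Submodule.isClosed_topologicalClosure (⨆ k, X k)) φ
  rw [Metric.tendsto_atTop]
  intro ε hε
  obtain ⟨x, hx, hxy⟩ := Metric.mem_closure_iff.mp hy (ε / M) (by positivity)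
  obtain ⟨k, hk⟩ := (Submodule.mem_iSup_of_directed X hX.directed_le).mp hx
  refine ⟨k, fun ℓ hℓ => ?_⟩
  have h1 : φ (w ℓ) = a (w ℓ) (y - x) := by
    rw [map_sub, horth ℓ x (hX hℓ hk), sub_zero, ← hy' _ (hw ℓ)]
    rfl
  rw [dist_zero_right, h1, Real.norm_eq_abs]
  calc |a (w ℓ) (y - x)| ≤ M * ‖w ℓ‖ * ‖y - x‖ := hB _ _
    _ ≤ M * 1 * ‖y - x‖ := by gcongr; exact hw1 ℓ
    _ < ε := by
      rw [dist_eq_norm, lt_div_iff₀ hM] at hxy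
      linarith

/-- A compact operator maps weakly null sequences to null sequences. -/
theorem tendsto_compact_of_weakly_null {K : H →L[ℝ] StrongDual ℝ H} (hK : IsCompactOperator K)
    {w : ℕ → H} (hw1 : ∀ ℓ, ‖w ℓ‖ ≤ 1)
    (hw : ∀ φ : StrongDual ℝ H, Tendsto (fun ℓ => φ (w ℓ)) atTop (𝓝 0)) :
    Tendsto (fun ℓ => K (w ℓ)) atTop (𝓝 0) := by
  have hc := hK.isCompact_closure_image_closedBall (1 : ℝ)
  -- The sequence stays in a compact set, and any cluster point vanishes when tested with `v`,
  -- because `K (w ℓ) v` is the functional `K.flip v` at `w ℓ`.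
  refine hc.tendsto_nhds_of_unique_mapClusterPt (Eventually.of_forall fun ℓ =>
    subset_closure ⟨w ℓ, by simpa using hw1 ℓ, rfl⟩) fun ψ _ hψ => ?_
  ext v
  have h1 : MapClusterPt (ψ v) atTop (fun ℓ => K (w ℓ) v) :=
    hψ.continuousAt_comp (f := fun ψ : StrongDual ℝ H => ψ v)
      (ContinuousLinearMap.apply ℝ ℝ v).continuous.continuousAt
  have h2 : Tendsto (fun ℓ => K (w ℓ) v) atTop (𝓝 0) := hw (K.flip v)
  have h3 : (𝓝 (ψ v) ⊓ 𝓝 0).NeBot := NeBot.mono h1 (inf_le_inf_left _ h2)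
  exact eq_of_nhds_neBot h3

/-- The transpose of a compact operator maps weakly null sequences to null sequences. -/
theorem eventually_flip_le_of_weakly_null {K : H →L[ℝ] StrongDual ℝ H} (hK : IsCompactOperator K)
    {w : ℕ → H} (hw1 : ∀ ℓ, ‖w ℓ‖ ≤ 1)
    (hw : ∀ φ : StrongDual ℝ H, Tendsto (fun ℓ => φ (w ℓ)) atTop (𝓝 0)) {ε : ℝ} (hε : 0 < ε) :
    ∀ᶠ ℓ in atTop, ∀ v, |K v (w ℓ)| ≤ ε * ‖v‖ := by
  have hc := (hK.isCompact_closure_image_closedBall (1 : ℝ)).totallyBounded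
  -- A finite net of the image of the unit ball turns pointwise smallness on `w ℓ` into smallness
  -- uniform in `v`.
  obtain ⟨t, ht, hcov⟩ := Metric.totallyBounded_iff.mp hc (ε / 2) (half_pos hε)
  have hev : ∀ᶠ ℓ in atTop, ∀ φ ∈ t, |φ (w ℓ)| < ε / 2 := by
    rw [eventually_all_finite ht]
    intro φ _
    have := (hw φ).eventually (Metric.ball_mem_nhds 0 (half_pos hε))
    simpa using this
  filter_upwards [hev] with ℓ hℓ
  have hball : ∀ v : H, ‖v‖ ≤ 1 → |K v (w ℓ)| ≤ ε := by
    intro v hv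
    have h1 : K v ∈ closure (K '' Metric.closedBall 0 1) :=
      subset_closure ⟨v, by simpa using hv, rfl⟩
    obtain ⟨φ, hφ, hφ'⟩ := Set.mem_iUnion₂.mp (hcov h1)
    rw [Metric.mem_ball, dist_eq_norm] at hφ'
    have h2 : |(K v - φ) (w ℓ)| ≤ ε / 2 := by
      refine ((K v - φ).le_opNorm (w ℓ)).trans ?_
      have := mul_le_mul hφ'.le (hw1 ℓ) (norm_nonneg _) (half_pos hε).le
      linarith
    have h3 := hℓ φ hφ
    have h4 : K v (w ℓ) = (K v - φ) (w ℓ) + φ (w ℓ) := by simp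
    rw [h4]
    exact (abs_add_le _ _).trans (by linarith)
  intro v
  rcases eq_or_ne v 0 with rfl | hv
  · simp
  have hv' : 0 < ‖v‖ := norm_pos_iff.mpr hv
  have h1 := hball (‖v‖⁻¹ • v) (by rw [norm_smul, norm_inv, norm_norm, inv_mul_cancel₀ hv'.ne'])
  rw [map_smul, smul_apply, smul_eq_mul, abs_mul, abs_inv, abs_norm,
    inv_mul_le_iff₀ hv'] at h1
  linarith

/-- For a convergent sequence of Galerkin approximations, the symmetrized compact operator is small
on the errors. -/
theorem exists_compact_error_le [CompleteSpace H] (a : H →L[ℝ] H →L[ℝ] ℝ) {α : ℝ}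
    (hα : 0 < α) (hco : ∀ v, α * ‖v‖ ^ 2 ≤ a v v) {K : H →L[ℝ] StrongDual ℝ H}
    (hK : IsCompactOperator K) {X : ℕ → Submodule ℝ H} (hX : Monotone X) {u : H} {us : ℕ → H}
    (hus : ∀ ℓ, us ℓ ∈ X ℓ) (horth : ∀ ℓ, ∀ x ∈ X ℓ, a (u - us ℓ) x = 0)
    (hlim : Tendsto us atTop (𝓝 u)) {ε : ℝ} (hε : 0 < ε) :
    ∃ ℓ₀, ∀ ℓ, ℓ₀ ≤ ℓ → ∀ v,
      |K v (u - us ℓ) + K (u - us ℓ) v| ≤ ε * ‖u - us ℓ‖ * ‖v‖ := by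
  -- Normalized errors, equal to `0` where the error vanishes. They lie in the limit space because
  -- `u` is the limit of `us`.
  set w : ℕ → H := fun ℓ => ‖u - us ℓ‖⁻¹ • (u - us ℓ) with hw
  have hmem : ∀ ℓ, us ℓ ∈ (⨆ k, X k).topologicalClosure := fun ℓ =>
    Submodule.le_topologicalClosure _ (le_iSup X ℓ (hus ℓ))
  have hu : u ∈ (⨆ k, X k).topologicalClosure :=
    (Submodule.isClosed_topologicalClosure _).mem_of_tendsto hlim (Eventually.of_forall hmem)
  have hw1 : ∀ ℓ, ‖w ℓ‖ ≤ 1 := fun ℓ => by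
    rw [hw, norm_smul, norm_inv, norm_norm]
    exact inv_mul_le_one
  have hws : ∀ ℓ, u - us ℓ = ‖u - us ℓ‖ • w ℓ := fun ℓ => by
    rcases eq_or_ne (u - us ℓ) 0 with h | h
    · simp [h]
    · rw [hw, smul_smul, mul_inv_cancel₀ (norm_ne_zero_iff.mpr h), one_smul]
  have hweak := tendsto_of_galerkin_orthogonal a hα hco hX hw1
    (fun ℓ => Submodule.smul_mem _ _ (Submodule.sub_mem _ hu (hmem ℓ)))
    (fun ℓ x hx => by rw [hw, map_smul, smul_apply, horth ℓ x hx, smul_zero])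
  have h1 := eventually_flip_le_of_weakly_null hK hw1 hweak (half_pos hε)
  have h2 := (tendsto_compact_of_weakly_null hK hw1 hweak).eventually
    (Metric.ball_mem_nhds 0 (half_pos hε))
  obtain ⟨ℓ₀, hℓ₀⟩ := eventually_atTop.mp (h1.and h2)
  refine ⟨ℓ₀, fun ℓ hℓ v => ?_⟩
  obtain ⟨h3, h4⟩ := hℓ₀ ℓ hℓ
  rw [dist_zero_right] at h4
  have h5 : |K (w ℓ) v| ≤ ε / 2 * ‖v‖ :=
    ((K (w ℓ)).le_opNorm v).trans (mul_le_mul_of_nonneg_right h4.le (norm_nonneg v))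
  have h6 : K v (u - us ℓ) + K (u - us ℓ) v = ‖u - us ℓ‖ * (K v (w ℓ) + K (w ℓ) v) := by
    conv_lhs => rw [hws ℓ]
    simp only [map_smul, smul_apply, smul_eq_mul]
    ring
  rw [h6, abs_mul, abs_norm]
  have h7 := (abs_add_le (K v (w ℓ)) (K (w ℓ) v)).trans (add_le_add (h3 v) h5)
  have h8 := mul_le_mul_of_nonneg_left h7 (norm_nonneg (u - us ℓ))
  linarith

end Compactness

end GOAFEM

namespace GOAFEM

/-! ### Optimality of the marking criterion -/

/-- The threshold for `θ` is exactly where this difference changes sign; the positive gap serves as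
the admissible reduction factor. -/
theorem lambda_mul_sqrt_lt {θ Λ : ℝ} (hθ : 0 < θ) (hΛ : 0 ≤ Λ) (h : θ < (1 + Λ ^ 2)⁻¹) :
    0 < √(1 - θ) - Λ * √θ := by
  have h1 : θ * (1 + Λ ^ 2) < 1 := by rwa [lt_inv_comm₀ hθ (by positivity), inv_eq_one_div,
    lt_div_iff₀ hθ, mul_comm] at h
  rw [sub_pos, Real.lt_sqrt (by positivity), mul_pow, Real.sq_sqrt hθ.le]
  linarith

/-- Here `e` stands for the whole estimator and `r` for its refined part. If `r² < θ e²`, the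
right-hand side of `h` is at most `(1 - θ) e²` while the left-hand side exceeds it. -/
theorem doerfler_of_le {θ Λ σ e r : ℝ} (hθ : 0 < θ) (hθ1 : θ ≤ 1) (hΛ : 0 ≤ Λ) (he : 0 ≤ e)
    (hr : 0 ≤ r) (hσ0 : 0 ≤ σ) (hσ : σ ≤ √(1 - θ) - Λ * √θ)
    (h : e ^ 2 - r ^ 2 ≤ (σ * e + Λ * r) ^ 2) : θ * e ^ 2 ≤ r ^ 2 := by
  by_contra! hlt
  have he0 : 0 < e := by
    rcases he.eq_or_lt with h0 | h0
    · rw [← h0] at hlt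
      nlinarith [sq_nonneg r]
    · exact h0
  have h1 : r ≤ √θ * e := by
    refine abs_le_of_sq_le_sq' ?_ (by positivity) |>.2
    rw [mul_pow, Real.sq_sqrt hθ.le]
    exact hlt.le
  have h2 : σ * e + Λ * r ≤ √(1 - θ) * e := by
    have := mul_le_mul_of_nonneg_left h1 hΛ
    have := mul_le_mul_of_nonneg_right hσ he
    linarith
  have h3 := pow_le_pow_left₀ (by positivity) h2 2
  rw [mul_pow, Real.sq_sqrt (by linarith)] at h3
  linarith

theorem sqrt_add_sq_le (p q x y : ℝ) :
    √((p + x) ^ 2 + (q + y) ^ 2) ≤ √(p ^ 2 + q ^ 2) + √(x ^ 2 + y ^ 2) := by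
  refine Real.sqrt_le_iff.mpr ⟨by positivity, ?_⟩
  have h1 := Real.sq_sqrt (by positivity : 0 ≤ p ^ 2 + q ^ 2)
  have h2 := Real.sq_sqrt (by positivity : 0 ≤ x ^ 2 + y ^ 2)
  have h3 : p * x + q * y ≤ √(p ^ 2 + q ^ 2) * √(x ^ 2 + y ^ 2) := by
    rw [← Real.sqrt_mul (by positivity)]
    refine Real.le_sqrt_of_sq_le ?_
    nlinarith [sq_nonneg (p * y - q * x)]
  nlinarith

theorem sum_pow_sub_le {ρ : ℝ} (h0 : 0 ≤ ρ) (h1 : ρ < 1) (ℓ : ℕ) :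
    ∑ j ∈ Finset.range ℓ, ρ ^ (ℓ - j) ≤ (1 - ρ)⁻¹ := by
  have h : ∑ j ∈ Finset.range ℓ, ρ ^ (ℓ - j) ≤ ∑ j ∈ Finset.range (ℓ + 1), ρ ^ j := by
    rw [Finset.sum_range_succ', ← Finset.sum_range_reflect]
    refine le_add_of_le_of_nonneg (Finset.sum_le_sum fun j hj => ?_) (by positivity)
    have := Finset.mem_range.mp hj
    rw [show ℓ - (ℓ - 1 - j) = j + 1 by omega]
  refine h.trans ?_
  rw [← tsum_geometric_of_lt_one h0 h1]
  exact (summable_geometric_of_lt_one h0 h1).sum_le_tsum _ fun _ _ => by positivity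

/-! ### Approximation classes -/

/-- The slack `ε` avoids having to show that the infimum is attained; it is absorbed where meshes
are selected. -/
theorem exists_near_best {M : Type*} (F : ℕ → Set M) (f : M → ℝ) {s : ℝ}
    (hA : (⨆ N : ℕ, ((N : ℝ≥0∞) + 1) ^ s * ⨅ 𝒯 ∈ F N, ENNReal.ofReal (f 𝒯)) ≠ ⊤) (N : ℕ) {ε : ℝ}
    (hε : 0 < ε) : ∃ 𝒯 ∈ F N, f 𝒯 ≤ ((N : ℝ) + 1) ^ (-s) *
      (⨆ N : ℕ, ((N : ℝ≥0∞) + 1) ^ s * ⨅ 𝒯 ∈ F N, ENNReal.ofReal (f 𝒯)).toReal + ε := by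
  set A := ⨆ N : ℕ, ((N : ℝ≥0∞) + 1) ^ s * ⨅ 𝒯 ∈ F N, ENNReal.ofReal (f 𝒯) with hAdef
  have h1 : ((N : ℝ≥0∞) + 1) ^ s * ⨅ 𝒯 ∈ F N, ENNReal.ofReal (f 𝒯) ≤ A :=
    le_iSup (fun N : ℕ => ((N : ℝ≥0∞) + 1) ^ s * ⨅ 𝒯 ∈ F N, ENNReal.ofReal (f 𝒯)) N
  have hN : (0 : ℝ) < (N : ℝ) + 1 := by positivity
  have hcast : ((N : ℝ≥0∞) + 1) = ENNReal.ofReal ((N : ℝ) + 1) := by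
    rw [ENNReal.ofReal_add (by positivity) zero_le_one]
    simp
  rw [hcast, ENNReal.ofReal_rpow_of_pos hN, ← ENNReal.ofReal_toReal hA] at h1
  have hpos : 0 < ((N : ℝ) + 1) ^ s := Real.rpow_pos_of_pos hN s
  have h2 : (⨅ 𝒯 ∈ F N, ENNReal.ofReal (f 𝒯)) ≤
      ENNReal.ofReal (((N : ℝ) + 1) ^ (-s) * A.toReal) := by
    rw [Real.rpow_neg hN.le, ENNReal.ofReal_mul (by positivity),
      ENNReal.ofReal_inv_of_pos hpos, mul_comm, ← div_eq_mul_inv]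
    rw [ENNReal.le_div_iff_mul_le (Or.inl (by simpa using hpos)) (Or.inl ENNReal.ofReal_ne_top),
      mul_comm]
    exact h1
  have h3 : 0 ≤ ((N : ℝ) + 1) ^ (-s) * A.toReal := by positivity
  have h4 := h2.trans_lt ((ENNReal.ofReal_lt_ofReal_iff (by linarith)).mpr
    (lt_add_of_pos_right _ hε))
  obtain ⟨𝒯, h5⟩ := iInf_lt_iff.mp h4
  obtain ⟨h6, h7⟩ := iInf_lt_iff.mp h5
  exact ⟨𝒯, h6, (ENNReal.ofReal_lt_ofReal_iff (by linarith)).mp h7 |>.le⟩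

variable {d : ℕ} {Ω : Set (Pt d)} {κ : Coeff d} {K : GoalOp Ω}
variable {Cmesh Cstab Clip qred Crel Cdrel θ Cmark : ℝ}

namespace Data

variable {D : Data Ω}

theorem MeshAssumptions.eq_mesh₀ (hM : D.MeshAssumptions Cmesh) {𝒯 : Mesh d}
    (h : 𝒯 ∈ D.meshesUpTo 0) : 𝒯 = D.mesh₀ := by
  have h1 := hM.sons _ _ isMesh_mesh₀ h.1
  have h2 := h.2
  have h3 : (D.mesh₀ \ 𝒯).card = 0 := by omega
  rw [Finset.card_eq_zero, Finset.sdiff_eq_empty_iff_subset] at h3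
  exact (Finset.eq_of_subset_of_card_le h3 (by omega)).symm

/-- Only the initial mesh competes for `N = 0`, where the weight is 1. This bounds the initial
estimator in `Setting.exists_rate`. -/
theorem MeshAssumptions.le_toReal_of_mesh₀ (hM : D.MeshAssumptions Cmesh) (f : Mesh d → ℝ) {s : ℝ}
    (hA : (⨆ N : ℕ, ((N : ℝ≥0∞) + 1) ^ s *
      ⨅ 𝒯 ∈ D.meshesUpTo N, ENNReal.ofReal (f 𝒯)) ≠ ⊤) :
    f D.mesh₀ ≤ (⨆ N : ℕ, ((N : ℝ≥0∞) + 1) ^ s *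
      ⨅ 𝒯 ∈ D.meshesUpTo N, ENNReal.ofReal (f 𝒯)).toReal := by
  refine le_of_forall_pos_le_add fun ε hε => ?_
  obtain ⟨𝒯, h1, h2⟩ := exists_near_best _ f hA 0 hε
  rw [hM.eq_mesh₀ h1] at h2
  simpa using h2

/-- Every marked element is refined and so adds at least one element. This counts the elements
marked before `ℓ₀`, about which the optimality of marking says nothing. -/
theorem IsRun.sum_marked_le {𝒯 : ℕ → Mesh d} {ℳ : ℕ → Finset (Element d)}
    (h : D.IsRun κ K θ Cmark 𝒯 ℳ) (hM : D.MeshAssumptions Cmesh) (ℓ : ℕ) :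
    ∑ j ∈ Finset.range ℓ, (ℳ j).card ≤ (𝒯 ℓ).card - D.mesh₀.card := by
  suffices ∑ j ∈ Finset.range ℓ, (ℳ j).card + D.mesh₀.card ≤ (𝒯 ℓ).card by omega
  induction ℓ with
  | zero => simp [IsRun.init h]
  | succ ℓ ih =>
    rw [Finset.sum_range_succ]
    have h1 := hM.sons (𝒯 ℓ) (𝒯 (ℓ + 1)) (h.isMesh ℓ) (h.refinement (Nat.le_succ ℓ))
    have h2 : ℳ ℓ ⊆ 𝒯 ℓ \ 𝒯 (ℓ + 1) := by
      rw [h.step ℓ]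
      exact hM.marked _ (h.isMesh ℓ) _ (h.subset ℓ)
    have h3 := Finset.card_le_card h2
    omega

theorem rateBound_of_real {s t C : ℝ} (hC : 0 < C) {𝒯 : Mesh d}
    (hu : D.approxPrimal κ s ≠ ⊤) (hz : D.approxDual κ K t ≠ ⊤)
    (hpos : 0 < (D.approxPrimal κ s).toReal + (D.approxDual κ K t).toReal)
    (hs : 0 < s) (ht : 0 < t)
    (h : 0 < 𝒯.card - D.mesh₀.card → D.est κ K 𝒯 ≤
      C * ((D.approxPrimal κ s).toReal ^ 2 + (D.approxDual κ K t).toReal ^ 2) *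
        ((𝒯.card - D.mesh₀.card : ℕ) : ℝ) ^ (-min (2 * s) (2 * t))) :
    D.RateBound κ K s t C 𝒯 := by
  have hβ : 0 < min (2 * s) (2 * t) := lt_min (by positivity) (by positivity)
  set Su := (D.approxPrimal κ s).toReal
  set Sz := (D.approxDual κ K t).toReal
  have hSu : 0 ≤ Su := ENNReal.toReal_nonneg
  have hSz : 0 ≤ Sz := ENNReal.toReal_nonneg
  have hsum : 0 < Su ^ 2 + Sz ^ 2 := by
    rcases hSu.eq_or_lt with h0 | h0
    · have : 0 < Sz := by linarith
      positivity
    · positivity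
  have e : ENNReal.ofReal C * (D.approxPrimal κ s ^ 2 + D.approxDual κ K t ^ 2)
      = ENNReal.ofReal (C * (Su ^ 2 + Sz ^ 2)) := by
    rw [ENNReal.ofReal_mul hC.le, ENNReal.ofReal_add (by positivity) (by positivity),
      ENNReal.ofReal_pow hSu, ENNReal.ofReal_pow hSz, ENNReal.ofReal_toReal hu,
      ENNReal.ofReal_toReal hz]
  rw [RateBound, e]
  rcases Nat.eq_zero_or_pos (𝒯.card - D.mesh₀.card) with h0 | h0
  -- The right-hand side is `⊤` because its prefactor is positive; this is where `hpos` prevents the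
  -- product `0 * ⊤ = 0`.
  · rw [h0, Nat.cast_zero, ENNReal.zero_rpow_of_neg (by linarith), ENNReal.mul_top]
    · exact le_top
    · simpa using mul_pos hC hsum
  · have hn : (0 : ℝ) < ((𝒯.card - D.mesh₀.card : ℕ) : ℝ) := Nat.cast_pos.mpr h0
    rw [← ENNReal.ofReal_natCast, ENNReal.ofReal_rpow_of_pos hn,
      ← ENNReal.ofReal_mul (by positivity)]
    exact ENNReal.ofReal_le_ofReal (h h0)

theorem rateBound_of_est_eq_zero {s t C : ℝ} {𝒯 : Mesh d} (h : D.est κ K 𝒯 = 0) :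
    D.RateBound κ K s t C 𝒯 := by
  rw [RateBound, h, ENNReal.ofReal_zero]
  exact zero_le

end Data

/-! ### Cardinality of the marked sets and convergence rates -/

/-- Two meshes that are quasi-optimal for the primal and dual problem yield a refinement of a given
mesh with few additional elements and a small estimator. -/
theorem exists_refinement_small {D : Data Ω} (hM : D.MeshAssumptions Cmesh) {Cc : ℝ} (hCc : 0 < Cc)
    (hcmp : ∀ 𝒯₁ 𝒯₂ 𝒯, D.IsMesh 𝒯₁ → D.IsMesh 𝒯₂ → D.Refinement 𝒯₁ 𝒯 →
        D.Refinement 𝒯₂ 𝒯 → √(D.est κ K 𝒯) ≤ Cc * (D.etaOn 𝒯₁ 𝒯₁ (D.solH κ 𝒯₁)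
          + D.zetaOn 𝒯₂ (D.sol κ) 𝒯₂ (D.dualH κ K 𝒯₂ (D.sol κ))))
    {s t : ℝ} (hs : 0 < s) (ht : 0 < t)
    (hu : D.approxPrimal κ s ≠ ⊤) (hz : D.approxDual κ K t ≠ ⊤) {𝒯 : Mesh d} (hT : D.IsMesh 𝒯)
    {δ : ℝ} (hδ : 0 < δ) :
    ∃ 𝒯', D.Refinement 𝒯 𝒯' ∧ √(D.est κ K 𝒯') ≤ δ ∧ ((𝒯 \ 𝒯').card : ℝ) ≤
      2 * (2 * Cc * ((D.approxPrimal κ s).toReal + (D.approxDual κ K t).toReal) / δ) ^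
        (2 / min (2 * s) (2 * t)) := by
  set β := min (2 * s) (2 * t) with hβ
  have hβ0 : 0 < β := lt_min (by positivity) (by positivity)
  set Su := (D.approxPrimal κ s).toReal with hSu'
  set Sz := (D.approxDual κ K t).toReal with hSz'
  have hSu : 0 ≤ Su := ENNReal.toReal_nonneg
  have hSz : 0 ≤ Sz := ENNReal.toReal_nonneg
  set Y := 2 * Cc * (Su + Sz) / δ with hY
  have hY0 : 0 ≤ Y := by positivity
  -- The budget for which `(N + 1) ^ (-(β / 2))` times the approximation norms drops to the order of
  -- `δ`. Half of `δ` is spent on this, the other half on the two slacks `δ / (4 * Cc)`.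
  set N := ⌊Y ^ (2 / β)⌋₊ with hN
  have hN1 : (N : ℝ) ≤ Y ^ (2 / β) := Nat.floor_le (by positivity)
  have hN2 : Y ^ (2 / β) ≤ (N : ℝ) + 1 := (Nat.lt_floor_add_one _).le
  have hNp : (1 : ℝ) ≤ (N : ℝ) + 1 := by
    have : (0 : ℝ) ≤ N := Nat.cast_nonneg N
    linarith
  have hε : 0 < δ / (4 * Cc) := by positivity
  obtain ⟨𝒯₁, h₁, h₁'⟩ := exists_near_best D.meshesUpTo
    (fun 𝒯 => D.etaOn 𝒯 𝒯 (D.solH κ 𝒯)) hu N hε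
  obtain ⟨𝒯₂, h₂, h₂'⟩ := exists_near_best D.meshesUpTo
    (fun 𝒯 => D.zetaOn 𝒯 (D.sol κ) 𝒯 (D.dualH κ K 𝒯 (D.sol κ))) hz N hε
  obtain ⟨𝒯₃, h₁₃, h₂₃, hc₃⟩ := hM.overlay 𝒯₁ 𝒯₂ h₁.1 h₂.1
  obtain ⟨𝒯', hT', h₃', hc'⟩ := hM.overlay 𝒯 𝒯₃ hT (h₁.1.refinement h₁₃)
  refine ⟨𝒯', hT', ?_, ?_⟩
  · refine (hcmp 𝒯₁ 𝒯₂ 𝒯' h₁.1 h₂.1 (h₁₃.trans h₃') (h₂₃.trans h₃')).trans ?_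
    have hrs : ((N : ℝ) + 1) ^ (-s) ≤ ((N : ℝ) + 1) ^ (-(β / 2)) :=
      Real.rpow_le_rpow_of_exponent_le hNp (by linarith [min_le_left (2 * s) (2 * t)])
    have hrt : ((N : ℝ) + 1) ^ (-t) ≤ ((N : ℝ) + 1) ^ (-(β / 2)) :=
      Real.rpow_le_rpow_of_exponent_le hNp (by linarith [min_le_right (2 * s) (2 * t)])
    have h5 := h₁'.trans (add_le_add_left (mul_le_mul_of_nonneg_right hrs hSu) _)
    have h6 := h₂'.trans (add_le_add_left (mul_le_mul_of_nonneg_right hrt hSz) _)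
    have h7 : Y ≤ ((N : ℝ) + 1) ^ (β / 2) := by
      have := Real.rpow_le_rpow (by positivity) hN2 (by positivity : 0 ≤ β / 2)
      rwa [← Real.rpow_mul hY0, show 2 / β * (β / 2) = 1 by field_simp, Real.rpow_one] at this
    have hp : 0 < ((N : ℝ) + 1) ^ (β / 2) := by positivity
    have h8 : ((N : ℝ) + 1) ^ (-(β / 2)) * (Su + Sz) * Cc ≤ δ / 2 := by
      rw [Real.rpow_neg (by linarith), mul_assoc, inv_mul_le_iff₀ hp]
      rw [hY, div_le_iff₀ hδ] at h7
      linarith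
    have h9 : Cc * (δ / (4 * Cc)) = δ / 4 := by field_simp
    have h10 := mul_le_mul_of_nonneg_left (add_le_add h5 h6) hCc.le
    linarith
  -- Each near-best mesh has at most `N` extra elements, so the two overlays add at most `2 * N`
  -- elements to `𝒯`; `sons` turns this into a count of refined elements.
  · have hsons := hM.sons 𝒯 𝒯' hT hT'
    have hc1 := h₁.2
    have hc2 := h₂.2
    have h5 : (𝒯 \ 𝒯').card ≤ 2 * N := by omega
    have h6 : ((𝒯 \ 𝒯').card : ℝ) ≤ 2 * N := by exact_mod_cast h5
    linarith

set_option maxHeartbeats 600000 in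
/-- Optimal rates, from the optimality of the marking criterion. -/
theorem Setting.exists_rate (S : Setting κ K) (hθ : 0 < θ) (hθ1 : θ ≤ 1) (hs : 0 < Cstab)
    (hl : 0 ≤ Clip) (hq0 : 0 < qred) (hq : qred < 1) (hr : 0 < Crel) (hdr : 0 < Cdrel)
    (hCmesh : 0 < Cmesh) (hCmark : 1 ≤ Cmark) {q s t : ℝ} (hq' : 0 < q) (hs' : 0 < s)
    (ht' : 0 < t) : ∃ Copt : ℝ, 0 < Copt ∧ ∀ D : Data Ω, D.MeshAssumptions Cmesh →
      D.Axioms κ K Cstab Clip qred Crel Cdrel → D.approxPrimal κ s + D.approxDual κ K t < ⊤ →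
      ∀ 𝒯 ℳ, D.IsRun κ K θ Cmark 𝒯 ℳ → ∀ ℓ₀ : ℕ,
        (∀ j, ℓ₀ ≤ j → ∀ 𝒯', D.Refinement (𝒯 j) 𝒯' →
          √(D.est κ K 𝒯') ≤ q * √(D.est κ K (𝒯 j)) →
            θ * D.est κ K (𝒯 j) ≤ D.estOn κ K (𝒯 j) (𝒯 j \ 𝒯')) →
        ∀ ℓ, ℓ₀ ≤ ℓ → D.RateBound κ K s t
          (Copt * (((𝒯 ℓ₀).card - D.mesh₀.card : ℕ) + 1 : ℝ) ^ min (2 * s) (2 * t)) (𝒯 ℓ) := by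
  obtain ⟨Clin, qlin, hClin, hql0, hql1, hlin⟩ :=
    S.exists_linear_convergence hθ hθ1 hs hl hq0 hq hr
  obtain ⟨Cm, hCm, hmono⟩ := S.exists_quasi_monotone hs hl hq hq0 hr
  obtain ⟨Cc, hCc, hcmp⟩ := S.exists_comparison hs hl hq hq0 hr hdr
  set β := min (2 * s) (2 * t) with hβ
  have hβ0 : 0 < β := lt_min (by positivity) (by positivity)
  set γ := 2 / β with hγ
  have hγ0 : 0 < γ := by positivity
  set ρ := qlin ^ (γ / 2) with hρ
  have hρ0 : 0 < ρ := by positivity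
  have hρ1 : ρ < 1 := Real.rpow_lt_one hql0.le hql1 (by positivity)
  have hρ2 : 0 < 1 - ρ := by linarith
  have hCmark0 : 0 < Cmark := by linarith
  set C₃ := 2 * Cmark * ((2 * Cc / q) ^ γ * Clin ^ (γ / 2)) * (1 - ρ)⁻¹ with hC₃
  set C₄ := (Cm * Cc) ^ γ with hC₄
  set C₅ := Cmesh * (C₃ + C₄) with hC₅
  have hC₃0 : 0 < C₃ := by positivity
  have hC₄0 : 0 < C₄ := by positivity
  have hC₅0 : 0 < C₅ := by positivity
  refine ⟨2 * C₅ ^ β, by positivity, fun D hM hA hfin 𝒯 ℳ hrun ℓ₀ hopt ℓ hℓ => ?_⟩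
  obtain ⟨hu, hz⟩ := ENNReal.add_ne_top.mp hfin.ne
  rcases (Data.est_nonneg (D := D) (κ := κ) (K := K) (𝒯 ℓ)).eq_or_lt with h0 | hE
  · exact Data.rateBound_of_est_eq_zero h0.symm
  set Su := (D.approxPrimal κ s).toReal with hSu'
  set Sz := (D.approxDual κ K t).toReal with hSz'
  have hSu : 0 ≤ Su := ENNReal.toReal_nonneg
  have hSz : 0 ≤ Sz := ENNReal.toReal_nonneg
  set e : ℕ → ℝ := fun j => √(D.est κ K (𝒯 j)) with he
  have hesq : ∀ j, e j ^ 2 = D.est κ K (𝒯 j) := fun j => Real.sq_sqrt (Data.est_nonneg _)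
  have heℓ : 0 < e ℓ := Real.sqrt_pos.mpr hE
  have hmon : ∀ j, j ≤ ℓ → e ℓ ≤ Cm * e j := fun j hj =>
    hmono D _ _ hA hM _ _ (hrun.isMesh j) (hrun.refinement hj)
  have hepos : ∀ j, j ≤ ℓ → 0 < e j := fun j hj =>
    pos_of_mul_pos_right (heℓ.trans_le (hmon j hj)) hCm.le
  have hinit : e 0 ≤ Cc * (Su + Sz) := by
    have h1 := hcmp D Cmesh hA hM D.mesh₀ D.mesh₀ D.mesh₀ Data.isMesh_mesh₀ Data.isMesh_mesh₀
      (Data.Refinement.refl _) (Data.Refinement.refl _)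
    have h2 := hM.le_toReal_of_mesh₀ (fun 𝒯 => D.etaOn 𝒯 𝒯 (D.solH κ 𝒯)) hu
    have h3 := hM.le_toReal_of_mesh₀
      (fun 𝒯 => D.zetaOn 𝒯 (D.sol κ) 𝒯 (D.dualH κ K 𝒯 (D.sol κ))) hz
    have h4 : e 0 = √(D.est κ K D.mesh₀) := congrArg (fun 𝒯 => √(D.est κ K 𝒯)) hrun.init
    rw [h4]
    exact h1.trans (mul_le_mul_of_nonneg_left (add_le_add h2 h3) hCc.le)
  have hSℓ : e ℓ ≤ Cm * Cc * (Su + Sz) := by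
    have := mul_le_mul_of_nonneg_left hinit hCm.le
    linarith [hmon 0 (Nat.zero_le ℓ)]
  have hSpos : 0 < Su + Sz := pos_of_mul_pos_right (heℓ.trans_le hSℓ) (by positivity)
  set Y := ((Su + Sz) / e ℓ) ^ γ with hY
  have hY0 : 0 < Y := by positivity
  -- The estimator at step `ℓ` is bounded by the approximation norms, so `Y` is bounded below and
  -- additive constants can be absorbed into it.
  have hY1 : 1 ≤ C₄ * Y := by
    rw [hC₄, hY, ← Real.mul_rpow (by positivity) (by positivity)]
    refine Real.one_le_rpow ?_ hγ0.le
    rw [← mul_div_assoc, one_le_div heℓ]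
    exact hSℓ
  -- The refined set of a mesh with estimator at most `q * e j` is a competitor in the minimality of
  -- `ℳ j`. Linear convergence then trades `e j ^ (-γ)` for `e ℓ ^ (-γ) * ρ ^ (ℓ - j)` up to a
  -- constant.
  have hmark : ∀ j, ℓ₀ ≤ j → j < ℓ → ((ℳ j).card : ℝ) ≤
      2 * Cmark * ((2 * Cc / q) ^ γ * Clin ^ (γ / 2)) * Y * ρ ^ (ℓ - j) := by
    intro j hj hjℓ
    have hej := hepos j hjℓ.le
    obtain ⟨𝒯', hT', hest, hcard⟩ := exists_refinement_small hM hCc (hcmp D Cmesh hA hM) hs' ht'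
      hu hz (hrun.isMesh j) (mul_pos hq' hej)
    have h1 := hrun.minimal j _ Finset.sdiff_subset (hopt j hj 𝒯' hT' hest)
    have h2 : e ℓ ≤ √(Clin * qlin ^ (ℓ - j)) * e j := by
      refine abs_le_of_sq_le_sq' ?_ (by positivity) |>.2
      rw [mul_pow, hesq, hesq, Real.sq_sqrt (by positivity)]
      exact hlin D _ _ _ hM hA 𝒯 ℳ hrun j ℓ hjℓ.le
    have h3 : 2 * Cc * (Su + Sz) / (q * e j) ≤
        2 * Cc / q * √(Clin * qlin ^ (ℓ - j)) * ((Su + Sz) / e ℓ) := by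
      have : (Su + Sz) / e j ≤ √(Clin * qlin ^ (ℓ - j)) * ((Su + Sz) / e ℓ) := by
        rw [← mul_div_assoc, div_le_div_iff₀ hej heℓ]
        have := mul_le_mul_of_nonneg_left h2 hSpos.le
        linarith
      have h4 := mul_le_mul_of_nonneg_left this (by positivity : 0 ≤ 2 * Cc / q)
      refine le_trans (le_of_eq ?_) (h4.trans (le_of_eq ?_))
      · field_simp
      · ring
    have h4 := Real.rpow_le_rpow (by positivity) h3 hγ0.le
    rw [Real.mul_rpow (by positivity) (by positivity),
      Real.mul_rpow (by positivity) (by positivity), Real.sqrt_eq_rpow,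
      ← Real.rpow_mul (by positivity), Real.mul_rpow (by positivity) (by positivity),
      ← Real.rpow_natCast_mul hql0.le, mul_comm ((ℓ - j : ℕ) : ℝ), Real.rpow_mul_natCast hql0.le,
      show 1 / 2 * γ = γ / 2 by ring] at h4
    have h5 := mul_le_mul_of_nonneg_left (hcard.trans (mul_le_mul_of_nonneg_left h4 two_pos.le))
      hCmark0.le
    refine h1.trans (h5.trans (le_of_eq ?_))
    rw [hY, hρ]
    ring
  set m := (𝒯 ℓ₀).card - D.mesh₀.card with hm
  have hsum : ∑ j ∈ Finset.range ℓ, ((ℳ j).card : ℝ) ≤ m + C₃ * Y := by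
    rw [← Finset.sum_range_add_sum_Ico _ hℓ]
    refine add_le_add ?_ ?_
    · exact_mod_cast hrun.sum_marked_le hM ℓ₀
    · have h1 : ∑ j ∈ Finset.Ico ℓ₀ ℓ, ((ℳ j).card : ℝ) ≤ ∑ j ∈ Finset.Ico ℓ₀ ℓ,
          2 * Cmark * ((2 * Cc / q) ^ γ * Clin ^ (γ / 2)) * Y * ρ ^ (ℓ - j) :=
        Finset.sum_le_sum fun j hj =>
          hmark j (Finset.mem_Ico.mp hj).1 (Finset.mem_Ico.mp hj).2
      rw [← Finset.mul_sum] at h1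
      have h2 : ∑ j ∈ Finset.Ico ℓ₀ ℓ, ρ ^ (ℓ - j) ≤ (1 - ρ)⁻¹ := by
        refine le_trans (Finset.sum_le_sum_of_subset_of_nonneg ?_ fun _ _ _ => by positivity)
          (sum_pow_sub_le hρ0.le hρ1 ℓ)
        intro j hj
        exact Finset.mem_range.mpr (Finset.mem_Ico.mp hj).2
      refine h1.trans ((mul_le_mul_of_nonneg_left h2 (by positivity)).trans (le_of_eq ?_))
      rw [hC₃]
      ring
  have hcl := hM.closure 𝒯 ℳ hrun.init (fun j => ⟨hrun.subset j, hrun.step j⟩) ℓ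
  set n := (𝒯 ℓ).card - D.mesh₀.card with hn
  have hcard : D.mesh₀.card ≤ (𝒯 ℓ).card := hM.card_le Data.isMesh_mesh₀ (hrun.isMesh ℓ)
  rw [← Nat.cast_sub hcard, ← hn] at hcl
  have hn5 : (n : ℝ) ≤ C₅ * ((m : ℝ) + 1) * Y := by
    refine hcl.trans ((mul_le_mul_of_nonneg_left hsum hCmesh.le).trans ?_)
    have hm0 : (0 : ℝ) ≤ m := Nat.cast_nonneg m
    have h1 := mul_le_mul_of_nonneg_left hY1 hm0
    have h2 : 0 ≤ C₃ * Y * m + C₄ * Y := by positivity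
    have h3 : (m : ℝ) + C₃ * Y ≤ (C₃ + C₄) * ((m : ℝ) + 1) * Y := by linarith
    have h4 := mul_le_mul_of_nonneg_left h3 hCmesh.le
    rw [hC₅]
    linarith
  refine Data.rateBound_of_real (by positivity) hu hz hSpos hs' ht' fun hnpos => ?_
  have hnp : (0 : ℝ) < n := Nat.cast_pos.mpr hnpos
  -- Since `γ * β = 2`, the `β`-th power turns `Y` into the squared ratio of `Su + Sz` and the
  -- estimator.
  have h1 := Real.rpow_le_rpow hnp.le hn5 hβ0.le
  rw [Real.mul_rpow (by positivity) hY0.le, Real.mul_rpow (by positivity) (by positivity), hY,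
    ← Real.rpow_mul (by positivity), show γ * β = 2 by rw [hγ]; field_simp, Real.rpow_two,
    div_pow, hesq] at h1
  rw [Real.rpow_neg hnp.le]
  have hnβ : 0 < (n : ℝ) ^ β := by positivity
  rw [← div_eq_mul_inv, le_div_iff₀ hnβ]
  have h2 := mul_le_mul_of_nonneg_right h1 hE.le
  have h3 : C₅ ^ β * ((m : ℝ) + 1) ^ β * ((Su + Sz) ^ 2 / D.est κ K (𝒯 ℓ)) * D.est κ K (𝒯 ℓ)
      = C₅ ^ β * ((m : ℝ) + 1) ^ β * (Su + Sz) ^ 2 := by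
    field_simp
  rw [h3] at h2
  have h4 : (Su + Sz) ^ 2 ≤ 2 * (Su ^ 2 + Sz ^ 2) := add_sq_le
  have h5 := mul_le_mul_of_nonneg_left h4 (by positivity : 0 ≤ C₅ ^ β * ((m : ℝ) + 1) ^ β)
  linarith

end GOAFEM

namespace GOAFEM

variable {d : ℕ} {Ω : Set (Pt d)} {κ : Coeff d} {K : GoalOp Ω}
variable {Cmesh Cstab Clip qred Crel Cdrel θ Cmark : ℝ}

/-- Minkowski's inequality keeps one factor `c` for both components; only the Lipschitz term adds
`l`. This produces the constant `(Cstab + Clip) * Cdrel` of (ii′) without a loss from summing the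
components. -/
theorem sqrt_sq_add_sq_le_of_le {p p' r r' x₁ x₂ c l τ : ℝ} (hp : 0 ≤ p) (hr : 0 ≤ r)
    (hx₁ : 0 ≤ x₁) (hc : 0 ≤ c) (hl : 0 ≤ l) (hτ : 0 ≤ τ) (e1 : p ≤ p' + c * x₁)
    (e2 : r ≤ r' + c * x₂ + (l * x₁ + τ)) :
    √(p ^ 2 + r ^ 2) ≤ √(p' ^ 2 + r' ^ 2) + (c + l) * √(x₁ ^ 2 + x₂ ^ 2) + τ := by
  have hτ' : 0 ≤ l * x₁ + τ := by positivity
  have m1 : √(p ^ 2 + r ^ 2) ≤ √((p' + c * x₁) ^ 2 + (r' + c * x₂ + (l * x₁ + τ)) ^ 2) :=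
    Real.sqrt_le_sqrt (add_le_add (pow_le_pow_left₀ hp e1 2) (pow_le_pow_left₀ hr e2 2))
  have m2 := (abs_le.mp (abs_sqrt_sub_sqrt_le (p' + c * x₁) (r' + c * x₂ + (l * x₁ + τ))
    (p' + c * x₁) (r' + c * x₂))).2
  rw [sub_self, abs_zero, zero_add, add_sub_cancel_left, abs_of_nonneg hτ'] at m2
  have m3 := sqrt_add_sq_le p' r' (c * x₁) (c * x₂)
  have m4 : √((c * x₁) ^ 2 + (c * x₂) ^ 2) = c * √(x₁ ^ 2 + x₂ ^ 2) := by
    rw [mul_pow, mul_pow c x₂, ← mul_add, Real.sqrt_mul (sq_nonneg _), Real.sqrt_sq hc]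
  have m6 : x₁ ≤ √(x₁ ^ 2 + x₂ ^ 2) :=
    Real.le_sqrt_of_sq_le (le_add_of_nonneg_right (sq_nonneg _))
  have m7 := mul_le_mul_of_nonneg_left m6 hl
  linarith

/-! ### Marking for the combined estimator -/

namespace Data

variable {D : Data Ω}

theorem est_sub_estOn_sdiff (𝒯 𝒯' : Mesh d) :
    D.est κ K 𝒯 - D.estOn κ K 𝒯 (𝒯 \ 𝒯') = D.estOn κ K 𝒯 (𝒯' ∩ 𝒯) := by
  rw [Finset.inter_comm]
  simp only [est, estOn]
  rw [combSq_split 𝒯 𝒯']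
  ring

/-- A bound for the estimator on the common elements of two meshes implies the marking criterion
for the refined elements. -/
theorem doerfler_of_sqrt_estOn_le {Λ σ : ℝ} (hθ : 0 < θ) (hθ1 : θ ≤ 1) (hΛ : 0 ≤ Λ) (hσ0 : 0 ≤ σ)
    (hσ : σ ≤ √(1 - θ) - Λ * √θ) {𝒯 𝒯' : Mesh d}
    (h : √(D.estOn κ K 𝒯 (𝒯' ∩ 𝒯))
      ≤ σ * √(D.est κ K 𝒯) + Λ * √(D.estOn κ K 𝒯 (𝒯 \ 𝒯'))) :
    θ * D.est κ K 𝒯 ≤ D.estOn κ K 𝒯 (𝒯 \ 𝒯') := by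
  have h1 : ∀ 𝒰, 0 ≤ D.estOn κ K 𝒯 𝒰 := fun 𝒰 => combSq_nonneg _ _ _ _
  have h2 := doerfler_of_le hθ hθ1 hΛ (Real.sqrt_nonneg (D.est κ K 𝒯))
    (Real.sqrt_nonneg (D.estOn κ K 𝒯 (𝒯 \ 𝒯'))) hσ0 hσ ?_
  · rwa [Real.sq_sqrt (est_nonneg _), Real.sq_sqrt (h1 _)] at h2
  · rw [Real.sq_sqrt (est_nonneg _), Real.sq_sqrt (h1 _), est_sub_estOn_sdiff,
      ← Real.sq_sqrt (h1 (𝒯' ∩ 𝒯))]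
    exact pow_le_pow_left₀ (Real.sqrt_nonneg _) h 2

/-- Stability moves the contribution of the common elements to the fine mesh, where it is below `q`
times the old estimator; by discrete reliability the defect is at most `Cs * Cd` times the refined
contribution. -/
theorem CombinedAxioms.doerfler {Cs Cd q : ℝ} (hC : D.CombinedAxioms κ K Cs Cd) (S : Setting κ K)
    (hs : 0 < Cs) (hd : 0 < Cd) (hθ : 0 < θ) (hθ1 : θ ≤ 1) (hq0 : 0 ≤ q)
    (hq : q ≤ √(1 - θ) - Cs * Cd * √θ) {𝒯 𝒯' : Mesh d} (h : D.IsMesh 𝒯)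
    (h' : D.Refinement 𝒯 𝒯') (hest : √(D.est κ K 𝒯') ≤ q * √(D.est κ K 𝒯)) :
    θ * D.est κ K 𝒯 ≤ D.estOn κ K 𝒯 (𝒯 \ 𝒯') := by
  refine doerfler_of_sqrt_estOn_le hθ hθ1 (by positivity) hq0 hq ?_
  have h1 := (abs_le.mp (hC.stability 𝒯 𝒯' h h' _ (S.solH_mem D 𝒯') _ (S.dualLinH_mem D 𝒯') _
    (S.solH_mem D 𝒯) _ (S.dualLinH_mem D 𝒯) _ (Finset.Subset.refl (𝒯' ∩ 𝒯)))).1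
  have h2 := mul_le_mul_of_nonneg_left (hC.discrete_reliability 𝒯 𝒯' h h') hs.le
  have h3 : √(D.combSq 𝒯' (𝒯' ∩ 𝒯) (D.solH κ 𝒯') (D.dualLinH κ K 𝒯')) ≤ √(D.est κ K 𝒯') :=
    Real.sqrt_le_sqrt (combSq_mono Finset.inter_subset_left _ _ _)
  have h4 : √(D.estOn κ K 𝒯 (𝒯' ∩ 𝒯)) =
    √(D.combSq 𝒯 (𝒯' ∩ 𝒯) (D.solH κ 𝒯) (D.dualLinH κ K 𝒯)) := rfl
  rw [h4]
  linarith

set_option maxHeartbeats 1000000 in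
/-- The estimator on the common elements, if the derivative of the goal functional is small on the
difference of the discrete primal solutions. -/
theorem Axioms.sqrt_estOn_inter_le (hA : D.Axioms κ K Cstab Clip qred Crel Cdrel) (S : Setting κ K)
    (hs : 0 < Cstab) (hl : 0 ≤ Clip) (hdr : 0 < Cdrel) {𝒯 𝒯' : Mesh d} (h : D.IsMesh 𝒯)
    (h' : D.Refinement 𝒯 𝒯') {C : ℝ} (hC0 : 0 ≤ C)
    (hC : ∀ v, |S.G (D.solH κ 𝒯' - D.solH κ 𝒯) v| ≤ C * ‖v‖) :
    √(D.estOn κ K 𝒯 (𝒯' ∩ 𝒯)) ≤ √(D.est κ K 𝒯')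
      + (Cstab + Clip) * Cdrel * √(D.estOn κ K 𝒯 (𝒯 \ 𝒯')) + Cstab * (S.CE * (C / S.α)) := by
  have hT' := h.refinement h'
  set 𝒰 := 𝒯' ∩ 𝒯 with hU
  set u := D.solH κ 𝒯
  set u' := D.solH κ 𝒯'
  set z := D.dualLinH κ K 𝒯
  set z' := D.dualLinH κ K 𝒯'
  -- The fine dual solution with coarse linearization point separates two effects: from `z` to `y`
  -- discrete reliability applies, and from `y` to `z'` only the functional `G (u' - u)` enters.
  set y := D.dualH κ K 𝒯' u with hy
  set x₁ := D.etaOn 𝒯 (𝒯 \ 𝒯') u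
  set x₂ := D.zetaOn 𝒯 u (𝒯 \ 𝒯') z
  have hx₁ : 0 ≤ x₁ := etaOn_nonneg _ _ _
  have hx₂ : 0 ≤ x₂ := zetaOn_nonneg _ _ _ _
  have d1 : energyNorm κ (u' - u) ≤ Cdrel * x₁ := hA.discrete_reliability_eta 𝒯 𝒯' h h'
  have d2 : energyNorm κ (y - z) ≤ Cdrel * x₂ := hA.discrete_reliability_zeta 𝒯 𝒯' h h' u
  have d3 : energyNorm κ (z' - y) ≤ S.CE * (C / S.α) :=
    (S.energy_le _).trans (mul_le_mul_of_nonneg_left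
      (S.norm_dualIn_sub_le (S.closed D.p 𝒯') hC0 hC) S.CE_pos.le)
  have e1 : D.etaOn 𝒯 𝒰 u ≤ D.etaOn 𝒯' 𝒰 u' + Cstab * Cdrel * x₁ := by
    have a1 := (abs_le.mp (hA.abs_etaOn_sub_le S h h' (S.solH_mem D 𝒯) (S.solH_mem D 𝒯')
      (Finset.Subset.refl 𝒰))).1
    have a2 := mul_le_mul_of_nonneg_left d1 hs.le
    linarith
  have e2 : D.zetaOn 𝒯 u 𝒰 z ≤ D.zetaOn 𝒯' u' 𝒰 z' + Cstab * Cdrel * x₂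
      + (Clip * Cdrel * x₁ + Cstab * (S.CE * (C / S.α))) := by
    have a1 := (abs_le.mp (hA.abs_zetaOn_sub_le h h' (S.dualLinH_mem D 𝒯) (S.dualH_mem D 𝒯' u)
      u u (Finset.Subset.refl 𝒰))).1
    have a2 := (abs_le.mp (hA.abs_zetaOn_sub_le hT' (Refinement.refl 𝒯') (S.dualH_mem D 𝒯' u)
      (S.dualLinH_mem D 𝒯') u u' (𝒰 := 𝒰) (by simp [hU]))).1
    rw [sub_self u, S.energyNorm_zero, mul_zero, add_zero] at a1
    have a3 := mul_le_mul_of_nonneg_left d2 hs.le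
    have a4 := mul_le_mul_of_nonneg_left d3 hs.le
    have a5 := mul_le_mul_of_nonneg_left d1 hl
    linarith
  have hCE := S.CE_pos
  have hα := S.α_pos
  have m := sqrt_sq_add_sq_le_of_le (etaOn_nonneg 𝒯 𝒰 u) (zetaOn_nonneg 𝒯 u 𝒰 z)
    hx₁ (by positivity) (by positivity) (by positivity) e1 e2
  rw [← add_mul] at m
  refine m.trans (add_le_add_left (add_le_add_left ?_ _) _)
  exact Real.sqrt_le_sqrt (combSq_mono Finset.inter_subset_left 𝒯' u' z')

end Data

/-- Along a run, the derivative of the goal functional is eventually small on the errors of the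
primal solution. -/
theorem Setting.exists_goal_error_le (S : Setting κ K) (hK : IsCompactOperator K) {D : Data Ω}
    (hM : D.MeshAssumptions Cmesh) {𝒯 : ℕ → Mesh d} {ℳ : ℕ → Finset (Element d)}
    (hrun : D.IsRun κ K θ Cmark 𝒯 ℳ) (C : ℝ)
    (hrel : ∀ ℓ, ‖D.sol κ - D.solH κ (𝒯 ℓ)‖ ≤ C * √(D.est κ K (𝒯 ℓ)))
    (hlim : Filter.Tendsto (fun ℓ => √(D.est κ K (𝒯 ℓ))) Filter.atTop (nhds 0)) {ε : ℝ}
    (hε : 0 < ε) : ∃ ℓ₀, ∀ ℓ, ℓ₀ ≤ ℓ → ∀ v,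
      |S.G (D.sol κ - D.solH κ (𝒯 ℓ)) v| ≤ ε * ‖D.sol κ - D.solH κ (𝒯 ℓ)‖ * ‖v‖ := by
  have htend : Filter.Tendsto (fun ℓ => D.solH κ (𝒯 ℓ)) Filter.atTop (nhds (D.sol κ)) := by
    rw [tendsto_iff_norm_sub_tendsto_zero]
    refine squeeze_zero (fun _ => norm_nonneg _) (fun ℓ => ?_) (g := fun ℓ =>
      C * √(D.est κ K (𝒯 ℓ))) (by simpa using hlim.const_mul C)
    rw [norm_sub_rev]
    exact hrel ℓ
  obtain ⟨ℓ₀, h⟩ := exists_compact_error_le S.a S.α_pos S.coercive hK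
    (X := fun ℓ => D.space (𝒯 ℓ))
    (fun i j hij => hM.space_mono (hrun.isMesh i) (hrun.refinement hij))
    (fun ℓ => S.solH_mem D (𝒯 ℓ)) (fun ℓ x hx => by
      rw [map_sub, sub_apply, (S.solvesOn_sol D).primal x trivial,
        (S.solvesOn_solH D (𝒯 ℓ)).primal x hx, sub_self]) htend hε
  refine ⟨ℓ₀, fun ℓ hℓ v => ?_⟩
  rw [S.G_apply]
  exact h ℓ hℓ v

set_option maxHeartbeats 1000000 in
/-- Eventual optimality of the marking criterion, with the constants of the two individual
estimators. -/
theorem Setting.exists_doerfler_eventually (S : Setting κ K) (hK : IsCompactOperator K)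
    (hθ : 0 < θ) (hθ' : θ < thetaOpt (Cstab + Clip) Cdrel) (hs : 0 < Cstab)
    (hl : 0 ≤ Clip) (hq0 : 0 < qred) (hq : qred < 1) (hr : 0 < Crel) (hdr : 0 < Cdrel) :
    ∃ q : ℝ, 0 < q ∧ ∀ D : Data Ω, D.MeshAssumptions Cmesh →
      D.Axioms κ K Cstab Clip qred Crel Cdrel → ∀ 𝒯 ℳ, D.IsRun κ K θ Cmark 𝒯 ℳ → ∃ ℓ₀ : ℕ,
        ∀ j, ℓ₀ ≤ j → ∀ 𝒯', D.Refinement (𝒯 j) 𝒯' →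
          √(D.est κ K 𝒯') ≤ q * √(D.est κ K (𝒯 j)) →
            θ * D.est κ K (𝒯 j) ≤ D.estOn κ K (𝒯 j) (𝒯 j \ 𝒯') := by
  have hα := S.α_pos
  have hG := S.MG_pos
  have hCE := S.CE_pos
  set Λ := (Cstab + Clip) * Cdrel with hΛ
  have hΛ0 : 0 < Λ := by positivity
  have hθ2 : θ < (1 + Λ ^ 2)⁻¹ := by rwa [hΛ, mul_pow]
  have hθ1 : θ ≤ 1 := hθ2.le.trans (inv_le_one_of_one_le₀ (by nlinarith))
  set σ := √(1 - θ) - Λ * √θ with hσ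
  have hσ0 : 0 < σ := lambda_mul_sqrt_lt hθ hΛ0.le hθ2
  set R := S.CE * Crel with hR
  set Θ := Cstab * (S.CE * (R / S.α)) with hΘ
  have hR0 : 0 < R := by positivity
  have hΘ0 : 0 < Θ := by positivity
  refine ⟨σ / 2 / (1 + Θ * S.MG), by positivity, fun D hM hA 𝒯 ℳ hrun => ?_⟩
  set q := σ / 2 / (1 + Θ * S.MG) with hqdef
  have hq'0 : 0 < q := by positivity
  -- The gap `σ` is split: one half pays for the reduced estimator and the error on the fine mesh,
  -- the other for the error on the mesh of the run, made small by compactness.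
  have hqσ : q + Θ * (S.MG * q) = σ / 2 := by
    rw [hqdef]; field_simp
  obtain ⟨Clin, qlin, hClin, hql0, hql1, hlin⟩ :=
    S.exists_linear_convergence hθ hθ1 hs hl hq0 hq hr
  have hrel : ∀ 𝒯, D.IsMesh 𝒯 → ‖D.sol κ - D.solH κ 𝒯‖ ≤ R * √(D.est κ K 𝒯) := by
    intro 𝒯 h
    refine (S.le_energy _).trans ?_
    rw [hR, mul_assoc]
    exact mul_le_mul_of_nonneg_left ((hA.reliability_eta 𝒯 h).trans
      (mul_le_mul_of_nonneg_left (Data.etaOn_le_sqrt_est 𝒯) hr.le)) hCE.le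
  have hlim : Filter.Tendsto (fun ℓ => √(D.est κ K (𝒯 ℓ))) Filter.atTop (nhds 0) := by
    rw [← Real.sqrt_zero]
    refine (Real.continuous_sqrt.tendsto 0).comp (squeeze_zero (fun ℓ => Data.est_nonneg _)
      (fun ℓ => hlin D _ _ _ hM hA 𝒯 ℳ hrun 0 ℓ (Nat.zero_le ℓ)) ?_)
    have := ((tendsto_pow_atTop_nhds_zero_of_lt_one hql0.le hql1).const_mul Clin).mul_const
      (D.est κ K (𝒯 0))
    simpa using this
  obtain ⟨ℓ₀, hℓ₀⟩ := S.exists_goal_error_le hK hM hrun R (fun ℓ => hrel _ (hrun.isMesh ℓ)) hlim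
    (ε := σ / 2 / Θ) (by positivity)
  refine ⟨ℓ₀, fun j hj 𝒯' hT' hest => ?_⟩
  set e := √(D.est κ K (𝒯 j)) with he
  have he0 : 0 ≤ e := Real.sqrt_nonneg _
  have hTj := hrun.isMesh j
  refine Data.doerfler_of_sqrt_estOn_le hθ hθ1 hΛ0.le hσ0.le le_rfl ?_
  have h1 := hA.sqrt_estOn_inter_le S hs hl hdr hTj hT'
    (C := (σ / 2 / Θ + S.MG * q) * (R * e)) (by positivity) ?_
  · have h2 : Cstab * (S.CE * ((σ / 2 / Θ + S.MG * q) * (R * e) / S.α))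
        = (σ / 2 + Θ * (S.MG * q)) * e := by
      have : Cstab * (S.CE * ((σ / 2 / Θ + S.MG * q) * (R * e) / S.α))
        = (Θ * (σ / 2 / Θ) + Θ * (S.MG * q)) * e := by rw [hΘ]; ring
      rw [this, mul_div_cancel₀ _ hΘ0.ne']
    rw [h2] at h1
    have h3 : q * e + (σ / 2 + Θ * (S.MG * q)) * e = σ * e := by
      have : (q + Θ * (S.MG * q)) * e = σ / 2 * e := by rw [hqσ]
      linarith
    linarith
  · intro v
    have a1 := hℓ₀ j hj v
    have a2 := S.G_le (D.sol κ - D.solH κ 𝒯') v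
    have a3 := hrel _ hTj
    have a4 := (hrel _ (hTj.refinement hT')).trans (mul_le_mul_of_nonneg_left hest hR0.le)
    -- Compactness applies only along the run, hence to `u - u_j`. The mesh `𝒯'` is arbitrary, but
    -- by reliability its error is already at most `R * q * e`.
    have e1 : D.solH κ 𝒯' - D.solH κ (𝒯 j)
        = (D.sol κ - D.solH κ (𝒯 j)) - (D.sol κ - D.solH κ 𝒯') := by abel
    rw [e1, map_sub, sub_apply]
    refine (abs_sub _ _).trans ((add_le_add a1 a2).trans ?_)
    rw [← add_mul]
    refine mul_le_mul_of_nonneg_right ?_ (norm_nonneg v)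
    have a5 := mul_le_mul_of_nonneg_left a3 (by positivity : 0 ≤ σ / 2 / Θ)
    have a6 := mul_le_mul_of_nonneg_left a4 hG.le
    linarith

end GOAFEM

/-! ### Assembly of the main theorem -/

theorem theorem2p7 (d : ℕ) (hd : 2 ≤ d) (Ω : Set (GOAFEM.Pt d)) (hΩ : IsOpen Ω)
    (hΩb : Bornology.IsBounded Ω) (κ : GOAFEM.Coeff d) (hκ : κ.Admissible Ω)
    (K : GOAFEM.GoalOp Ω) (hK : IsCompactOperator K) :
    -- (i), and (ii) for `θ_opt` built from constants of the combined estimator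
    (∀ θ Cstab Clip qred Crel : ℝ, 0 < θ → θ ≤ 1 → 0 < Cstab → 0 ≤ Clip →
      0 < qred → qred < 1 → 0 < Crel →
      ∃ (ℓ₀ : ℕ) (Clin qlin : ℝ), 0 < Clin ∧ 0 < qlin ∧ qlin < 1 ∧
        (∀ (D : GOAFEM.Data Ω) (Cmesh Cdrel Cmark : ℝ), 0 < Cmesh → 0 < Cdrel → 1 ≤ Cmark →
          D.MeshAssumptions Cmesh → D.Axioms κ K Cstab Clip qred Crel Cdrel →
          ∀ 𝒯 ℳ, D.IsRun κ K θ Cmark 𝒯 ℳ → ∀ ℓ n : ℕ, ℓ₀ ≤ ℓ → ℓ ≤ n →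
            D.est κ K (𝒯 n) ≤ Clin * qlin ^ (n - ℓ) * D.est κ K (𝒯 ℓ)) ∧
        (∀ Cmesh Cdrel Cmark Cs Cd s t : ℝ, 0 < Cmesh → 0 < Cdrel → 1 ≤ Cmark →
          0 < Cs → 0 < Cd → θ < GOAFEM.thetaOpt Cs Cd → 0 < s → 0 < t →
          ∃ Copt : ℝ, 0 < Copt ∧
            ∀ D : GOAFEM.Data Ω, D.MeshAssumptions Cmesh →
              D.Axioms κ K Cstab Clip qred Crel Cdrel → D.CombinedAxioms κ K Cs Cd →
              D.approxPrimal κ s + D.approxDual κ K t < ⊤ →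
              ∀ 𝒯 ℳ, D.IsRun κ K θ Cmark 𝒯 ℳ → ∀ ℓ : ℕ, ℓ₀ ≤ ℓ →
                D.RateBound κ K s t Copt (𝒯 ℓ))) ∧
    -- the combined estimator has such constants
    (∀ Cstab Clip qred Crel Cdrel : ℝ, 0 < Cstab → 0 ≤ Clip →
      0 < qred → qred < 1 → 0 < Crel → 0 < Cdrel →
      ∃ Cs Cd : ℝ, 0 < Cs ∧ 0 < Cd ∧
        ∀ (D : GOAFEM.Data Ω) (Cmesh : ℝ), 0 < Cmesh → D.MeshAssumptions Cmesh →
          D.Axioms κ K Cstab Clip qred Crel Cdrel → D.CombinedAxioms κ K Cs Cd) ∧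
    -- (ii) for `θ_opt` built from the constants of the two individual estimators
    (∀ θ Cstab Clip qred Crel Cdrel Cmesh Cmark : ℝ, 0 < Cstab → 0 ≤ Clip →
      0 < qred → qred < 1 → 0 < Crel → 0 < Cdrel → 0 < Cmesh → 1 ≤ Cmark →
      0 < θ → θ < GOAFEM.thetaOpt (Cstab + Clip) Cdrel →
      ∃ Copt : ℝ → ℝ → ℝ, (∀ s t : ℝ, 0 < Copt s t) ∧
        ∀ D : GOAFEM.Data Ω, D.MeshAssumptions Cmesh →
          D.Axioms κ K Cstab Clip qred Crel Cdrel →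
          ∀ 𝒯 ℳ, D.IsRun κ K θ Cmark 𝒯 ℳ → ∃ ℓ₀ : ℕ, ∀ s t : ℝ, 0 < s → 0 < t →
            D.approxPrimal κ s + D.approxDual κ K t < ⊤ → ∀ ℓ : ℕ, ℓ₀ ≤ ℓ →
              D.RateBound κ K s t
                (Copt s t * (((𝒯 ℓ₀).card - D.mesh₀.card : ℕ) + 1 : ℝ) ^ min (2 * s) (2 * t))
                (𝒯 ℓ)) := by
  obtain ⟨S⟩ := GOAFEM.nonempty_setting hd hΩb hκ K
  refine ⟨?_, ?_, ?_⟩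
  · intro θ Cstab Clip qred Crel hθ hθ1 hs hl hq0 hq hr
    obtain ⟨Clin, qlin, hC, h0, h1, hlin⟩ := S.exists_linear_convergence hθ hθ1 hs hl hq0 hq hr
    -- The generalized quasi-orthogonality has no preasymptotic phase, so `ℓ₀ = 0` serves both
    -- claims.
    refine ⟨0, Clin, qlin, hC, h0, h1, ?_, ?_⟩
    · intro D Cmesh Cdrel Cmark _ _ _ hM hA 𝒯 ℳ hrun ℓ n _ hn
      exact hlin D Cmesh Cdrel Cmark hM hA 𝒯 ℳ hrun ℓ n hn
    · intro Cmesh Cdrel Cmark Cs Cd s t hCm hdr hCmark hCs hCd hθ' hs' ht'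
      have hθ2 : θ < (1 + (Cs * Cd) ^ 2)⁻¹ := by rwa [mul_pow]
      have hq' := GOAFEM.lambda_mul_sqrt_lt hθ (mul_nonneg hCs.le hCd.le) hθ2
      obtain ⟨Copt, hCopt, h⟩ := S.exists_rate hθ hθ1 hs hl hq0 hq hr hdr hCm hCmark hq' hs' ht'
      refine ⟨Copt, hCopt, fun D hM hA hcomb hfin 𝒯 ℳ hrun ℓ _ => ?_⟩
      have h2 := h D hM hA hfin 𝒯 ℳ hrun 0 (fun j _ 𝒯' hT' hest =>
        hcomb.doerfler S hCs hCd hθ hθ1 hq'.le le_rfl (hrun.isMesh j) hT' hest) ℓ (Nat.zero_le ℓ)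
      -- With `ℓ₀ = 0` no elements have been added yet, and the factor `(0 + 1) ^ β` disappears.
      rw [hrun.init, Nat.sub_self, Nat.cast_zero, zero_add, Real.one_rpow, mul_one] at h2
      exact h2
  · intro Cstab Clip qred Crel Cdrel hs hl _ _ _ hdr
    obtain ⟨Cs, Cd, hCs, hCd, h⟩ :=
      S.exists_combinedAxioms (qred := qred) (Crel := Crel) hs hl hdr
    exact ⟨Cs, Cd, hCs, hCd, fun D _ _ _ hA => h D hA⟩
  · intro θ Cstab Clip qred Crel Cdrel Cmesh Cmark hs hl hq0 hq hr hdr hCm hCmark hθ hθ'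
    have hθ1 : θ ≤ 1 := hθ'.le.trans (inv_le_one_of_one_le₀
      (le_add_of_nonneg_right (by positivity)))
    obtain ⟨q, hq', hev⟩ := S.exists_doerfler_eventually (Cmesh := Cmesh) (Cmark := Cmark) hK hθ hθ'
      hs hl hq0 hq hr hdr
    have hrate : ∀ s t : ℝ, ∃ Copt : ℝ, 0 < Copt ∧ (0 < s → 0 < t → _) := fun s t => by
      by_cases hst : 0 < s ∧ 0 < t
      · obtain ⟨C, hC, h⟩ := S.exists_rate hθ hθ1 hs hl hq0 hq hr hdr hCm hCmark hq' hst.1 hst.2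
        exact ⟨C, hC, fun _ _ => h⟩
      -- A dummy value, since `Copt` must be positive for all real `s` and `t`.
      · exact ⟨1, one_pos, fun h1 h2 => absurd ⟨h1, h2⟩ hst⟩
    choose Copt hCopt h using hrate
    refine ⟨Copt, hCopt, fun D hM hA 𝒯 ℳ hrun => ?_⟩
    obtain ⟨ℓ₀, hℓ₀⟩ := hev D hM hA 𝒯 ℳ hrun
    exact ⟨ℓ₀, fun s t hs' ht' hfin ℓ hℓ => h s t hs' ht' D hM hA hfin 𝒯 ℳ hrun ℓ₀ hℓ₀ ℓ hℓ⟩
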